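/- **Setting.** Let $\nu\ge 2$ be an integer, $G$ an (additively written) abelian group and $\sigma:G\to\mathbb C^\times$ a character; write $\tilde\alpha=\sigma(\alpha)$. *The Lie algebra.* Let $\mathcal R_\sigma$ be the skew Laurent polynomial ring with basis $t^me^\alpha$ ($m\in\mathbb Z,\alpha\in G$) and product $(t^me^\alpha)(t^ne^\beta)=\tilde\alpha^{\,n}t^{m+n}e^{\alpha+\beta}$, with the anti-involution $\overline{t^me^\alpha}=(-\tilde\alpha)^{-m}t^me^{-\alpha}$. Let $\mathfrak u_\nu(\mathcal R_\sigma,\bar{\ })=\{X\in M_\nu(\mathcal R_\sigma): \overline X^{\,t}=-X\}$, and let $\widehat{\mathfrak u}_\nu(\mathcal R_\sigma,\bar{\ })=\mathfrak u_\nu(\mathcal R_\sigma,\bar{\ })\oplus\mathbb Cc$ be the subalgebra of the central extension $gl_\nu(\mathcal R_\sigma)\oplus\mathbb Cc$ ($c$ central) with bracket $$[E_{ij}t^me^\alpha,E_{kl}t^ne^\beta]=\delta_{jk}\tilde\alpha^{\,n}E_{il}t^{m+n}e^{\alpha+\beta}-\delta_{il}\tilde\beta^{\,m}E_{kj}t^{m+n}e^{\alpha+\beta}+m\,\delta_{il}\delta_{jk}\delta_{m+n,0}\delta_{\tilde\alpha\tilde\beta,1}\tilde\alpha^{\,n}c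 .$$ Together with $c$ it is spanned by the elements $e_{ij}(m,\alpha)=E_{ij}t^me^\alpha-E_{ji}\overline{t^me^\alpha}$. *The Fock space.* Let $\Gamma=\bigoplus_{i=1}^\nu\mathbb Z\epsilon_i$, $\bar\Gamma=\Gamma/2\Gamma$, and let $\mathbb C[\bar\Gamma]$ be the twisted group algebra with $e^{\bar\alpha}e^{\bar\beta}=\varepsilon(\alpha,\beta)e^{\overline{\alpha+\beta}}$, where $\varepsilon$ is bimultiplicative, $\varepsilon(\epsilon_i,\epsilon_j)=1$ for $i\le j$ and $-1$ for $i>j$. Let $S(\mathcal H^-)$ be the polynomial algebra in the variables $\epsilon_i(n)$ ($1\le i\le\nu$, $n<0$ odd). For $n<0$ odd, $\epsilon_i(n)$ acts on it by multiplication, and for $n>0$ odd by $\frac n2\,\partial/\partial\epsilon_i(-n)$; for $\alpha=\sum_i a_i\epsilon_i\in\Gamma$ put $\alpha(n)=\sum_i a_i\epsilon_i(n)$. Put $M=\mathbb C[\bar\Gamma]\otimes S(\mathcal H^-)$. With $E_\pm(\alpha,z)=\exp\bigl(-2\sum_{n\in\pm(2\mathbb N+1)}\frac{\alpha(n)}nz^{-n}\bigr)$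 and $a\in\mathbb C^\times$ define $X_{ij}(a,z)=\sum_{n\in\mathbb Z}x_{ij}(a,n)z^{-n}$ as $$X_{ij}(a,z)=\begin{cases}\varepsilon(\epsilon_i,\epsilon_j)e^{\overline{\epsilon_i-\epsilon_j}}E_-(\epsilon_i,z)E_-(-\epsilon_j,az)E_+(\epsilon_i,z)E_+(-\epsilon_j,az), & i\ne j,\\ 4\sum_{n\ \mathrm{odd}}\epsilon_i(n)z^{-n}, & i=j,\ a=1,\\ \frac{1+a}{1-a}\bigl(E_-(\epsilon_i,z)E_-(-\epsilon_i,az)E_+(\epsilon_i,z)E_+(-\epsilon_i,az)-1\bigr), & i=j,\ a\ne1,\end{cases}$$ where $e^{\overline{\epsilon_i-\epsilon_j}}$ acts on $\mathbb C[\bar\Gamma]$ by left multiplication. *The spaces $V_\nu(\gamma)$.* For $\rho=\pm1$ and $1\le j\le\nu$ let $w_j(\rho)=1+\sqrt{-1}\,\rho\,e^{\bar\epsilon_j}$ if $j$ is odd and $w_j(\rho)=1+\rho\,e^{\bar\epsilon_j}$ if $j$ is even, and let $w(\rho_1,\dots,\rho_\nu)=w_1(\rho_1)\cdots w_\nu(\rho_\nu)\in\mathbb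 C[\bar\Gamma]$. Let $d=[\nu/2]$. For $\gamma=(\gamma_1,\dots,\gamma_{d+1})\in\{\pm1\}^{d+1}$ let $V_\nu(\gamma)$ be the span of all $w(\rho_1,\dots,\rho_\nu)$, $\rho_j\in\{\pm1\}$, such that - if $\nu=2d+1$: $\rho_1=\gamma_1$ and $\rho_{2j}\rho_{2j+1}=\gamma_{j+1}$ for $1\le j\le d$; - if $\nu=2d$: $\rho_1=\gamma_1$, $\rho_{2j}\rho_{2j+1}=\gamma_{j+1}$ for $1\le j\le d-1$, and $\rho_{2d}=\gamma_{d+1}$. **Theorem.** There is a $\widehat{\mathfrak u}_\nu(\mathcal R_\sigma,\bar{\ })$-module structure on $M$ in which $c$ acts as $\frac12$ and, for all $1\le i,j\le\nu$, $m\in\mathbb Z$, $\alpha\in G$, the element $2e_{ij}(m,\alpha)$ acts as $x_{ij}(\tilde\alpha,m)$ if $i\neq j$ or $\tilde\alpha=1$ or $m\ne0$, and as $x_{ii}(\tilde\alpha,0)+\frac{1+\tilde\alpha}{1-\tilde\alpha}$ if $i=j$, $\tilde\alpha\ne1$ and $m=0$. The $\widehat{\mathfrak u}_\nu(\mathcal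 R_\sigma,\bar{\ })$-module $M$ is completely reducible. Moreover, $$M=\bigoplus_{\gamma\in\{\pm1\}^{[\nu/2]+1}}V_\nu(\gamma)\otimes S(\mathcal H^-),$$ where each $V_\nu(\gamma)\otimes S(\mathcal H^-)$ is a submodule and is irreducible as a $\widehat{\mathfrak u}_\nu(\mathcal R_\sigma,\bar{\ })$-module. -/

import Mathlib

/-! ## Twisted group algebras -/

namespace UnitaryVertex

open scoped TensorProduct

noncomputable section

/-- A bimultiplicative map `A × A → ℂˣ` on an additive abelian group, in particular a two-cocycle. -/
structure Bichar (A : Type*) [AddCommGroup A] where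
  toFun : A → A → ℂ
  zero_left : ∀ b, toFun 0 b = 1
  zero_right : ∀ a, toFun a 0 = 1
  add_left : ∀ a a' b, toFun (a + a') b = toFun a b * toFun a' b
  add_right : ∀ a b b', toFun a (b + b') = toFun a b * toFun a b'

/-- The twisted group algebra of `A`: the vector space with basis `e^a` (`a ∈ A`), where
`e^a e^b = ε(a, b) e^(a + b)`. -/
def TwistedGroupAlgebra {A : Type*} [AddCommGroup A] (_ε : Bichar A) : Type _ := A →₀ ℂ

namespace TwistedGroupAlgebra

variable {A : Type*} [AddCommGroup A] (ε : Bichar A)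

instance : AddCommGroup (TwistedGroupAlgebra ε) := inferInstanceAs (AddCommGroup (A →₀ ℂ))

instance : Module ℂ (TwistedGroupAlgebra ε) := inferInstanceAs (Module ℂ (A →₀ ℂ))

/-- The element `x e^a`. -/
def term (a : A) (x : ℂ) : TwistedGroupAlgebra ε := Finsupp.single a x

/-- The basis element `e^a`. -/
def exp (a : A) : TwistedGroupAlgebra ε := term ε a 1

/-- Linear maps out of the twisted group algebra, given by the values at the basis `e^a`. -/
def lift {V : Type*} [AddCommGroup V] [Module ℂ V] (f : A → V) :
    TwistedGroupAlgebra ε →ₗ[ℂ] V := Finsupp.linearCombination ℂ f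

variable {ε}

theorem lift_term {V : Type*} [AddCommGroup V] [Module ℂ V] (f : A → V) (a : A) (x : ℂ) :
    lift ε f (term ε a x) = x • f a := Finsupp.linearCombination_single ℂ x a

theorem smul_term (c : ℂ) (a : A) (x : ℂ) : c • term ε a x = term ε a (c * x) :=
  Finsupp.smul_single c a x

theorem induction {p : TwistedGroupAlgebra ε → Prop} (f : TwistedGroupAlgebra ε) (h0 : p 0)
    (hadd : ∀ f g, p f → p g → p (f + g)) (hterm : ∀ a x, p (term ε a x)) : p f :=
  Finsupp.induction_linear f h0 hadd hterm

/-- The multiplication as a bilinear map. -/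
def mulBilin (ε : Bichar A) :
    TwistedGroupAlgebra ε →ₗ[ℂ] TwistedGroupAlgebra ε →ₗ[ℂ] TwistedGroupAlgebra ε :=
  lift ε fun a => lift ε fun b => term ε (a + b) (ε.toFun a b)

instance : Mul (TwistedGroupAlgebra ε) := ⟨fun f g => mulBilin ε f g⟩

instance : One (TwistedGroupAlgebra ε) := ⟨exp ε 0⟩

theorem mul_def (f g : TwistedGroupAlgebra ε) : f * g = mulBilin ε f g := rfl

theorem term_mul_term (a b : A) (x y : ℂ) :
    term ε a x * term ε b y = term ε (a + b) (ε.toFun a b * (x * y)) := by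
  rw [mul_def, mulBilin, lift_term, LinearMap.smul_apply, lift_term, smul_term, smul_term]
  congr 1; ring

theorem one_def : (1 : TwistedGroupAlgebra ε) = term ε 0 1 := rfl

instance : NonUnitalNonAssocRing (TwistedGroupAlgebra ε) where
  __ := (inferInstance : AddCommGroup (TwistedGroupAlgebra ε))
  left_distrib f g h := by simp only [mul_def, map_add]
  right_distrib f g h := by simp only [mul_def, map_add, LinearMap.add_apply]
  zero_mul f := by simp only [mul_def, map_zero, LinearMap.zero_apply]
  mul_zero f := by simp only [mul_def, map_zero]

instance : Ring (TwistedGroupAlgebra ε) where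
  __ := (inferInstance : NonUnitalNonAssocRing (TwistedGroupAlgebra ε))
  mul_assoc f g h := by
    induction f using induction with
    | h0 => simp
    | hadd f f' hf hf' => simp only [add_mul, hf, hf']
    | hterm a x =>
      induction g using induction with
      | h0 => simp
      | hadd f f' hf hf' => simp only [add_mul, mul_add, hf, hf']
      | hterm b y =>
        induction h using induction with
        | h0 => simp
        | hadd f f' hf hf' => simp only [mul_add, hf, hf']
        | hterm c z =>
          simp only [term_mul_term, ε.add_left, ε.add_right, add_assoc]
          congr 1; ring
  one_mul f := by
    induction f using induction with
    | h0 => simp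
    | hadd f f' hf hf' => simp only [mul_add, hf, hf']
    | hterm a x => simp [one_def, term_mul_term, ε.zero_left]
  mul_one f := by
    induction f using induction with
    | h0 => simp
    | hadd f f' hf hf' => simp only [add_mul, hf, hf']
    | hterm a x => simp [one_def, term_mul_term, ε.zero_right]

instance : Algebra ℂ (TwistedGroupAlgebra ε) :=
  Algebra.ofModule
    (fun r f g => by simp only [mul_def, map_smul, LinearMap.smul_apply])
    (fun r f g => by simp only [mul_def, map_smul])

end TwistedGroupAlgebra

open TwistedGroupAlgebra

/-! ## The skew Laurent polynomial ring, the unitary Lie algebra and its central extension -/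

section Unitary

variable {G : Type*} [AddCommGroup G] (σ : AddChar G ℂ)

theorem char_ne_zero (α : G) : σ α ≠ 0 := fun h => by
  have h1 : σ α * σ (-α) = 1 := by rw [← AddChar.map_add_eq_mul, add_neg_cancel, AddChar.map_zero_eq_one]
  rw [h, zero_mul] at h1
  exact zero_ne_one h1

/-- The twist `((m, α), (n, β)) ↦ σ(α)^n`. -/
def skewBichar : Bichar (ℤ × G) where
  toFun p q := σ p.2 ^ q.1
  zero_left q := by simp
  zero_right p := by simp
  add_left p p' q := by simp [AddChar.map_add_eq_mul, mul_zpow]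
  add_right p q q' := by simp [zpow_add₀ (char_ne_zero σ _)]

theorem skewBichar_apply (p q : ℤ × G) : (skewBichar σ).toFun p q = σ p.2 ^ q.1 := rfl

/-- The skew Laurent polynomial ring `R_σ = ℂ[G][t^±1, σ]`, with basis `t^m e^α` and
`(t^m e^α)(t^n e^β) = σ(α)^n t^(m+n) e^(α+β)`, that is `e^α t^n = σ(α)^n t^n e^α`. -/
abbrev SkewLaurent : Type _ := TwistedGroupAlgebra (skewBichar σ)

/-- The monomial `t^m e^α`. -/
def monom (m : ℤ) (α : G) : SkewLaurent σ := TwistedGroupAlgebra.exp (skewBichar σ) (m, α)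

/-- The anti-involution with `t ↦ -t` and `e^α ↦ e^(-α)`, so `t^m e^α ↦ (-σ(α))^(-m) t^m e^(-α)`. -/
def bar : SkewLaurent σ →ₗ[ℂ] SkewLaurent σ :=
  lift (skewBichar σ) fun p => (-σ p.2) ^ (-p.1) • monom σ p.1 (-p.2)

theorem bar_term (p : ℤ × G) (x : ℂ) : bar σ (term (skewBichar σ) p x) =
    term (skewBichar σ) (p.1, -p.2) (x * (-σ p.2) ^ (-p.1)) := by
  rw [bar, lift_term, monom, TwistedGroupAlgebra.exp, smul_term, smul_term]
  simp

theorem char_neg (α : G) : σ (-α) = (σ α)⁻¹ := AddChar.map_neg_eq_inv σ α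

/-- The anti-involution as a star operation, so that `Matrix.conjTranspose` is `X ↦ X̄ᵗ`. -/
instance : StarRing (SkewLaurent σ) where
  star := bar σ
  star_involutive f := by
    induction f using TwistedGroupAlgebra.induction with
    | h0 => exact (congrArg _ (map_zero _)).trans (map_zero _)
    | hadd f g hf hg =>
      change bar σ (bar σ _) = _ at *
      rw [map_add, map_add, hf, hg]
    | hterm p x =>
      change bar σ (bar σ _) = _
      have h : σ p.2 ≠ 0 := char_ne_zero σ _
      rw [bar_term, bar_term]
      simp only [neg_neg, Prod.mk.eta, char_neg]
      congr 1
      rw [mul_assoc, ← mul_zpow]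
      have : (-σ p.2) * (-(σ p.2)⁻¹) = 1 := by field_simp
      rw [this]; simp
  star_mul f g := by
    change bar σ _ = bar σ _ * bar σ _
    induction f using TwistedGroupAlgebra.induction with
    | h0 => simp
    | hadd f f' hf hf' => simp only [add_mul, mul_add, map_add, hf, hf']
    | hterm p x =>
      induction g using TwistedGroupAlgebra.induction with
      | h0 => simp
      | hadd f f' hf hf' => simp only [add_mul, mul_add, map_add, hf, hf']
      | hterm q y =>
        have h : σ p.2 ≠ 0 := char_ne_zero σ _
        have h' : σ q.2 ≠ 0 := char_ne_zero σ _
        simp only [term_mul_term, bar_term, skewBichar_apply, Prod.fst_add, Prod.snd_add,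
          AddChar.map_add_eq_mul, neg_add, char_neg]
        rw [Prod.mk_add_mk, add_comm q.1, add_comm (-q.2)]
        congr 1
        have e1 : -(σ p.2 * σ q.2) = (-1) * (σ p.2 * σ q.2) := by ring
        have e2 : -σ p.2 = (-1) * σ p.2 := by ring
        have e3 : -σ q.2 = (-1) * σ q.2 := by ring
        rw [e1, e2, e3]
        simp only [mul_zpow, inv_zpow', zpow_add₀ h, zpow_add₀ h',
          zpow_add₀ (show (-1 : ℂ) ≠ 0 by norm_num), zpow_neg]
        field_simp
  star_add f g := map_add (bar σ) f g

theorem star_eq_bar (f : SkewLaurent σ) : star f = bar σ f := rfl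

/-- The degree derivation `t^m e^α ↦ m t^m e^α`. -/
def degDer : SkewLaurent σ →ₗ[ℂ] SkewLaurent σ :=
  lift (skewBichar σ) fun p => (p.1 : ℂ) • monom σ p.1 p.2

theorem degDer_term (p : ℤ × G) (x : ℂ) :
    degDer σ (term (skewBichar σ) p x) = term (skewBichar σ) p (x * p.1) := by
  rw [degDer, lift_term, monom, TwistedGroupAlgebra.exp, smul_term, smul_term]
  simp

theorem degDer_mul (f g : SkewLaurent σ) : degDer σ (f * g) = degDer σ f * g + f * degDer σ g := by
  induction f using TwistedGroupAlgebra.induction with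
  | h0 => simp
  | hadd f f' hf hf' => simp only [add_mul, map_add, hf, hf']; abel
  | hterm p x =>
    induction g using TwistedGroupAlgebra.induction with
    | h0 => simp
    | hadd f f' hf hf' => simp only [mul_add, map_add, hf, hf']; abel
    | hterm q y =>
      simp only [term_mul_term, degDer_term]
      refine Eq.trans ?_ (Finsupp.single_add _ _ _)
      change term _ _ _ = term _ _ _
      congr 1
      simp only [Prod.fst_add, Int.cast_add]
      ring

open Classical in
/-- The functional with `t^m e^α ↦ 1` if `m = 0` and `σ(α) = 1`, and `t^m e^α ↦ 0` otherwise. -/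
def traceForm : SkewLaurent σ →ₗ[ℂ] ℂ :=
  lift (skewBichar σ) fun p => if p.1 = 0 ∧ σ p.2 = 1 then 1 else 0

theorem traceForm_degDer (f : SkewLaurent σ) : traceForm σ (degDer σ f) = 0 := by
  induction f using TwistedGroupAlgebra.induction with
  | h0 => simp
  | hadd f f' hf hf' => simp only [map_add, hf, hf', add_zero]
  | hterm p x =>
    rw [degDer_term, traceForm, lift_term]
    split_ifs with h <;> simp [h]

theorem traceForm_mul_comm (f g : SkewLaurent σ) : traceForm σ (f * g) = traceForm σ (g * f) := by
  induction f using TwistedGroupAlgebra.induction with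
  | h0 => simp
  | hadd f f' hf hf' => simp only [add_mul, mul_add, map_add, hf, hf']
  | hterm p x =>
    induction g using TwistedGroupAlgebra.induction with
    | h0 => simp
    | hadd f f' hf hf' => simp only [add_mul, mul_add, map_add, hf, hf']
    | hterm q y =>
      simp only [term_mul_term, traceForm, lift_term, skewBichar_apply, Prod.fst_add, Prod.snd_add,
        AddChar.map_add_eq_mul, add_comm q.1, mul_comm (σ q.2)]
      split_ifs with h
      · have h1 : q.1 = -p.1 := by omega
        have h2 : σ q.2 = (σ p.2)⁻¹ := eq_inv_of_mul_eq_one_right h.2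
        rw [h1, h2, inv_zpow', mul_comm x]
      · simp

variable (ν : ℕ)

/-- The two-cocycle on `gl_ν(R_σ)` with
`(E_ij t^m e^α, E_kl t^n e^β) ↦ m δ_il δ_jk δ_{m+n,0} δ_{σ(α)σ(β),1} σ(α)^n`. -/
def cocycle (X Y : Matrix (Fin ν) (Fin ν) (SkewLaurent σ)) : ℂ :=
  traceForm σ (Matrix.trace (X.map (degDer σ) * Y))

theorem traceForm_trace_comm (X Y : Matrix (Fin ν) (Fin ν) (SkewLaurent σ)) :
    traceForm σ (Matrix.trace (X * Y)) = traceForm σ (Matrix.trace (Y * X)) := by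
  simp only [Matrix.trace, Matrix.diag, Matrix.mul_apply, map_sum]
  rw [Finset.sum_comm]
  simp only [traceForm_mul_comm σ (X _ _)]

theorem map_degDer_mul (X Y : Matrix (Fin ν) (Fin ν) (SkewLaurent σ)) :
    (X * Y).map (degDer σ) = X.map (degDer σ) * Y + X * Y.map (degDer σ) := by
  ext1 i j
  simp only [Matrix.map_apply, Matrix.mul_apply, map_sum, degDer_mul, Matrix.add_apply,
    Finset.sum_add_distrib]

theorem cocycle_self (X : Matrix (Fin ν) (Fin ν) (SkewLaurent σ)) : cocycle σ ν X X = 0 := by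
  have h : traceForm σ (Matrix.trace ((X * X).map (degDer σ))) = 0 := by
    simp only [Matrix.trace, Matrix.diag, Matrix.map_apply, map_sum, traceForm_degDer,
      Finset.sum_const_zero]
  rw [map_degDer_mul, Matrix.trace_add, map_add, traceForm_trace_comm σ ν X] at h
  have h2 : (2 : ℂ) * cocycle σ ν X X = 0 := by rw [two_mul]; exact h
  simpa using h2

/-- The central extension `gl_ν(R_σ) ⊕ ℂ c`; the pair `(X, s)` stands for `X + s c`. -/
def GlHat : Type _ := Matrix (Fin ν) (Fin ν) (SkewLaurent σ) × ℂ

instance : AddCommGroup (GlHat σ ν) :=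
  inferInstanceAs (AddCommGroup (Matrix (Fin ν) (Fin ν) (SkewLaurent σ) × ℂ))

instance : Module ℂ (GlHat σ ν) :=
  inferInstanceAs (Module ℂ (Matrix (Fin ν) (Fin ν) (SkewLaurent σ) × ℂ))

variable {σ ν} in
/-- The underlying matrix of an element of the central extension. -/
def GlHat.mat (x : GlHat σ ν) : Matrix (Fin ν) (Fin ν) (SkewLaurent σ) := x.1

/-- `[X + s c, Y + t c] = (X Y - Y X) + cocycle(X, Y) c`. -/
instance : Bracket (GlHat σ ν) (GlHat σ ν) where
  bracket x y := (x.mat * y.mat - y.mat * x.mat, cocycle σ ν x.mat y.mat)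

theorem GlHat.lie_def (x y : GlHat σ ν) :
    ⁅x, y⁆ = (x.mat * y.mat - y.mat * x.mat, cocycle σ ν x.mat y.mat) := rfl

theorem GlHat.mat_add (x y : GlHat σ ν) : (x + y).mat = x.mat + y.mat := rfl

theorem GlHat.mat_smul (r : ℂ) (x : GlHat σ ν) : (r • x).mat = r • x.mat := rfl

theorem GlHat.mat_lie (x y : GlHat σ ν) : (⁅x, y⁆).mat = x.mat * y.mat - y.mat * x.mat := rfl

theorem cocycle_add_left (X Y Z : Matrix (Fin ν) (Fin ν) (SkewLaurent σ)) :
    cocycle σ ν (X + Y) Z = cocycle σ ν X Z + cocycle σ ν Y Z := by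
  simp only [cocycle, Matrix.map_add _ (map_add (degDer σ)), add_mul, Matrix.trace_add, map_add]

theorem cocycle_add_right (X Y Z : Matrix (Fin ν) (Fin ν) (SkewLaurent σ)) :
    cocycle σ ν X (Y + Z) = cocycle σ ν X Y + cocycle σ ν X Z := by
  simp only [cocycle, mul_add, Matrix.trace_add, map_add]

theorem cocycle_sub_left (X Y Z : Matrix (Fin ν) (Fin ν) (SkewLaurent σ)) :
    cocycle σ ν (X - Y) Z = cocycle σ ν X Z - cocycle σ ν Y Z := by
  simp only [cocycle, Matrix.map_sub _ (map_sub (degDer σ)), sub_mul, Matrix.trace_sub, map_sub]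

theorem cocycle_sub_right (X Y Z : Matrix (Fin ν) (Fin ν) (SkewLaurent σ)) :
    cocycle σ ν X (Y - Z) = cocycle σ ν X Y - cocycle σ ν X Z := by
  simp only [cocycle, mul_sub, Matrix.trace_sub, map_sub]

theorem cocycle_smul_right (r : ℂ) (X Y : Matrix (Fin ν) (Fin ν) (SkewLaurent σ)) :
    cocycle σ ν X (r • Y) = r * cocycle σ ν X Y := by
  simp only [cocycle, Matrix.mul_smul, Matrix.trace_smul, map_smul, smul_eq_mul]

theorem cocycle_leibniz (X Y Z : Matrix (Fin ν) (Fin ν) (SkewLaurent σ)) :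
    cocycle σ ν X (Y * Z - Z * Y) =
      cocycle σ ν (X * Y - Y * X) Z + cocycle σ ν Y (X * Z - Z * X) := by
  have h1 := traceForm_trace_comm σ ν X (Y.map (degDer σ) * Z)
  have h2 := traceForm_trace_comm σ ν Y (X.map (degDer σ) * Z)
  simp only [cocycle_sub_left, cocycle_sub_right]
  simp only [cocycle, map_degDer_mul, add_mul, Matrix.trace_add, map_add, ← mul_assoc] at h1 h2 ⊢
  rw [h1, h2]
  ring

instance : LieRing (GlHat σ ν) where
  add_lie x y z := Prod.ext (by simp only [GlHat.lie_def, GlHat.mat_add]; exact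
    (by rw [add_mul, mul_add]; abel : (x.mat + y.mat) * z.mat - z.mat * (x.mat + y.mat) =
      (x.mat * z.mat - z.mat * x.mat) + (y.mat * z.mat - z.mat * y.mat)))
    (cocycle_add_left σ ν _ _ _)
  lie_add x y z := Prod.ext (by simp only [GlHat.lie_def, GlHat.mat_add]; exact
    (by rw [add_mul, mul_add]; abel : x.mat * (y.mat + z.mat) - (y.mat + z.mat) * x.mat =
      (x.mat * y.mat - y.mat * x.mat) + (x.mat * z.mat - z.mat * x.mat)))
    (cocycle_add_right σ ν _ _ _)
  lie_self x := Prod.ext (sub_self _) (cocycle_self σ ν _)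
  leibniz_lie x y z := Prod.ext
    (by
      change x.mat * (y.mat * z.mat - z.mat * y.mat) - (y.mat * z.mat - z.mat * y.mat) * x.mat =
        ((x.mat * y.mat - y.mat * x.mat) * z.mat - z.mat * (x.mat * y.mat - y.mat * x.mat)) +
        (y.mat * (x.mat * z.mat - z.mat * x.mat) - (x.mat * z.mat - z.mat * x.mat) * y.mat)
      noncomm_ring)
    (cocycle_leibniz σ ν _ _ _)

instance : LieAlgebra ℂ (GlHat σ ν) where
  lie_smul r x y := Prod.ext
    (by
      change x.mat * (r • y.mat) - (r • y.mat) * x.mat = r • (x.mat * y.mat - y.mat * x.mat)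
      rw [Matrix.mul_smul, Matrix.smul_mul, smul_sub])
    (cocycle_smul_right σ ν _ _ _)

/-- The element `E_ij t^m e^α`. -/
def GlHat.unit (i j : Fin ν) (m : ℤ) (α : G) : GlHat σ ν := (Matrix.single i j (monom σ m α), 0)

/-- The central element `c`. -/
def GlHat.central : GlHat σ ν := (0, 1)

open Classical in
/-- The bracket of `gl_ν(R_σ) ⊕ ℂ c` on the spanning elements. -/
theorem GlHat.lie_unit (i j k l : Fin ν) (m n : ℤ) (α β : G) :
    ⁅GlHat.unit σ ν i j m α, GlHat.unit σ ν k l n β⁆ =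
      (if j = k then σ α ^ n • GlHat.unit σ ν i l (m + n) (α + β) else 0)
      - (if i = l then σ β ^ m • GlHat.unit σ ν k j (m + n) (α + β) else 0)
      + (if i = l ∧ j = k ∧ m + n = 0 ∧ σ α * σ β = 1 then
          ((m : ℂ) * σ α ^ n) • GlHat.central σ ν else 0) := by
  have hm : ∀ (m n : ℤ) (α β : G), monom σ m α * monom σ n β =
      σ α ^ n • monom σ (m + n) (α + β) := fun m n α β => by
    simp only [monom, TwistedGroupAlgebra.exp, term_mul_term, smul_term, skewBichar_apply, mul_one,
      Prod.mk_add_mk]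
  have h1 : ∀ (i j k l : Fin ν) (x y : SkewLaurent σ),
      Matrix.single i j x * Matrix.single k l y =
        if j = k then Matrix.single i l (x * y) else 0 := fun i j k l x y => by
    split_ifs with h
    · subst h; simp
    · exact Matrix.single_mul_single_of_ne _ i j k h y
  have h2 : cocycle σ ν (Matrix.single i j (monom σ m α)) (Matrix.single k l (monom σ n β)) =
      if i = l ∧ j = k ∧ m + n = 0 ∧ σ α * σ β = 1 then (m : ℂ) * σ α ^ n else 0 := by
    rw [cocycle, Matrix.map_single _ _ _ (degDer σ), h1]
    by_cases hjk : j = k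
    · by_cases hil : i = l
      · subst hjk hil
        simp only [if_true, Matrix.trace_single_eq_same, monom, TwistedGroupAlgebra.exp,
          degDer_term, term_mul_term, traceForm, lift_term, skewBichar_apply, Prod.mk_add_mk,
          AddChar.map_add_eq_mul, true_and]
        split_ifs <;> simp [mul_comm]
      · rw [if_pos hjk, if_neg (fun h => hil h.1), Matrix.trace_single_eq_of_ne _ _ _ hil, map_zero]
    · simp [hjk]
  have h3 : ∀ (i j k l : Fin ν) (m n : ℤ) (α β : G),
      Matrix.single i j (monom σ m α) * Matrix.single k l (monom σ n β) =
        (if j = k then σ α ^ n • GlHat.unit σ ν i l (m + n) (α + β) else 0).mat :=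
    fun i j k l m n α β => by
      rw [h1, hm]
      split_ifs
      · exact (Matrix.smul_single _ _ _ _).symm
      · rfl
  have h4 : ∀ (p : Prop) [Decidable p] (r : ℂ) (i j : Fin ν) (m : ℤ) (α : G),
      (if p then r • GlHat.unit σ ν i j m α else 0).2 = 0 := fun p _ r i j m α => by
    split_ifs
    · exact mul_zero r
    · rfl
  have h5 : ∀ (p : Prop) [Decidable p] (r : ℂ),
      (if p then r • GlHat.central σ ν else 0).mat = 0 := fun p _ r => by
    split_ifs
    · exact smul_zero r
    · rfl
  have h6 : ∀ (p : Prop) [Decidable p] (r : ℂ),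
      (if p then r • GlHat.central σ ν else 0).2 = if p then r else 0 := fun p _ r => by
    split_ifs
    · exact mul_one r
    · rfl
  refine Prod.ext ?_ ?_
  · refine Eq.trans (congrArg₂ (· - ·) (h3 i j k l m n α β) (h3 k l i j n m β α)) ?_
    refine Eq.trans ?_ (congrArg (_ + ·) (h5 _ _).symm)
    rw [add_zero, add_comm n m, add_comm β α]
    simp only [eq_comm (a := l)]
    rfl
  · refine Eq.trans h2 ?_
    refine Eq.trans ?_ (congrArg₂ (· + ·) (congrArg₂ (· - ·) (h4 _ _ _ _ _ _) (h4 _ _ _ _ _ _)).symm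
      (h6 _ _).symm)
    simp

theorem star_smul_skew (r : ℂ) (f : SkewLaurent σ) : star (r • f) = r • star f :=
  map_smul (bar σ) r f

/-- The Lie algebra `{X ∈ gl_ν(R_σ) | X* = -X} ⊕ ℂ c`, where `X* = X̄ᵗ`. -/
def UHat : LieSubalgebra ℂ (GlHat σ ν) where
  carrier := {x | x.mat.conjTranspose = -x.mat}
  add_mem' {x y} hx hy := by
    simp only [Set.mem_ofPred_eq, GlHat.mat_add, Matrix.conjTranspose_add] at *
    rw [hx, hy, neg_add]
  zero_mem' := by
    change (0 : Matrix (Fin ν) (Fin ν) (SkewLaurent σ)).conjTranspose = -0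
    simp
  smul_mem' r x hx := by
    simp only [Set.mem_ofPred_eq, GlHat.mat_smul] at *
    rw [← smul_neg, ← hx]
    ext1 i j
    simp only [Matrix.conjTranspose_apply, Matrix.smul_apply, star_smul_skew]
  lie_mem' {x y} hx hy := by
    simp only [Set.mem_ofPred_eq, GlHat.mat_lie] at *
    have hx : x.mat.conjTranspose = -x.mat := hx
    have hy : y.mat.conjTranspose = -y.mat := hy
    rw [Matrix.conjTranspose_sub, Matrix.conjTranspose_mul, Matrix.conjTranspose_mul, hx, hy]
    noncomm_ring

/-- The element `e_ij(m, α) = E_ij t^m e^α - E_ji \overline{t^m e^α}`. -/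
def uElt (i j : Fin ν) (m : ℤ) (α : G) : UHat σ ν :=
  ⟨(Matrix.single i j (monom σ m α) - Matrix.single j i (star (monom σ m α)), 0), by
    change (Matrix.single i j (monom σ m α) - Matrix.single j i (star (monom σ m α))).conjTranspose
      = -(Matrix.single i j (monom σ m α) - Matrix.single j i (star (monom σ m α)))
    rw [Matrix.conjTranspose_sub, Matrix.conjTranspose_single, Matrix.conjTranspose_single,
      star_star, neg_sub]⟩

/-- The central element `c`. -/
def uCentral : UHat σ ν :=
  ⟨GlHat.central σ ν, by
    change (0 : Matrix (Fin ν) (Fin ν) (SkewLaurent σ)).conjTranspose = -0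
    simp⟩

end Unitary

/-! ## The Fock space -/

section FockSpace

variable (ν : ℕ)

/-- The cocycle on `Γ̄ = (ℤ/2)^ν` induced by the bimultiplicative map on `Γ = ℤ^ν` with
`ε(ε_i, ε_j) = 1` for `i ≤ j` and `ε(ε_i, ε_j) = -1` for `i > j`. -/
def epsilon : Bichar (Fin ν → ZMod 2) where
  toFun a b := ∏ i, ∏ j, if j < i then (-1) ^ ((a i).val * (b j).val) else 1
  zero_left b := by simp
  zero_right a := by simp
  add_left a a' b := by
    have h : ∀ x y z : ZMod 2, (-1 : ℤ) ^ ((x + y).val * z.val) =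
      (-1) ^ (x.val * z.val) * (-1) ^ (y.val * z.val) := by decide
    simp only [← Finset.prod_mul_distrib]
    refine Finset.prod_congr rfl fun i _ => Finset.prod_congr rfl fun j _ => ?_
    split_ifs
    · exact_mod_cast h (a i) (a' i) (b j)
    · simp
  add_right a b b' := by
    have h : ∀ x y z : ZMod 2, (-1 : ℤ) ^ (z.val * (x + y).val) =
      (-1) ^ (z.val * x.val) * (-1) ^ (z.val * y.val) := by decide
    simp only [← Finset.prod_mul_distrib]
    refine Finset.prod_congr rfl fun i _ => Finset.prod_congr rfl fun j _ => ?_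
    split_ifs
    · exact_mod_cast h (b j) (b' j) (a i)
    · simp

/-- The twisted group algebra `ℂ[Γ̄]`. -/
abbrev GroupAlg : Type := TwistedGroupAlgebra (epsilon ν)

variable {ν}

/-- The reduction `Γ → Γ̄ = Γ/2Γ`. -/
def reduct (α : Fin ν → ℤ) : Fin ν → ZMod 2 := fun i => (α i : ZMod 2)

/-- The basis element `ε_i` of `Γ`. -/
def basisVec (i : Fin ν) : Fin ν → ℤ := Pi.single i 1

/-- The element `e^ᾱ` of `ℂ[Γ̄]`. -/
def expBar (α : Fin ν → ℤ) : GroupAlg ν := TwistedGroupAlgebra.exp (epsilon ν) (reduct α)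

variable (ν)

/-- The symmetric algebra of the space with basis `ε_i(n)`, `n < 0` odd; the variable
`(i, k)` stands for `ε_i(-(2k+1))`. -/
abbrev SymAlg : Type := MvPolynomial (Fin ν × ℕ) ℂ

/-- The Fock space `ℂ[Γ̄] ⊗ S(H⁻)`. -/
abbrev Fock : Type := GroupAlg ν ⊗[ℂ] SymAlg ν

variable {ν}

/-- The action of `ε_i(n)`, `n` odd, on `S(H⁻)`: multiplication by the variable `ε_i(n)` for
`n < 0`, and `(n/2) ∂/∂ε_i(-n)` for `n > 0`, so that `[ε_i(m), ε_j(n)] = (m/2) δ_ij δ_{m+n,0}`.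
For even `n` we put `ε_i(n) = 0`. -/
def osc (i : Fin ν) (n : ℤ) : Module.End ℂ (SymAlg ν) :=
  if Odd n then
    if n < 0 then LinearMap.mulLeft ℂ (MvPolynomial.X (i, n.natAbs / 2))
    else ((n : ℂ) / 2) • (MvPolynomial.pderiv (i, n.natAbs / 2)).toLinearMap
  else 0

/-- The action of `α(n) = ∑ α_i ε_i(n)` for `α = ∑ α_i ε_i ∈ Γ`. -/
def heis (α : Fin ν → ℤ) (n : ℤ) : Module.End ℂ (SymAlg ν) := ∑ i, (α i : ℂ) • osc i n

/-- The formal exponential `∑ A^l / l!` of an operator-valued power series without constant term;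
`A^l` contributes to the coefficient of degree `k` only if `l ≤ k`. -/
def expSeries (A : PowerSeries (Module.End ℂ (SymAlg ν))) :
    PowerSeries (Module.End ℂ (SymAlg ν)) :=
  PowerSeries.mk fun k =>
    ∑ l ∈ Finset.range (k + 1), ((l.factorial : ℂ)⁻¹) • PowerSeries.coeff k (A ^ l)

/-- The series `-2 ∑_{n ∈ s(2ℕ+1)} (α(n)/n) (az)^(-n)` for a sign `s = ±1`, as a power series in
`z^(-s)`. -/
def expArg (s : ℤˣ) (α : Fin ν → ℤ) (a : ℂ) : PowerSeries (Module.End ℂ (SymAlg ν)) :=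
  PowerSeries.mk fun k =>
    (-2 / ((s * k : ℤ) : ℂ) * a ^ (-(s * k : ℤ))) • heis α (s * k)

/-- The series `E_±(α, az)` as a power series in `z^∓`: `E_+` for `s = 1`, `E_-` for `s = -1`. -/
def expE (s : ℤˣ) (α : Fin ν → ℤ) (a : ℂ) : PowerSeries (Module.End ℂ (SymAlg ν)) :=
  expSeries (expArg s α a)

/-! The coefficients of `E_-(…) E_+(…)` are infinite sums of operators that are finite on each
vector, since the coefficient of degree `k` of `E_+` lowers the weight of a polynomial by `k`. -/

/-- The weight of a monomial, where `ε_i(-(2k+1))` has weight `2k+1`. -/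
def wt (s : Fin ν × ℕ →₀ ℕ) : ℤ := Finsupp.weight (fun p : Fin ν × ℕ => (2 * p.2 + 1 : ℤ)) s

/-- The polynomials all of whose monomials have weight at most `n`. -/
def wtLE (n : ℤ) : Submodule ℂ (SymAlg ν) :=
  MvPolynomial.restrictSupport ℂ {s | wt s ≤ n}

theorem wt_nonneg (s : Fin ν × ℕ →₀ ℕ) : 0 ≤ wt s := by
  rw [wt, Finsupp.weight_apply]
  exact Finset.sum_nonneg fun p _ => by positivity

theorem wtLE_neg {n : ℤ} (hn : n < 0) {f : SymAlg ν} (hf : f ∈ wtLE n) : f = 0 := by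
  rw [wtLE, MvPolynomial.mem_restrictSupport_iff] at hf
  rw [← MvPolynomial.support_eq_empty, Finset.eq_empty_iff_forall_notMem]
  intro s hs
  have h1 : wt s ≤ n := hf hs
  have h2 := wt_nonneg s
  omega

theorem exists_mem_wtLE (f : SymAlg ν) : ∃ n : ℕ, f ∈ wtLE (n : ℤ) := by
  refine ⟨∑ s ∈ f.support, (wt s).toNat, ?_⟩
  rw [wtLE, MvPolynomial.mem_restrictSupport_iff]
  intro s hs
  have h1 := Finset.single_le_sum (f := fun s => (wt s).toNat) (fun _ _ => Nat.zero_le _) hs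
  have h2 := Int.self_le_toNat (wt s)
  change wt s ≤ _

  omega

/-- The operator `T` lowers the weight by at least `d`. -/
def Lowers (d : ℤ) (T : Module.End ℂ (SymAlg ν)) : Prop :=
  ∀ (n : ℤ) (f : SymAlg ν), f ∈ wtLE n → T f ∈ wtLE (n - d)

theorem Lowers.zero (d : ℤ) : Lowers d (0 : Module.End ℂ (SymAlg ν)) :=
  fun _ _ _ => Submodule.zero_mem _

theorem Lowers.smul {d : ℤ} {T : Module.End ℂ (SymAlg ν)} (h : Lowers d T) (r : ℂ) :
    Lowers d (r • T) := fun n f hf => Submodule.smul_mem _ r (h n f hf)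

theorem Lowers.sum {ι : Type*} {d : ℤ} {u : Finset ι} {T : ι → Module.End ℂ (SymAlg ν)}
    (h : ∀ i ∈ u, Lowers d (T i)) : Lowers d (∑ i ∈ u, T i) := fun n f hf => by
  rw [LinearMap.sum_apply]
  exact Submodule.sum_mem _ fun i hi => h i hi n f hf

theorem Lowers.mul {d e : ℤ} {T U : Module.End ℂ (SymAlg ν)} (hT : Lowers d T)
    (hU : Lowers e U) : Lowers (d + e) (T * U) := fun n f hf => by
  have := hT _ _ (hU n f hf)
  rwa [show n - e - d = n - (d + e) by ring] at this

theorem Lowers.osc (i : Fin ν) {n : ℤ} (hn : 0 ≤ n) : Lowers n (osc i n) := by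
  unfold UnitaryVertex.osc
  split_ifs with h1 h2
  · omega
  · refine Lowers.smul ?_ _
    intro N f hf
    rw [wtLE, MvPolynomial.mem_restrictSupport_iff] at hf
    rw [f.as_sum, map_sum]
    refine Submodule.sum_mem _ fun s hs => ?_
    change MvPolynomial.pderiv _ _ ∈ _
    rw [MvPolynomial.pderiv_monomial]
    by_cases h0 : s (i, n.natAbs / 2) = 0
    · simp [h0]
    · rw [wtLE, MvPolynomial.mem_restrictSupport_iff]
      intro t ht
      have ht' := Finset.mem_singleton.1 (MvPolynomial.support_monomial_subset ht)
      have hs' : wt s ≤ N := hf hs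
      have hle : Finsupp.single (i, n.natAbs / 2) 1 ≤ s := by
        rw [Finsupp.single_le_iff]; omega
      have h3 : wt t + wt (Finsupp.single (i, n.natAbs / 2) 1) = wt s := by
        rw [ht', wt, wt, wt, ← map_add, tsub_add_cancel_of_le hle]
      have h4 : wt (Finsupp.single (i, n.natAbs / 2) 1) = n := by
        rw [wt, Finsupp.weight_single, one_smul]
        obtain ⟨k, hk⟩ := h1
        dsimp only
        omega
      change wt t ≤ N - n
      omega
  · exact Lowers.zero _

/-- The coefficient of degree `k` lowers the weight by `k`. -/
def SeriesLowers (P : PowerSeries (Module.End ℂ (SymAlg ν))) : Prop :=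
  ∀ k : ℕ, Lowers k (PowerSeries.coeff k P)

theorem SeriesLowers.mul {P Q : PowerSeries (Module.End ℂ (SymAlg ν))} (hP : SeriesLowers P)
    (hQ : SeriesLowers Q) : SeriesLowers (P * Q) := fun k => by
  rw [PowerSeries.coeff_mul]
  refine Lowers.sum fun p hp => ?_
  have h := (hP p.1).mul (hQ p.2)
  rwa [← Nat.cast_add, Finset.HasAntidiagonal.mem_antidiagonal.1 hp] at h

theorem SeriesLowers.one : SeriesLowers (1 : PowerSeries (Module.End ℂ (SymAlg ν))) := fun k => by
  rw [PowerSeries.coeff_one]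
  split_ifs with h
  · subst h
    intro n f hf
    simpa using hf
  · exact Lowers.zero _

theorem SeriesLowers.pow {P : PowerSeries (Module.End ℂ (SymAlg ν))} (hP : SeriesLowers P)
    (l : ℕ) : SeriesLowers (P ^ l) := by
  induction l with
  | zero => rw [pow_zero]; exact SeriesLowers.one
  | succ l ih => rw [pow_succ]; exact ih.mul hP

theorem SeriesLowers.expE (α : Fin ν → ℤ) (a : ℂ) : SeriesLowers (expE 1 α a) := fun k => by
  rw [UnitaryVertex.expE, expSeries, PowerSeries.coeff_mk]
  refine Lowers.sum fun l _ => Lowers.smul ?_ _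
  refine SeriesLowers.pow (fun k => ?_) l k
  rw [expArg, PowerSeries.coeff_mk]
  refine Lowers.smul (Lowers.sum fun i _ => Lowers.smul ?_ _) _
  rw [Units.val_one, one_mul]
  exact Lowers.osc i (Int.natCast_nonneg k)

theorem SeriesLowers.finite {P : PowerSeries (Module.End ℂ (SymAlg ν))} (hP : SeriesLowers P)
    (B : ℕ → Module.End ℂ (SymAlg ν)) (f : SymAlg ν) :
    (Function.support fun l : ℕ => B l (PowerSeries.coeff l P f)).Finite := by
  obtain ⟨n, hn⟩ := exists_mem_wtLE f
  refine (Set.finite_Iic n).subset fun l hl => ?_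
  by_contra hlt
  refine hl ?_
  have h : PowerSeries.coeff l P f = 0 :=
    wtLE_neg (by simp only [Set.mem_Iic, not_le] at hlt; omega) (hP l n f hn)
  simp only [h, map_zero]

/-- The coefficient of `z^(-n)` in the product `(∑_k N_k z^k) (∑_l P_l z^(-l))`, that is
`∑_l N_(l-n) P_l`, where on each vector only finitely many terms are non-zero. -/
def laurentCoeff (N P : PowerSeries (Module.End ℂ (SymAlg ν))) (hP : SeriesLowers P) (n : ℤ) :
    Module.End ℂ (SymAlg ν) where
  toFun f := ∑ᶠ l : ℕ,
    (if n ≤ l then PowerSeries.coeff (l - n).toNat N else 0) (PowerSeries.coeff l P f)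
  map_add' f g := by
    rw [← finsum_add_distrib (hP.finite _ f) (hP.finite _ g)]
    simp only [map_add]
  map_smul' r f := by
    rw [RingHom.id_apply, smul_finsum' r (hP.finite _ f)]
    simp only [map_smul]

/-- The coefficient of `z^(-n)` in `E_-(ε_i, z) E_-(-ε_j, az) E_+(ε_i, z) E_+(-ε_j, az)`. -/
def expCoeff (i j : Fin ν) (a : ℂ) (n : ℤ) : Module.End ℂ (SymAlg ν) :=
  laurentCoeff (expE (-1) (basisVec i) 1 * expE (-1) (-basisVec j) a)
    (expE 1 (basisVec i) 1 * expE 1 (-basisVec j) a)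
    ((SeriesLowers.expE _ _).mul (SeriesLowers.expE _ _)) n

open Classical in
/-- The coefficient `x_ij(a, n)` of `z^(-n)` in the vertex operator `X_ij(a, z)`, which is
`ε(ε_i, ε_j) e^(ε_i - ε_j) E_-(ε_i, z) E_-(-ε_j, az) E_+(ε_i, z) E_+(-ε_j, az)` if `i ≠ j`,
`4 ε_i(z) = 4 ∑ ε_i(n) z^(-n)` if `i = j`, `a = 1`, and
`(1 + a)/(1 - a) (E_-(ε_i, z) E_-(-ε_i, az) E_+(ε_i, z) E_+(-ε_i, az) - 1)` if `i = j`, `a ≠ 1`. -/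
def vertexCoeff (i j : Fin ν) (a : ℂ) (n : ℤ) : Module.End ℂ (Fock ν) :=
  if i ≠ j then
    (epsilon ν).toFun (reduct (basisVec i)) (reduct (basisVec j)) •
      TensorProduct.map (LinearMap.mulLeft ℂ (expBar (basisVec i - basisVec j))) (expCoeff i j a n)
  else if a = 1 then (4 : ℂ) • TensorProduct.map LinearMap.id (osc i n)
  else ((1 + a) / (1 - a)) •
    (TensorProduct.map LinearMap.id (expCoeff i i a n) - if n = 0 then LinearMap.id else 0)

/-! ## The components -/

/-- The element `1 + √-1 ρ e^{ε_j}` for odd `j` and `1 + ρ e^{ε_j}` for even `j`, where the indices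
are counted from `1`; so here, counting from `0`, the first case is that of even `j`. -/
def wFactor (j : Fin ν) (ρ : ℤˣ) : GroupAlg ν :=
  1 + ((if Even j.val then Complex.I else 1) * ((ρ : ℤ) : ℂ)) • expBar (basisVec j)

/-- The ordered product `w(ρ_1, …, ρ_ν) = w_1(ρ_1) ⋯ w_ν(ρ_ν)`. -/
def wVec (ρ : Fin ν → ℤˣ) : GroupAlg ν := (List.ofFn fun j => wFactor j (ρ j)).prod

/-- With `d = [ν/2]` and indices counted from `1`, the conditions are `ρ_1 = γ_1`,
`ρ_{2j} ρ_{2j+1} = γ_{j+1}` whenever `1 ≤ j` and `2j + 1 ≤ ν` (so `j ≤ d` for odd `ν` and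
`j ≤ d - 1` for even `ν`), and, for even `ν` only, `ρ_{2d} = γ_{d+1}`.
In the code all indices are counted from `0`. -/
def SignCond (γ : Fin (ν / 2 + 1) → ℤˣ) (ρ : Fin ν → ℤˣ) : Prop :=
  (∀ i : Fin ν, i.val = 0 → ρ i = γ 0) ∧
  (∀ (i k : Fin ν) (j : Fin (ν / 2 + 1)), 1 ≤ j.val → i.val + 1 = 2 * j.val →
    k.val = 2 * j.val → ρ i * ρ k = γ j) ∧
  (Even ν → ∀ i : Fin ν, i.val + 1 = ν → ρ i = γ (Fin.last (ν / 2)))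

/-- The space `V_ν(γ)`, the span of the `w(ρ_1, …, ρ_ν)` with sign invariants `γ`. -/
def compV (γ : Fin (ν / 2 + 1) → ℤˣ) : Submodule ℂ (GroupAlg ν) :=
  Submodule.span ℂ {x | ∃ ρ, SignCond γ ρ ∧ x = wVec ρ}

/-- The subspace `V_ν(γ) ⊗ S(H⁻)` of the Fock space. -/
def compFock (γ : Fin (ν / 2 + 1) → ℤˣ) : Submodule ℂ (Fock ν) :=
  LinearMap.range (TensorProduct.map (compV γ).subtype (LinearMap.id : SymAlg ν →ₗ[ℂ] SymAlg ν))

end FockSpace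

end

end UnitaryVertex

open UnitaryVertex

namespace UnitaryVertex

open scoped TensorProduct

noncomputable section

/-! ## The Euler operator on power series and formal exponentials -/

section Euler

variable {R : Type*} [Ring R]

/-! The vertex operators are quadratic in twisted fermions. Put `X_i(z) = E_-(ε_i, z) E_+(ε_i, z)`
and `ψ_i(z) = e^(ε_i) X_i(z)`. Only odd oscillators occur, so `E_±(-ε_j, az) = E_±(ε_j, -az)`
(`coeff_expE_neg`), and the exponential part of `X_ij(a, z)` is the bosonic normally ordered product
of `X_i(z)` and `X_j(w)` at `w = -az`.

Moving `E_+(ε_i, z)` past `E_-(ε_i, w)` costs the factor `(1 - w/z)/(1 + w/z)` (`expMode_exchange`).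
This factor is antisymmetric in `z, w` up to its pole at `w = -z`, so the modes of `X_i` anticommute
up to a scalar carried by that pole (`mode_anticomm`). The modes of `X_i`, `X_j` with `i ≠ j`
commute, and the Clifford relations of the `e^(ε_i)` turn this into anticommutation. The factor
takes the value `(1 + a)/(1 - a)` at `w = -az`, which explains the diagonal case with `a ≠ 1`; at `a
= 1` it has a pole, and a derivative of the normally ordered product, equal to a multiple of
`ε_i(z)`, appears. Thus in all cases `X_ij(a, z)` is the fermionic normally ordered product of
`ψ_i(z)` and `ψ_j(-az)` (`vertexCoeff_eq_quad`).

The commutator of a quadratic expression with a fermion is linear in fermions, so the Leibniz rule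
computes commutators of quadratic expressions. Reordering leaves a scalar `∑_r x^(-r) (sgn(r + m) -
sgn(r))` with `x = ab`. For `x = 1` this is `2m`, the cocycle; for `x ≠ 1` it is a coboundary,
removed by adding `(1 + x)/(1 - x)` to the zero mode (`quad'_comm`). The resulting map on matrices
satisfies `[Q(X), Q(Y)] = Q([X - X*, Y])` (`matQuad_comm`). On skew elements `X - X* = 2X`, so half
of it is a representation, and `c` acts as `1/2`.

For the decomposition, `e^(ε_i)` sends `w(ρ)` to a multiple of the vector obtained by changing an
initial segment of signs of odd length. Such a segment contains both or neither of the signs in each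
pair entering `γ`, so only the first invariant changes, and products of two generators preserve
`V_ν(γ)`. A submodule is stable under all oscillators, since `x_ii(1, n) = 4 ε_i(n)`; if non-zero it
contains some `u ⊗ 1` with `u ≠ 0` (`exists_tmul_one_mem`), and on such vectors `x_ij(1, 0)` with `i
≠ j` acts as `e^(ε_i) e^(ε_j)`. Products of neighbouring generators are diagonal and separate the
`w(ρ)` in `V_ν(γ)`; the other products connect them (`compV_le_of_gen_mul_gen_mul_mem`). The Fock
space is then a sum of irreducible submodules, hence completely reducible. -/

theorem PowerSeries.commute_of_coeff {A B : PowerSeries R}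
    (h : ∀ i j, Commute (PowerSeries.coeff i A) (PowerSeries.coeff j B)) : Commute A B := by
  ext k
  rw [PowerSeries.coeff_mul, PowerSeries.coeff_mul, ← Finset.Nat.sum_antidiagonal_swap]
  exact Finset.sum_congr rfl fun p _ => (h _ _).eq

theorem PowerSeries.coeff_pow_eq_zero {A : PowerSeries R} (h0 : PowerSeries.coeff 0 A = 0)
    {l k : ℕ} (hk : k < l) : PowerSeries.coeff k (A ^ l) = 0 := by
  induction l generalizing k with
  | zero => omega
  | succ l ih =>
    rw [pow_succ', PowerSeries.coeff_mul]
    refine Finset.sum_eq_zero fun p hp => ?_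
    have hp := Finset.HasAntidiagonal.mem_antidiagonal.1 hp
    rcases Nat.eq_zero_or_pos p.1 with h | h
    · rw [h, h0, zero_mul]
    · rw [ih (by omega), mul_zero]

variable [Algebra ℂ R]

/-- The Euler operator `T d/dT` on power series over a not necessarily commutative algebra. -/
def euler (P : PowerSeries R) : PowerSeries R :=
  PowerSeries.mk fun k => (k : ℂ) • PowerSeries.coeff k P

theorem coeff_euler (P : PowerSeries R) (k : ℕ) :
    PowerSeries.coeff k (euler P) = (k : ℂ) • PowerSeries.coeff k P := PowerSeries.coeff_mk _ _

theorem euler_mul (P Q : PowerSeries R) : euler (P * Q) = euler P * Q + P * euler Q := by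
  ext k
  simp only [coeff_euler, map_add, PowerSeries.coeff_mul, Finset.smul_sum,
    ← Finset.sum_add_distrib, smul_mul_assoc, mul_smul_comm, ← add_smul]
  refine Finset.sum_congr rfl fun p hp => ?_
  rw [← Finset.HasAntidiagonal.mem_antidiagonal.1 hp, Nat.cast_add]

theorem euler_one : euler (1 : PowerSeries R) = 0 := by
  ext k
  rw [coeff_euler, PowerSeries.coeff_one]
  split_ifs with h <;> simp [h]

theorem euler_pow {A : PowerSeries R} (h : Commute (euler A) A) (l : ℕ) :
    euler (A ^ l) = (l : ℂ) • (euler A * A ^ (l - 1)) := by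
  induction l with
  | zero => simp [euler_one]
  | succ l ih =>
    rw [pow_succ, euler_mul, ih, Nat.add_sub_cancel]
    rcases l with _ | l
    · simp
    · rw [Nat.add_sub_cancel, smul_mul_assoc, mul_assoc, ← pow_succ, ← (h.pow_right (l + 1)).eq,
        Nat.cast_succ (l + 1), add_smul, one_smul]

theorem coeff_pow_euler {A : PowerSeries R} (h : Commute (euler A) A) (k l : ℕ) :
    (k : ℂ) • PowerSeries.coeff k (A ^ l) =
      (l : ℂ) • PowerSeries.coeff k (euler A * A ^ (l - 1)) := by
  rw [← coeff_euler, euler_pow h]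
  rfl

/-- A first-order linear equation has one solution for each initial value: `D` has no constant term,
so `k` times the coefficient of degree `k` is determined by lower coefficients. Identities between
exponentials are proved below by checking that both sides solve the same equation. -/
theorem eq_of_euler_eq {D X Y : PowerSeries R} (hD : PowerSeries.coeff 0 D = 0)
    (hX : euler X = D * X) (hY : euler Y = D * Y)
    (h0 : PowerSeries.coeff 0 X = PowerSeries.coeff 0 Y) : X = Y := by
  ext k
  induction k using Nat.strong_induction_on with
  | _ k ih =>
    rcases Nat.eq_zero_or_pos k with rfl | hk
    · exact h0
    · have h1 := congrArg (PowerSeries.coeff k) hX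
      have h2 := congrArg (PowerSeries.coeff k) hY
      rw [coeff_euler, PowerSeries.coeff_mul] at h1 h2
      have hk' : (k : ℂ) ≠ 0 := by exact_mod_cast hk.ne'
      refine smul_right_injective R hk' ?_
      dsimp only
      rw [h1, h2]
      refine Finset.sum_congr rfl fun p hp => ?_
      have hp := Finset.HasAntidiagonal.mem_antidiagonal.1 hp
      rcases Nat.eq_zero_or_pos p.1 with h | h
      · rw [h, hD, zero_mul, zero_mul]
      · rw [ih p.2 (by omega)]

/-- The recursion of `eq_of_euler_eq` builds every coefficient of `X` from those of `D` and the
initial value. -/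
theorem commute_of_euler_eq {D X : PowerSeries R} (hD : PowerSeries.coeff 0 D = 0)
    (hX : euler X = D * X) (T : R) (h0 : Commute T (PowerSeries.coeff 0 X))
    (hT : ∀ k, Commute T (PowerSeries.coeff k D)) (k : ℕ) : Commute T (PowerSeries.coeff k X) := by
  induction k using Nat.strong_induction_on with
  | _ k ih =>
    rcases Nat.eq_zero_or_pos k with rfl | hk
    · exact h0
    · have h1 := congrArg (PowerSeries.coeff k) hX
      rw [coeff_euler, PowerSeries.coeff_mul] at h1
      have hk' : (k : ℂ) ≠ 0 := by exact_mod_cast hk.ne'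
      have : PowerSeries.coeff k X = (k : ℂ)⁻¹ • (k : ℂ) • PowerSeries.coeff k X := by
        rw [smul_smul, inv_mul_cancel₀ hk', one_smul]
      rw [this, h1]
      refine Commute.smul_right (Commute.sum_right _ _ _ fun p hp => ?_) _
      have hp := Finset.HasAntidiagonal.mem_antidiagonal.1 hp
      rcases Nat.eq_zero_or_pos p.1 with h | h
      · rw [h, hD, zero_mul]; exact Commute.zero_right _
      · exact (hT _).mul_right (ih p.2 (by omega))

end Euler

/-! ### Oscillator relations and the series `E_±`. -/

section Exponentials

variable {ν : ℕ}

theorem coeff_zero_expSeries (A : PowerSeries (Module.End ℂ (SymAlg ν))) :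
    PowerSeries.coeff 0 (expSeries A) = 1 := by
  simp [expSeries, PowerSeries.coeff_mk]

/-- `A^l` begins in degree at least `l`, so the truncation in `expSeries` may be lengthened freely;
the usual termwise differentiation of the exponential then applies, since `A` commutes with its
derivative. -/
theorem euler_expSeries {A : PowerSeries (Module.End ℂ (SymAlg ν))}
    (h0 : PowerSeries.coeff 0 A = 0) (hA : Commute (euler A) A) :
    euler (expSeries A) = euler A * expSeries A := by
  have key : ∀ k L : ℕ, k < L → PowerSeries.coeff k (expSeries A) =
      ∑ l ∈ Finset.range L, ((l.factorial : ℂ)⁻¹) • PowerSeries.coeff k (A ^ l) := by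
    intro k L hL
    rw [expSeries, PowerSeries.coeff_mk]
    refine Finset.sum_subset (Finset.range_subset_range.2 hL) fun l _ hl => ?_
    rw [PowerSeries.coeff_pow_eq_zero h0 (by simpa using hl), smul_zero]
  ext1 k
  rw [coeff_euler, key k (k + 1 + 1) (by omega), Finset.sum_range_succ', PowerSeries.coeff_mul]
  have e1 : ∀ p ∈ Finset.HasAntidiagonal.antidiagonal k, PowerSeries.coeff p.1 (euler A) *
      PowerSeries.coeff p.2 (expSeries A) = ∑ l ∈ Finset.range (k + 1),
        ((l.factorial : ℂ)⁻¹) • (PowerSeries.coeff p.1 (euler A) *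
          PowerSeries.coeff p.2 (A ^ l)) := by
    intro p hp
    have hp := Finset.HasAntidiagonal.mem_antidiagonal.1 hp
    rw [key p.2 (k + 1) (by omega), Finset.mul_sum]
    simp only [mul_smul_comm]
  rw [Finset.sum_congr rfl e1, Finset.sum_comm, smul_add, Finset.smul_sum]
  have e2 : (k : ℂ) • ((Nat.factorial 0 : ℂ)⁻¹ • PowerSeries.coeff k (A ^ 0)) = 0 := by
    rw [pow_zero, PowerSeries.coeff_one]
    split_ifs with h <;> simp [h]
  rw [e2, add_zero]
  refine Finset.sum_congr rfl fun l _ => ?_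
  rw [← Finset.smul_sum, ← PowerSeries.coeff_mul, smul_comm, coeff_pow_euler hA,
    Nat.add_sub_cancel, smul_smul]
  congr 1
  have : ((l + 1 : ℕ) : ℂ) ≠ 0 := by exact_mod_cast l.succ_ne_zero
  rw [Nat.factorial_succ, Nat.cast_mul, mul_inv_rev, mul_assoc, inv_mul_cancel₀ this, mul_one]

theorem osc_even (i : Fin ν) {n : ℤ} (hn : ¬ Odd n) : osc i n = 0 := if_neg hn

theorem heis_basisVec (i : Fin ν) (n : ℤ) : heis (basisVec i) n = osc i n := by
  rw [heis, Finset.sum_eq_single i]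
  · simp [basisVec]
  · intro j _ hj; simp [basisVec, hj]
  · simp

theorem end_neg_smul {V : Type*} [AddCommGroup V] [Module ℂ V] (c : ℂ) (T : Module.End ℂ V) :
    (-c) • T = -(c • T) := neg_smul c T

theorem heis_neg (α : Fin ν → ℤ) (n : ℤ) : heis (-α) n = -heis α n := by
  rw [heis, heis, ← Finset.sum_neg_distrib]
  refine Finset.sum_congr rfl fun i _ => ?_
  rw [Pi.neg_apply, Int.cast_neg]
  exact neg_smul (α i : ℂ) (osc i n)

theorem heis_even (α : Fin ν → ℤ) {n : ℤ} (hn : ¬ Odd n) : heis α n = 0 := by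
  simp [heis, osc_even _ hn]

/-- The commutation relations of the oscillators. -/
theorem osc_comm (i j : Fin ν) {m n : ℤ} (hm : 0 ≤ m) :
    osc i m * osc j n = osc j n * osc i m +
      if i = j ∧ m + n = 0 ∧ Odd m then ((m : ℂ) / 2) • 1 else 0 := by
  by_cases hm1 : Odd m
  swap
  · simp [osc_even i hm1, hm1]
  by_cases hn1 : Odd n
  swap
  · have : ¬ (m + n = 0) := fun h => hn1 (by rw [show n = -m by omega]; exact hm1.neg)
    simp [osc_even j hn1, this]
  have hm0 : ¬ m < 0 := by omega
  have hM : osc i m = ((m : ℂ) / 2) • (MvPolynomial.pderiv (i, m.natAbs / 2)).toLinearMap := by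
    rw [osc, if_pos hm1, if_neg hm0]
  rw [hM]
  by_cases hn0 : n < 0
  · have hN : osc j n = LinearMap.mulLeft ℂ (MvPolynomial.X (j, n.natAbs / 2)) := by
      rw [osc, if_pos hn1, if_pos hn0]
    rw [hN]
    refine LinearMap.ext fun f => ?_
    simp only [Module.End.mul_apply, LinearMap.smul_apply, LinearMap.add_apply,
      LinearMap.mulLeft_apply, Derivation.coeFn_coe, Derivation.leibniz, MvPolynomial.pderiv_X,
      smul_eq_mul, mul_smul_comm, smul_add]
    congr 1
    -- Halving loses nothing: an odd number is recovered from its integer half. The signs of `m` and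
    -- `n` are opposite here.
    have hiff : ((j, n.natAbs / 2) = (i, m.natAbs / 2)) ↔ (i = j ∧ m + n = 0 ∧ Odd m) := by
      rw [Prod.mk.injEq]
      obtain ⟨a, ha⟩ := hm1
      obtain ⟨b, hb⟩ := hn1
      refine ⟨fun ⟨h1, h2⟩ => ⟨h1.symm, by omega, ⟨a, ha⟩⟩, fun ⟨h1, h2, _⟩ => ⟨h1.symm, by omega⟩⟩
    by_cases h : i = j ∧ m + n = 0 ∧ Odd m
    · rw [if_pos h, ← hiff.2 h, Pi.single_eq_same]
      simp
    · rw [if_neg h, Pi.single_eq_of_ne (fun h' => h (hiff.1 h'))]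
      simp
  · have hN : osc j n = ((n : ℂ) / 2) • (MvPolynomial.pderiv (j, n.natAbs / 2)).toLinearMap := by
      rw [osc, if_pos hn1, if_neg hn0]
    have : ¬ (m + n = 0) := by obtain ⟨a, ha⟩ := hm1; omega
    rw [hN, if_neg (fun h => this h.2.1), add_zero, smul_mul_smul_comm, smul_mul_smul_comm,
      mul_comm ((m : ℂ) / 2)]
    refine congrArg (((n : ℂ) / 2 * ((m : ℂ) / 2)) • ·) (LinearMap.ext fun f => ?_)
    simp only [Module.End.mul_apply, Derivation.coeFn_coe]
    have h : ⁅MvPolynomial.pderiv (R := ℂ) (i, m.natAbs / 2), MvPolynomial.pderiv (j, n.natAbs / 2)⁆ =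
        (0 : Derivation ℂ (SymAlg ν) (SymAlg ν)) := by
      refine MvPolynomial.derivation_ext fun p => ?_
      rw [Derivation.commutator_apply, MvPolynomial.pderiv_X, MvPolynomial.pderiv_X,
        Pi.single_apply, Pi.single_apply]
      split_ifs <;> simp
    have h' := DFunLike.congr_fun h f
    rw [Derivation.commutator_apply] at h'
    exact sub_eq_zero.1 h'

/-- The hypothesis says that both are creation operators or both annihilation operators; a zero
index is even and gives the zero operator. -/
theorem osc_commute_of_mul_nonneg (i j : Fin ν) {m n : ℤ} (h : 0 ≤ m * n) :
    Commute (osc i m) (osc j n) := by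
  by_cases hm1 : Odd m
  swap
  · rw [osc_even i hm1]; exact Commute.zero_left _
  by_cases hn1 : Odd n
  swap
  · rw [osc_even j hn1]; exact Commute.zero_right _
  by_cases hm : m < 0
  · by_cases hn : n < 0
    · rw [osc, osc, if_pos hm1, if_pos hn1, if_pos hm, if_pos hn]
      refine LinearMap.ext fun f => ?_
      simp only [Module.End.mul_apply, LinearMap.mulLeft_apply]
      ring
    · have : n = 0 := by nlinarith
      subst this
      simp at hn1
  · refine (osc_comm i j (by omega)).trans ?_
    have : ¬ (m + n = 0) := fun h' => by
      have : n = -m := by omega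
      subst this
      have : m = 0 := by nlinarith
      subst this
      simp at hm1
    simp [this]

theorem osc_commute_of_ne {i j : Fin ν} (hij : i ≠ j) (m n : ℤ) :
    Commute (osc i m) (osc j n) := by
  rcases le_total 0 m with hm | hm
  · exact (osc_comm i j hm).trans (by simp [hij])
  · rcases le_total 0 n with hn | hn
    · exact ((osc_comm j i hn).trans (by simp [hij.symm])).symm
    · exact osc_commute_of_mul_nonneg i j (mul_nonneg_of_nonpos_of_nonpos hm hn)

/-- The logarithmic derivative of `E_±(α, az)`. -/
def expD (s : ℤˣ) (α : Fin ν → ℤ) (a : ℂ) : PowerSeries (Module.End ℂ (SymAlg ν)) :=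
  PowerSeries.mk fun k => (-2 * ((s : ℤ) : ℂ) * a ^ (-(s * k : ℤ))) • heis α (s * k)

theorem euler_expArg (s : ℤˣ) (α : Fin ν → ℤ) (a : ℂ) : euler (expArg s α a) = expD s α a := by
  ext1 k
  rw [coeff_euler, expArg, expD, PowerSeries.coeff_mk, PowerSeries.coeff_mk, smul_smul]
  -- The scalars of the two sides disagree in degree 0, where the division by zero has the default
  -- value 0; this does no harm because the oscillator of index 0 vanishes.
  rcases Nat.eq_zero_or_pos k with rfl | hk
  · rw [heis_even]
    · simp
    · simp
  · congr 1
    have hk' : (k : ℂ) ≠ 0 := by exact_mod_cast hk.ne'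
    rcases Int.units_eq_one_or s with rfl | rfl
    · push_cast; field_simp
    · push_cast; field_simp

theorem heis_commute (s : ℤˣ) (α β : Fin ν → ℤ) (k l : ℕ) :
    Commute (heis α (s * k)) (heis β (s * l)) := by
  rw [heis, heis]
  refine Commute.sum_left _ _ _ fun i _ => Commute.sum_right _ _ _ fun j _ => ?_
  refine ((osc_commute_of_mul_nonneg i j ?_).smul_left _).smul_right _
  rcases Int.units_eq_one_or s with rfl | rfl <;> push_cast
  · simp only [one_mul]; positivity
  · rw [show -1 * (k : ℤ) * (-1 * (l : ℤ)) = k * l by ring]; positivity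

theorem coeff_zero_expD (s : ℤˣ) (α : Fin ν → ℤ) (a : ℂ) :
    PowerSeries.coeff 0 (expD s α a) = 0 := by
  rw [expD, PowerSeries.coeff_mk, heis_even _ (by simp), smul_zero]

theorem euler_expE (s : ℤˣ) (α : Fin ν → ℤ) (a : ℂ) :
    euler (expE s α a) = expD s α a * expE s α a := by
  rw [expE, euler_expSeries, euler_expArg]
  · rw [expArg, PowerSeries.coeff_mk]; simp
  · rw [euler_expArg]
    refine PowerSeries.commute_of_coeff fun i j => ?_
    rw [expD, expArg, PowerSeries.coeff_mk, PowerSeries.coeff_mk]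
    exact ((heis_commute s α α i j).smul_left _).smul_right _

theorem coeff_zero_expE (s : ℤˣ) (α : Fin ν → ℤ) (a : ℂ) :
    PowerSeries.coeff 0 (expE s α a) = 1 := coeff_zero_expSeries _

/-- The operator `T` commutes with the coefficients of `E_±(ε_i, z)` if it commutes with all
`ε_i(n)` of the same sign. -/
theorem commute_coeff_expE {s : ℤˣ} {i : Fin ν} {T : Module.End ℂ (SymAlg ν)}
    (h : ∀ k : ℕ, Commute T (osc i (s * k))) (k : ℕ) :
    Commute T (PowerSeries.coeff k (expE s (basisVec i) 1)) := by
  refine commute_of_euler_eq (coeff_zero_expD _ _ _) (euler_expE _ _ _) T ?_ (fun k => ?_) k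
  · rw [coeff_zero_expE]; exact Commute.one_right _
  · rw [expD, PowerSeries.coeff_mk, heis_basisVec]
    exact (h k).smul_right _

/-- This is `E_±(-ε_j, az) = E_±(ε_j, -az)`: the logarithmic derivative involves odd powers of `z`
only, so the sign of the lattice vector can be moved into the variable. It is what makes `X_ij(a,
z)` a product of two fields of the same kind. -/
theorem coeff_expE_neg (s : ℤˣ) (j : Fin ν) (a : ℂ) (ha : a ≠ 0) (k : ℕ) :
    PowerSeries.coeff k (expE s (-basisVec j) a) =
      (-a) ^ (-(s * k : ℤ)) • PowerSeries.coeff k (expE s (basisVec j) 1) := by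
  have hna : -a ≠ 0 := neg_ne_zero.2 ha
  let Y : PowerSeries (Module.End ℂ (SymAlg ν)) :=
    PowerSeries.mk fun k => (-a) ^ (-(s * k : ℤ)) • PowerSeries.coeff k (expE s (basisVec j) 1)
  suffices h : expE s (-basisVec j) a = Y by
    rw [h]; exact PowerSeries.coeff_mk _ _
  refine eq_of_euler_eq (coeff_zero_expD _ _ _) (euler_expE _ _ _) ?_ ?_
  · ext1 k
    have h := congrArg (PowerSeries.coeff k) (euler_expE s (basisVec j) 1)
    rw [coeff_euler, PowerSeries.coeff_mul] at h ⊢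
    rw [PowerSeries.coeff_mk, smul_comm, h, Finset.smul_sum]
    refine Finset.sum_congr rfl fun p hp => ?_
    rw [expD, expD, PowerSeries.coeff_mk, PowerSeries.coeff_mk, PowerSeries.coeff_mk,
      ← Finset.HasAntidiagonal.mem_antidiagonal.1 hp, heis_basisVec, heis_neg, heis_basisVec, smul_neg, ← end_neg_smul,
      smul_mul_smul_comm, smul_mul_assoc, smul_smul]
    -- For an odd exponent the sign of `-a` comes out and cancels the sign of `-ε_j`; for an even
    -- one there is no oscillator.
    by_cases hp1 : Odd ((s : ℤ) * (p.1 : ℤ))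
    · congr 1
      rw [Nat.cast_add, mul_add, neg_add, zpow_add₀ hna, (hp1.neg).neg_zpow, one_zpow]
      ring
    · rw [osc_even _ hp1]; simp
  · rw [coeff_zero_expE, PowerSeries.coeff_mk, coeff_zero_expE]; simp

/-- The logarithmic derivatives of the two factors commute with everything in sight and add up to
zero, so the product is constant. -/
theorem expE_mul_expE_neg (s : ℤˣ) (i : Fin ν) :
    expE s (basisVec i) 1 * expE s (-basisVec i) 1 = 1 := by
  have hc : Commute (expD s (-basisVec i) 1) (expE s (basisVec i) 1) := by
    refine PowerSeries.commute_of_coeff fun k l => commute_coeff_expE (fun l => ?_) l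
    rw [expD, PowerSeries.coeff_mk, ← heis_basisVec]
    exact (heis_commute s _ _ k l).smul_left _
  refine eq_of_euler_eq (D := 0) (by simp) ?_ (by simp [euler_one]) ?_
  · rw [euler_mul, euler_expE, euler_expE, ← mul_assoc, ← hc.eq, mul_assoc, mul_assoc, ← add_mul]
    congr 1
    ext1 k
    simp [expD, heis_neg, end_neg_smul]
  · simp [PowerSeries.coeff_mul, coeff_zero_expE]

theorem expE_mul_euler_expE_neg (s : ℤˣ) (i : Fin ν) :
    expE s (basisVec i) 1 * euler (expE s (-basisVec i) 1) = -expD s (basisVec i) 1 := by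
  have hc : Commute (expD s (-basisVec i) 1) (expE s (basisVec i) 1) := by
    refine PowerSeries.commute_of_coeff fun k l => commute_coeff_expE (fun l => ?_) l
    rw [expD, PowerSeries.coeff_mk, ← heis_basisVec]
    exact (heis_commute s _ _ k l).smul_left _
  rw [euler_expE, ← mul_assoc, ← hc.eq, mul_assoc, expE_mul_expE_neg, mul_one]
  ext1 k
  simp [expD, heis_neg, end_neg_smul]

end Exponentials

/-! ## Exchange relations between `E_+` and `E_-` -/

section Exchange

variable {R : Type*} [Ring R] [Algebra ℂ R]

/-- The Euler operator in the inner variable of an iterated power series. -/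
def innerEuler (P : PowerSeries (PowerSeries R)) : PowerSeries (PowerSeries R) :=
  PowerSeries.mk fun k => euler (PowerSeries.coeff k P)

theorem coeff_innerEuler (P : PowerSeries (PowerSeries R)) (k : ℕ) :
    PowerSeries.coeff k (innerEuler P) = euler (PowerSeries.coeff k P) := PowerSeries.coeff_mk _ _

theorem euler_add (P Q : PowerSeries R) : euler (P + Q) = euler P + euler Q := by
  ext k
  simp only [coeff_euler, map_add, smul_add]

theorem coeff_csmul (c : ℂ) (P : PowerSeries R) (k : ℕ) :
    PowerSeries.coeff k (c • P) = c • PowerSeries.coeff k P := rfl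

theorem euler_X_pow (n : ℕ) :
    euler (PowerSeries.X ^ n : PowerSeries R) = (n : ℂ) • PowerSeries.X ^ n := by
  ext1 k
  rw [coeff_euler, coeff_csmul, PowerSeries.coeff_X_pow]
  split_ifs with h
  · rw [h]
  · rw [smul_zero, smul_zero]

theorem euler_zero : euler (0 : PowerSeries R) = 0 := by
  ext k
  simp only [coeff_euler, map_zero, smul_zero]

theorem euler_sum {ι : Type*} (u : Finset ι) (f : ι → PowerSeries R) :
    euler (∑ x ∈ u, f x) = ∑ x ∈ u, euler (f x) := by
  classical
  induction u using Finset.induction_on with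
  | empty => simp [euler_zero]
  | insert a u ha ih => rw [Finset.sum_insert ha, Finset.sum_insert ha, euler_add, ih]

theorem innerEuler_mul (P Q : PowerSeries (PowerSeries R)) :
    innerEuler (P * Q) = innerEuler P * Q + P * innerEuler Q := by
  ext1 k
  simp only [coeff_innerEuler, map_add, PowerSeries.coeff_mul, euler_sum, euler_mul,
    Finset.sum_add_distrib]

theorem euler_C (x : R) : euler (PowerSeries.C x) = 0 := by
  ext k
  rw [coeff_euler, PowerSeries.coeff_C]
  split_ifs with h <;> simp [h]

/-- The coefficients of `(1 - x)/(1 + x)`. -/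
def cayley (r : ℕ) : ℂ := if r = 0 then 1 else 2 * (-1) ^ r

/-- Coefficientwise this is the logarithmic derivative of `h(x) = (1 - x)/(1 + x)`, namely `x h'(x)
= -2 (x + x^3 + x^5 + ⋯) h(x)`. -/
theorem sum_odd_cayley (t : ℕ) : ∑ p ∈ Finset.HasAntidiagonal.antidiagonal t,
    (if Odd p.1 then cayley p.2 else 0) = -(t * cayley t) / 2 := by
  have hp : ∀ a : ℕ, (if Odd a then (1 : ℂ) else 0) = (1 - (-1) ^ a) / 2 := fun a => by
    split_ifs with h
    · rw [h.neg_one_pow]; norm_num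
    · rw [(Nat.not_odd_iff_even.1 h).neg_one_pow]; norm_num
  have h1 : ∀ t : ℕ, ∑ a ∈ Finset.range t, (1 - (-1 : ℂ) ^ a) / 2 * (2 * (-1) ^ (t - a)) =
      (-1) ^ t * ((1 - (-1) ^ t) / 2 - t) := by
    intro t
    induction t with
    | zero => simp
    | succ t ih =>
      rw [Finset.sum_range_succ]
      have h2 : ∀ a ∈ Finset.range t, (1 - (-1 : ℂ) ^ a) / 2 * (2 * (-1) ^ (t + 1 - a)) =
          -((1 - (-1 : ℂ) ^ a) / 2 * (2 * (-1) ^ (t - a))) := fun a ha => by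
        rw [Nat.succ_sub (Finset.mem_range.1 ha).le, pow_succ]
        ring
      rw [Finset.sum_congr rfl h2, Finset.sum_neg_distrib, ih, Nat.add_sub_cancel_left]
      rcases Nat.even_or_odd t with h | h
      · rw [pow_succ (-1 : ℂ) t, h.neg_one_pow]; push_cast; ring
      · rw [pow_succ (-1 : ℂ) t, h.neg_one_pow]; push_cast; ring
  rw [Finset.Nat.sum_antidiagonal_eq_sum_range_succ_mk, Finset.sum_range_succ]
  have h3 : ∀ a ∈ Finset.range t, (if Odd a then cayley (t - a) else 0) =
      (1 - (-1 : ℂ) ^ a) / 2 * (2 * (-1) ^ (t - a)) := fun a ha => by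
    have : t - a ≠ 0 := by have := Finset.mem_range.1 ha; omega
    rw [← hp, cayley, if_neg this]
    split_ifs <;> simp
  rw [Finset.sum_congr rfl h3, h1]
  rcases Nat.eq_zero_or_pos t with rfl | ht
  · simp
  · rw [Nat.sub_self, cayley, cayley, if_pos rfl, if_neg ht.ne', hp]
    rcases Nat.even_or_odd t with h | h
    · rw [h.neg_one_pow]; ring
    · rw [h.neg_one_pow]; ring

/-- Suppose that the logarithmic derivative `D = ∑ D_k X^k` of a power series `E` over an algebra
satisfies `[D_k, c_q] = -2 c_(q-k)` for odd `k ≤ q` and `[D_k, c_q] = 0` otherwise. Then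
`E c(w) = (1 - Xw)/(1 + Xw) c(w) E` for `c(w) = ∑ c_q w^q`. -/
theorem mul_C_eq_of_euler {E D : PowerSeries R} (hD : PowerSeries.coeff 0 D = 0)
    (hE : euler E = D * E) (h0 : PowerSeries.coeff 0 E = 1)
    (c : ℕ → R) (hc : ∀ k q, PowerSeries.coeff k D * c q = c q * PowerSeries.coeff k D -
      if Odd k ∧ k ≤ q then (2 : ℂ) • c (q - k) else 0) (q : ℕ) :
    E * PowerSeries.C (c q) = ∑ p ∈ Finset.HasAntidiagonal.antidiagonal q,
      cayley p.1 • ((PowerSeries.X ^ p.1 : PowerSeries R) * (PowerSeries.C (c p.2) * E)) := by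
  -- The outer variable is `w`, the inner one `X`. Here `H = (1 - Xw)/(1 + Xw)`, and `O` is the sum
  -- of the odd powers of `Xw`; differentiation is with respect to `X` only.
  let H : PowerSeries (PowerSeries R) := PowerSeries.mk fun r => cayley r • PowerSeries.X ^ r
  let O : PowerSeries (PowerSeries R) :=
    PowerSeries.mk fun a => if Odd a then PowerSeries.X ^ a else 0
  let c' : PowerSeries (PowerSeries R) := PowerSeries.mk fun q => PowerSeries.C (c q)
  let E' : PowerSeries (PowerSeries R) := PowerSeries.C E
  let D' : PowerSeries (PowerSeries R) := PowerSeries.C D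
  have hX : ∀ (a : ℕ) (P : PowerSeries R), PowerSeries.X ^ a * P = P * PowerSeries.X ^ a :=
    fun a P => ((PowerSeries.commute_X P).pow_right a).eq.symm
  have hcE : innerEuler c' = 0 := by
    ext1 k; rw [coeff_innerEuler, PowerSeries.coeff_mk, euler_C, map_zero]
  have hE' : innerEuler E' = D' * E' := by
    ext1 k
    rw [coeff_innerEuler, PowerSeries.coeff_C_mul, PowerSeries.coeff_C]
    split_ifs
    · exact hE
    · rw [euler_zero, mul_zero]
  have hH : innerEuler H = -(2 : ℂ) • (O * H) := by
    ext1 t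
    rw [coeff_innerEuler, PowerSeries.coeff_mk]
    rw [coeff_csmul, PowerSeries.coeff_mul]
    have : ∀ p ∈ Finset.HasAntidiagonal.antidiagonal t, PowerSeries.coeff p.1 O *
        PowerSeries.coeff p.2 H =
        (if Odd p.1 then cayley p.2 else 0) • (PowerSeries.X ^ t : PowerSeries R) := by
      intro p hp
      rw [PowerSeries.coeff_mk, PowerSeries.coeff_mk,
        ← Finset.HasAntidiagonal.mem_antidiagonal.1 hp, pow_add]
      split_ifs
      · rw [mul_smul_comm]
      · simp
    rw [Finset.sum_congr rfl this, ← Finset.sum_smul, sum_odd_cayley, smul_smul]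
    ext k
    rw [coeff_euler]
    rw [coeff_csmul, coeff_csmul, PowerSeries.coeff_X_pow, smul_smul]
    split_ifs with h
    · subst h; congr 1; ring
    · simp
  have hcD : D' * c' = c' * D' - (2 : ℂ) • (O * c') := by
    ext1 q
    rw [map_sub, PowerSeries.coeff_C_mul, PowerSeries.coeff_mul_C]
    rw [coeff_csmul, PowerSeries.coeff_mk, PowerSeries.coeff_mul]
    ext k
    rw [map_sub, PowerSeries.coeff_mul_C, PowerSeries.coeff_C_mul]
    rw [coeff_csmul, hc, map_sum]
    congr 1
    have : ∀ p ∈ Finset.HasAntidiagonal.antidiagonal q, PowerSeries.coeff k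
        (PowerSeries.coeff p.1 O * PowerSeries.coeff p.2 c') =
        if p.1 = k ∧ Odd k then c p.2 else 0 := by
      intro p _
      rw [PowerSeries.coeff_mk, PowerSeries.coeff_mk]
      split_ifs with h1 h2 h2
      · rw [PowerSeries.coeff_mul_C, PowerSeries.coeff_X_pow, if_pos h2.1.symm, one_mul]
      · rw [PowerSeries.coeff_mul_C, PowerSeries.coeff_X_pow, if_neg, zero_mul]
        rintro rfl; exact h2 ⟨rfl, h1⟩
      · exact absurd (h2.1 ▸ h2.2) h1
      · simp
    rw [Finset.sum_congr rfl this]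
    split_ifs with h
    · rw [Finset.sum_eq_single (k, q - k)]
      · rw [if_pos ⟨rfl, h.1⟩]
      · intro p hp hne
        refine if_neg fun h' => hne (Prod.ext h'.1 ?_)
        have := Finset.HasAntidiagonal.mem_antidiagonal.1 hp
        dsimp only; omega
      · intro h'
        exact absurd (Finset.HasAntidiagonal.mem_antidiagonal.2 (by dsimp only; omega)) h'
    · rw [Finset.sum_eq_zero, smul_zero]
      intro p hp
      refine if_neg fun h' => h ⟨h'.2, ?_⟩
      have := Finset.HasAntidiagonal.mem_antidiagonal.1 hp
      omega
  have hHD : H * D' = D' * H := by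
    ext1 k
    rw [PowerSeries.coeff_mul_C, PowerSeries.coeff_C_mul, PowerSeries.coeff_mk, smul_mul_assoc, hX,
      mul_smul_comm]
  have hOH : O * H = H * O := by
    refine (PowerSeries.commute_of_coeff fun i j => ?_).eq
    rw [PowerSeries.coeff_mk, PowerSeries.coeff_mk]
    refine Commute.smul_right ?_ _
    split_ifs
    · exact (hX i _)
    · exact Commute.zero_left _
  -- Moving `D'` to the left of `c'` produces `2 O c'`, which cancels the derivative `-2 O H` of
  -- `H`. So `H c' E'` solves the same equation as `E' c'`, coefficient by coefficient in `w`.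
  have hZ : innerEuler (H * c' * E') = D' * (H * c' * E') := by
    have e1 : H * c' * (D' * E') = H * (c' * D') * E' := by noncomm_ring
    have e2 : c' * D' = D' * c' + (2 : ℂ) • (O * c') := by rw [hcD, sub_add_cancel]
    rw [innerEuler_mul, innerEuler_mul, hcE, hH, hE', mul_zero, add_zero, e1, e2, mul_add,
      ← mul_assoc H D', hHD, mul_smul_comm, ← mul_assoc H O, ← hOH, neg_smul, add_mul,
      neg_mul, neg_mul, smul_mul_assoc, smul_mul_assoc]
    simp only [mul_assoc]
    abel
  have hco : ∀ q, PowerSeries.coeff q (H * c' * E') =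
      ∑ p ∈ Finset.HasAntidiagonal.antidiagonal q, cayley p.1 •
        ((PowerSeries.X ^ p.1 : PowerSeries R) * (PowerSeries.C (c p.2) * E)) := fun q => by
    rw [PowerSeries.coeff_mul_C, PowerSeries.coeff_mul, Finset.sum_mul]
    refine Finset.sum_congr rfl fun p _ => ?_
    rw [PowerSeries.coeff_mk, PowerSeries.coeff_mk, smul_mul_assoc, smul_mul_assoc, mul_assoc]
  rw [← hco]
  refine eq_of_euler_eq hD ?_ ?_ ?_
  · rw [euler_mul, hE, euler_C, mul_zero, add_zero, mul_assoc]
  · rw [← coeff_innerEuler, hZ, PowerSeries.coeff_C_mul]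
  · rw [hco, map_sum, Finset.sum_eq_single (0, q)]
    · rw [coeff_csmul]
      simp [cayley, h0]
    · intro p hp hne
      have : p.1 ≠ 0 := fun h => hne (Prod.ext h (by
        have := Finset.HasAntidiagonal.mem_antidiagonal.1 hp; dsimp only; omega))
      rw [coeff_csmul, PowerSeries.coeff_X_pow_mul', if_neg (by omega), smul_zero]
    · intro h
      exact absurd (Finset.HasAntidiagonal.mem_antidiagonal.2 (by simp)) h

/-- If the commutator of `x` with the logarithmic derivative is `n X^n`, then its commutator with
the exponential is `X^n E`. Indeed `x E - X^n E` and `E x` solve the same equation with the same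
initial value, `n` being non-zero. -/
theorem C_mul_eq_of_euler {E D : PowerSeries R} (hD : PowerSeries.coeff 0 D = 0)
    (hE : euler E = D * E) (h0 : PowerSeries.coeff 0 E = 1) (x : R) {n : ℕ} (hn : n ≠ 0)
    (hx : ∀ k, x * PowerSeries.coeff k D = PowerSeries.coeff k D * x +
      if k = n then (n : ℂ) • 1 else 0) :
    PowerSeries.C x * E = E * PowerSeries.C x + PowerSeries.X ^ n * E := by
  have hX : ∀ P : PowerSeries R, PowerSeries.X ^ n * P = P * PowerSeries.X ^ n :=
    fun P => ((PowerSeries.commute_X P).pow_right n).eq.symm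
  have hD' : PowerSeries.C x * D = D * PowerSeries.C x + (n : ℂ) • PowerSeries.X ^ n := by
    ext1 k
    rw [map_add, PowerSeries.coeff_C_mul, PowerSeries.coeff_mul_C, coeff_csmul,
      PowerSeries.coeff_X_pow, hx]
    split_ifs <;> simp
  have hneg : ∀ P : PowerSeries R, euler (-P) = -euler P := fun P => by
    ext k; simp only [coeff_euler, map_neg, smul_neg]
  rw [add_comm, ← sub_eq_iff_eq_add']
  refine eq_of_euler_eq hD ?_ ?_ ?_
  · rw [sub_eq_add_neg, euler_add, hneg, euler_mul, euler_mul, euler_C, zero_mul, zero_add, hE,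
      ← mul_assoc, hD', euler_X_pow, add_mul, mul_add, mul_assoc, ← mul_assoc _ D, hX, mul_neg,
      mul_assoc]
    abel
  · rw [euler_mul, euler_C, mul_zero, add_zero, hE, mul_assoc]
  · rw [map_sub, PowerSeries.coeff_C_mul, PowerSeries.coeff_mul_C, h0,
      PowerSeries.coeff_X_pow_mul', if_neg (by omega), mul_one, one_mul, sub_zero]

/-- The coefficientwise form of `mul_C_eq_of_euler`, with the denominator cleared. -/
theorem coeff_exchange_of_euler {E D : PowerSeries R} (hD : PowerSeries.coeff 0 D = 0)
    (hE : euler E = D * E) (h0 : PowerSeries.coeff 0 E = 1)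
    (c : ℕ → R) (hc : ∀ k q, PowerSeries.coeff k D * c q = c q * PowerSeries.coeff k D -
      if Odd k ∧ k ≤ q then (2 : ℂ) • c (q - k) else 0) (p q : ℕ) :
    PowerSeries.coeff (p + 1) E * c (q + 1) + PowerSeries.coeff p E * c q =
      c (q + 1) * PowerSeries.coeff (p + 1) E - c q * PowerSeries.coeff p E := by
  have key : ∀ p q : ℕ, PowerSeries.coeff p E * c q = ∑ r ∈ Finset.range (q + 1),
      cayley r • (if r ≤ p then c (q - r) * PowerSeries.coeff (p - r) E else 0) := by
    intro p q
    have h := congrArg (PowerSeries.coeff p) (mul_C_eq_of_euler hD hE h0 c hc q)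
    rw [PowerSeries.coeff_mul_C, map_sum, Finset.Nat.sum_antidiagonal_eq_sum_range_succ_mk] at h
    refine h.trans (Finset.sum_congr rfl fun r _ => ?_)
    rw [coeff_csmul, PowerSeries.coeff_X_pow_mul', PowerSeries.coeff_C_mul]
  -- Multiplying by `1 + Xw` telescopes the expansion: consecutive values of `cayley` cancel from
  -- index 1 on. What remains is the leading term and the term with coefficient `cayley 1 + cayley 0
  -- = -1`.
  rw [key, key, Finset.sum_range_succ', add_right_comm, ← Finset.sum_add_distrib,
    Finset.sum_range_succ', Finset.sum_eq_zero, zero_add]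
  · simp only [cayley, Nat.zero_add, Nat.add_sub_cancel, Nat.sub_zero, Nat.zero_le, if_true,
      one_ne_zero, if_false, one_smul, le_add_iff_nonneg_left, pow_one, mul_neg, mul_one, neg_smul,
      two_smul]
    abel
  · intro r _
    simp only [Nat.add_sub_add_right, Nat.add_le_add_iff_right, ← add_smul]
    rw [cayley, cayley, if_neg (by omega), if_neg (by omega), pow_succ]
    simp

end Exchange

/-! ### Exchange relations for the modes of `E_+` and `E_-`. -/

section Vertex

variable {ν : ℕ}

/-- The coefficient of `z^(-sk)` in `E_±(ε_i, z)`, which is zero for negative `k`. -/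
def expMode (s : ℤˣ) (i : Fin ν) (k : ℤ) : Module.End ℂ (SymAlg ν) :=
  if 0 ≤ k then PowerSeries.coeff k.toNat (expE s (basisVec i) 1) else 0

theorem expMode_natCast (s : ℤˣ) (i : Fin ν) (k : ℕ) :
    expMode s i k = PowerSeries.coeff k (expE s (basisVec i) 1) := by
  rw [expMode, if_pos (Int.natCast_nonneg k), Int.toNat_natCast]

theorem expMode_neg (s : ℤˣ) (i : Fin ν) {k : ℤ} (hk : k < 0) : expMode s i k = 0 :=
  if_neg (by omega)

theorem expMode_zero (s : ℤˣ) (i : Fin ν) : expMode s i 0 = 1 := by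
  have := expMode_natCast s i 0
  rwa [coeff_zero_expE] at this

theorem commute_expMode {s : ℤˣ} {i : Fin ν} {T : Module.End ℂ (SymAlg ν)}
    (h : ∀ k : ℕ, Commute T (osc i (s * k))) (k : ℤ) : Commute T (expMode s i k) := by
  rw [expMode]
  split_ifs
  · exact commute_coeff_expE h _
  · exact Commute.zero_right _

theorem expMode_commute_same (s : ℤˣ) (i j : Fin ν) (k l : ℤ) :
    Commute (expMode s i k) (expMode s j l) := by
  refine commute_expMode (fun b => Commute.symm (commute_expMode (fun a => ?_) _)) _
  rw [← heis_basisVec, ← heis_basisVec]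
  exact heis_commute s _ _ b a

theorem expMode_commute_of_ne (s t : ℤˣ) {i j : Fin ν} (hij : i ≠ j) (k l : ℤ) :
    Commute (expMode s i k) (expMode t j l) :=
  commute_expMode (fun _ => Commute.symm (commute_expMode (fun _ =>
    osc_commute_of_ne hij.symm _ _) _)) _

/-- The positive oscillator differentiates the exponent of `E_-(ε_i, z)`, whose coefficient `2/n`
cancels the `n/2` of the Heisenberg relation; the commutator is `z^n E_-(ε_i, z)`. -/
theorem osc_mul_expE (i : Fin ν) {n : ℕ} (hn : Odd n) :
    PowerSeries.C (osc i n) * expE (-1) (basisVec i) 1 =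
      expE (-1) (basisVec i) 1 * PowerSeries.C (osc i n) +
        PowerSeries.X ^ n * expE (-1) (basisVec i) 1 := by
  refine C_mul_eq_of_euler (coeff_zero_expD _ _ _) (euler_expE _ _ _)
    (coeff_zero_expE _ _ _) _ (by rintro rfl; simp at hn) fun k => ?_
  rw [expD, PowerSeries.coeff_mk, heis_basisVec, mul_smul_comm,
    osc_comm i i (Int.natCast_nonneg n), smul_add, smul_mul_assoc]
  congr 1
  have hn' : Odd (n : ℤ) := by exact_mod_cast hn
  by_cases h : k = n
  · subst h
    rw [if_pos ⟨rfl, by simp, hn'⟩, if_pos rfl, smul_smul]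
    congr 1
    push_cast
    rw [one_zpow]
    ring
  · rw [if_neg, if_neg h, smul_zero]
    rintro ⟨_, h', _⟩
    push_cast at h'
    omega

/-- The exchange relation `(1 + w/z) E_+(ε_i, z) E_-(ε_i, w) = (1 - w/z) E_-(ε_i, w) E_+(ε_i, z)`. -/
theorem expMode_exchange (i : Fin ν) (p q : ℤ) :
    expMode 1 i p * expMode (-1) i q + expMode 1 i (p - 1) * expMode (-1) i (q - 1) =
      expMode (-1) i q * expMode 1 i p - expMode (-1) i (q - 1) * expMode 1 i (p - 1) := by
  by_cases hp : p < 0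
  · simp [expMode_neg 1 i hp, expMode_neg 1 i (show p - 1 < 0 by omega)]
  by_cases hq : q < 0
  · simp [expMode_neg (-1) i hq, expMode_neg (-1) i (show q - 1 < 0 by omega)]
  obtain ⟨p, rfl⟩ := Int.eq_ofNat_of_zero_le (not_lt.1 hp)
  obtain ⟨q, rfl⟩ := Int.eq_ofNat_of_zero_le (not_lt.1 hq)
  rcases p with _ | p
  · simp [expMode_zero, expMode_neg 1 i (show (-1 : ℤ) < 0 by omega)]
  rcases q with _ | q
  · simp [expMode_zero, expMode_neg (-1) i (show (-1 : ℤ) < 0 by omega)]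
  rw [Nat.cast_succ, Nat.cast_succ, add_sub_cancel_right, add_sub_cancel_right, ← Nat.cast_succ,
    ← Nat.cast_succ]
  simp only [expMode_natCast]
  refine coeff_exchange_of_euler (coeff_zero_expD 1 (basisVec i) 1)
    (euler_expE 1 (basisVec i) 1) (coeff_zero_expE 1 (basisVec i) 1)
    (fun q => PowerSeries.coeff q (expE (-1) (basisVec i) 1)) (fun k q => ?_) p q
  rw [expD, PowerSeries.coeff_mk, heis_basisVec, Units.val_one, one_mul, smul_mul_assoc,
    mul_smul_comm]
  -- The logarithmic derivative of `E_+` has the coefficients `-2 ε_i(k)`, so by `osc_mul_expE` its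
  -- commutator with a mode of `E_-` is `-2` times the mode with index lowered by `k`.
  by_cases hk : Odd k
  · have h := congrArg (PowerSeries.coeff q) (osc_mul_expE i hk)
    rw [map_add, PowerSeries.coeff_C_mul, PowerSeries.coeff_mul_C,
      PowerSeries.coeff_X_pow_mul'] at h
    rw [h, smul_add, sub_eq_add_neg]
    congr 1
    by_cases hkq : k ≤ q
    · rw [if_pos hkq, if_pos ⟨hk, hkq⟩]
      refine Eq.trans ?_ (neg_smul (2 : ℂ) _)
      simp
    · rw [if_neg hkq, if_neg (fun h => hkq h.2), smul_zero, neg_zero]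
  · rw [osc_even _ (by exact_mod_cast hk), if_neg (fun h => hk h.1)]
    simp

end Vertex

/-! ## Locally finite sums -/

section FiniteSums

variable {V : Type*} [AddCommGroup V]

theorem hasFiniteSupport_of_bounds {f : ℤ → V} (a b : ℤ) (h : ∀ k, k < a ∨ b < k → f k = 0) :
    Function.HasFiniteSupport f :=
  (Set.finite_Icc a b).subset fun k hk => by
    by_contra h'
    simp only [Set.mem_Icc, not_and_or, not_le] at h'
    exact hk (h k h')

theorem finsum_shift (f : ℤ → V) (c : ℤ) : ∑ᶠ k, f (k + c) = ∑ᶠ k, f k :=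
  finsum_comp_equiv (Equiv.addRight c)

theorem finsum_reflect (f : ℤ → V) (c : ℤ) : ∑ᶠ k, f (c - k) = ∑ᶠ k, f k :=
  finsum_comp_equiv (Equiv.subLeft c)

theorem finsum_int_eq_nat (f : ℤ → V) (h : ∀ k < 0, f k = 0) : ∑ᶠ k, f k = ∑ᶠ l : ℕ, f l := by
  rw [← finsum_mem_univ, ← finsum_mem_range (f := f) (g := fun l : ℕ => (l : ℤ)) Nat.cast_injective]
  refine finsum_mem_inter_support_eq' _ _ _ fun k hk => ⟨fun _ => ?_, fun _ => Set.mem_univ _⟩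
  have : 0 ≤ k := by
    by_contra h'
    exact hk (h k (not_le.1 h'))
  exact ⟨k.toNat, Int.toNat_of_nonneg this⟩

theorem finsum_eq_sum_range (f : ℤ → V) (n : ℕ) (h : ∀ k : ℤ, k < 0 ∨ n < k → f k = 0) :
    ∑ᶠ k, f k = ∑ k ∈ Finset.range (n + 1), f k := by
  rw [finsum_int_eq_nat f fun k hk => h k (Or.inl hk)]
  refine finsum_eq_sum_of_support_subset _ fun k hk => ?_
  by_contra h'
  exact hk (h k (Or.inr (by simpa using h')))

theorem finsum_swap (f : ℤ → ℤ → V) {a b c d : ℤ}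
    (h : ∀ p q, p < a ∨ b < p ∨ q < c ∨ d < q → f p q = 0) :
    ∑ᶠ p, ∑ᶠ q, f p q = ∑ᶠ q, ∑ᶠ p, f p q := by
  have hf : Function.HasFiniteSupport fun t : ℤ × ℤ => f t.1 t.2 := by
    refine ((Set.finite_Icc a b).prod (Set.finite_Icc c d)).subset fun t ht => ?_
    by_contra h'
    refine ht (h _ _ ?_)
    simp only [Set.mem_prod, Set.mem_Icc, not_and_or, not_le] at h'
    tauto
  have hg : Function.HasFiniteSupport fun t : ℤ × ℤ => f t.2 t.1 :=
    hf.preimage Prod.swap_injective.injOn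
  rw [← finsum_curry (fun t : ℤ × ℤ => f t.1 t.2) hf,
    ← finsum_curry (fun t : ℤ × ℤ => f t.2 t.1) hg]
  exact (finsum_comp_equiv (Equiv.prodComm ℤ ℤ)).symm

variable [Module ℂ V]

/-- The sum of a locally finite family of operators. -/
def locSum (T : ℤ → Module.End ℂ V) (hT : ∀ v, Function.HasFiniteSupport fun k => T k v) :
    Module.End ℂ V where
  toFun v := ∑ᶠ k, T k v
  map_add' v w := by
    rw [← finsum_add_distrib (hT v) (hT w)]
    simp only [map_add]
  map_smul' r v := by
    rw [RingHom.id_apply, smul_finsum' r (hT v)]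
    simp only [map_smul]

/-- Summation of `u(k) - u(k+1) = f(k) + f(k+1)` for `u` of finite support. -/
theorem finsum_eq_two_smul_of_sub_shift {u f : ℤ → V} (hu : Function.HasFiniteSupport u)
    (hf : Function.HasFiniteSupport f) (h : ∀ k, u k - u (k + 1) = f k + f (k + 1)) :
    ∑ᶠ k, f k = 0 ∧ ∑ᶠ k, u k = (2 : ℂ) • ∑ᶠ k : ℤ, (k : ℂ) • f k := by
  have hu1 : Function.HasFiniteSupport fun k => u (k + 1) :=
    hu.preimage (add_left_injective 1).injOn
  have hf1 : Function.HasFiniteSupport fun k => f (k + 1) :=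
    hf.preimage (add_left_injective 1).injOn
  -- Unweighted summation telescopes on the left and gives twice the sum of `f` on the right.
  have h0 : ∑ᶠ k, f k = 0 := by
    have h1 : ∑ᶠ k, (u k - u (k + 1)) = ∑ᶠ k, (f k + f (k + 1)) := finsum_congr h
    rw [finsum_sub_distrib hu hu1, finsum_add_distrib hf hf1, finsum_shift, finsum_shift,
      sub_self, ← two_smul ℂ] at h1
    exact (smul_eq_zero.1 h1.symm).resolve_left two_ne_zero
  refine ⟨h0, ?_⟩
  have hs : ∀ {g : ℤ → V} (c : ℤ → ℂ), Function.HasFiniteSupport g →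
      Function.HasFiniteSupport fun k => c k • g k := fun c hg =>
    hg.subset fun k hk h' => hk (by dsimp only; rw [h', smul_zero])
  have e2 : ∀ k : ℤ, (k : ℂ) • (u k - u (k + 1)) =
      (k : ℂ) • f k + (((k + 1 : ℤ) : ℂ) • f (k + 1) - f (k + 1)) := fun k => by
    rw [h]; push_cast; module
  have hk1 : Function.HasFiniteSupport fun k : ℤ => ((k + 1 : ℤ) : ℂ) • f (k + 1) :=
    (hs (fun k => (k : ℂ)) hf).preimage (add_left_injective 1).injOn
  have hk2 : Function.HasFiniteSupport fun k : ℤ => ((k + 1 : ℤ) : ℂ) • u (k + 1) :=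
    (hs (fun k => (k : ℂ)) hu).preimage (add_left_injective 1).injOn
  have e3 : ∀ k : ℤ, (k : ℂ) • (u k - u (k + 1)) =
      (k : ℂ) • u k - (((k + 1 : ℤ) : ℂ) • u (k + 1) - u (k + 1)) := fun k => by
    push_cast; module
  -- Summation by parts with weight `k`. The right-hand side of the hypothesis, weighted in the same
  -- way, gives `2 ∑ k f(k) - ∑ f(k)`, and the last sum vanishes.
  have h2 : ∑ᶠ k : ℤ, (k : ℂ) • (u k - u (k + 1)) = ∑ᶠ k, u k := by
    rw [finsum_congr e3, finsum_sub_distrib (hs _ hu) (hk2.fun_sub hu1),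
      finsum_sub_distrib hk2 hu1, finsum_shift (fun k => (k : ℂ) • u k), finsum_shift u]
    abel
  rw [← h2, finsum_congr e2, finsum_add_distrib (hs _ hf) (hk1.fun_sub hf1),
    finsum_sub_distrib hk1 hf1, finsum_shift (fun k => (k : ℂ) • f k), finsum_shift f, h0, sub_zero,
    two_smul]

end FiniteSums

/-! ## Modes of vertex operators on the symmetric algebra -/

section Modes

variable {ν : ℕ}

theorem exists_expMode_eq_zero (i : Fin ν) (f : SymAlg ν) :
    ∃ W : ℤ, ∀ p, W < p → expMode 1 i p f = 0 := by
  obtain ⟨n, hn⟩ := exists_mem_wtLE f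
  refine ⟨n, fun p hp => ?_⟩
  obtain ⟨p, rfl⟩ := Int.eq_ofNat_of_zero_le (show 0 ≤ p by omega)
  rw [expMode_natCast]
  exact wtLE_neg (by omega) (SeriesLowers.expE (basisVec i) 1 p n f hn)

theorem mode_hasFiniteSupport (i : Fin ν) (c : ℤ → Module.End ℂ (SymAlg ν)) (f : SymAlg ν) :
    Function.HasFiniteSupport fun p => c p (expMode 1 i p f) := by
  obtain ⟨W, hW⟩ := exists_expMode_eq_zero i f
  refine hasFiniteSupport_of_bounds 0 W fun k hk => ?_
  rcases hk with hk | hk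
  · rw [expMode_neg 1 i hk, LinearMap.zero_apply, map_zero]
  · rw [hW k hk, map_zero]

/-- The coefficient of `z^(-m)` in `E_-(ε_i, z) E_+(ε_i, z)`. -/
def mode (i : Fin ν) (m : ℤ) : Module.End ℂ (SymAlg ν) :=
  locSum (fun p => expMode (-1) i (p - m) * expMode 1 i p)
    (mode_hasFiniteSupport i fun p => expMode (-1) i (p - m))

theorem mode_apply (i : Fin ν) (m : ℤ) (f : SymAlg ν) :
    mode i m f = ∑ᶠ p, expMode (-1) i (p - m) (expMode 1 i p f) := rfl

theorem exists_mode_eq_zero (i : Fin ν) (f : SymAlg ν) :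
    ∃ W : ℤ, ∀ m, W < m → mode i m f = 0 := by
  obtain ⟨W, hW⟩ := exists_expMode_eq_zero i f
  refine ⟨W, fun m hm => ?_⟩
  rw [mode_apply, ← finsum_zero (α := ℤ)]
  refine finsum_congr fun p => ?_
  rcases lt_or_ge W p with hp | hp
  · rw [hW p hp, map_zero]
  · rw [expMode_neg _ _ (by omega), LinearMap.zero_apply]

theorem commute_mode {i : Fin ν} {T : Module.End ℂ (SymAlg ν)}
    (h : ∀ (s : ℤˣ) (k : ℤ), Commute T (expMode s i k)) (m : ℤ) : Commute T (mode i m) := by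
  refine LinearMap.ext fun f => ?_
  rw [Module.End.mul_apply, Module.End.mul_apply, mode_apply, mode_apply, map_finsum]
  · refine finsum_congr fun p => ?_
    have h1 := LinearMap.congr_fun (h (-1) (p - m)).eq (expMode 1 i p f)
    have h2 := LinearMap.congr_fun (h 1 p).eq f
    simp only [Module.End.mul_apply] at h1 h2
    rw [h1, h2]
  · exact mode_hasFiniteSupport i _ f

theorem mode_commute_of_ne {i j : Fin ν} (hij : i ≠ j) (m n : ℤ) :
    Commute (mode i m) (mode j n) :=
  commute_mode (fun _ _ => (commute_mode (fun _ _ =>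
    expMode_commute_of_ne _ _ hij.symm _ _) _).symm) _

/-- The exchange relation `(z + w) X(z) E_-(w) = (z - w) E_-(w) X(z)` for
`X(z) = E_-(ε_i, z) E_+(ε_i, z)`. -/
theorem mode_exchange (i : Fin ν) (m s : ℤ) :
    mode i m * expMode (-1) i s + mode i (m - 1) * expMode (-1) i (s - 1) =
      expMode (-1) i s * mode i m - expMode (-1) i (s - 1) * mode i (m - 1) := by
  refine LinearMap.ext fun f => ?_
  simp only [LinearMap.add_apply, LinearMap.sub_apply, Module.End.mul_apply]
  have sh : ∀ g : SymAlg ν, mode i (m - 1) g =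
      ∑ᶠ p, expMode (-1) i (p - m) (expMode 1 i (p - 1) g) := fun g => by
    rw [mode_apply, ← finsum_shift _ (-1)]
    refine finsum_congr fun p => ?_
    rw [← sub_eq_add_neg, show p - 1 - (m - 1) = p - m by ring]
  have fin : ∀ g : SymAlg ν, Function.HasFiniteSupport
      fun p => expMode (-1) i (p - m) (expMode 1 i (p - 1) g) := fun g => by
    have := (mode_hasFiniteSupport i (fun p => expMode (-1) i (p + 1 - m)) g).preimage
      (add_left_injective (-1 : ℤ)).injOn
    refine this.subset fun p hp => ?_
    simpa [← sub_eq_add_neg] using hp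
  rw [sh, sh, mode_apply, mode_apply, map_finsum _ (mode_hasFiniteSupport i _ f),
    map_finsum _ (fin f), ← finsum_add_distrib (mode_hasFiniteSupport i _ _) (fin _),
    ← finsum_sub_distrib]
  · refine finsum_congr fun p => ?_
    have h := LinearMap.congr_fun (expMode_exchange i p s) f
    simp only [LinearMap.add_apply, LinearMap.sub_apply, Module.End.mul_apply] at h
    have h1 := fun g k => LinearMap.congr_fun
      (expMode_commute_same (-1) i i (p - m) k).eq g
    simp only [Module.End.mul_apply] at h1
    rw [← map_add, h, map_sub, h1, h1]
  · exact mode_hasFiniteSupport i (fun p => expMode (-1) i s * expMode (-1) i (p - m)) f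
  · refine (fin f).subset fun p hp h' => hp ?_
    dsimp only at h' ⊢
    rw [h', map_zero]

/-- The coefficient of `z^(-m) w^(-k)` in `E_-(ε_i, z) E_-(ε_j, w) E_+(ε_i, z) E_+(ε_j, w)`. -/
def biMode (i j : Fin ν) (m k : ℤ) : Module.End ℂ (SymAlg ν) :=
  locSum (fun q => expMode (-1) j (q - k) * (mode i m * expMode 1 j q))
    (mode_hasFiniteSupport j fun q => expMode (-1) j (q - k) * mode i m)

theorem biMode_apply (i j : Fin ν) (m k : ℤ) (f : SymAlg ν) :
    biMode i j m k f = ∑ᶠ q, expMode (-1) j (q - k) (mode i m (expMode 1 j q f)) := rfl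

theorem biMode_apply' (i j : Fin ν) (m k : ℤ) (f : SymAlg ν) :
    biMode i j m k f = ∑ᶠ q, ∑ᶠ p, expMode (-1) j (q - k) (expMode (-1) i (p - m)
      (expMode 1 i p (expMode 1 j q f))) := by
  rw [biMode_apply]
  refine finsum_congr fun q => ?_
  rw [mode_apply, map_finsum _ (mode_hasFiniteSupport i _ _)]

theorem exists_expMode_expMode_eq_zero (i j : Fin ν) (f : SymAlg ν) :
    ∃ W : ℤ, ∀ p q, (p < 0 ∨ W < p ∨ q < 0 ∨ W < q) → expMode 1 i p (expMode 1 j q f) = 0 := by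
  obtain ⟨W, hW⟩ := exists_expMode_eq_zero i f
  obtain ⟨W', hW'⟩ := exists_expMode_eq_zero j f
  refine ⟨max W W', fun p q h => ?_⟩
  rcases h with h | h | h | h
  · rw [expMode_neg _ _ h, LinearMap.zero_apply]
  · have := LinearMap.congr_fun (expMode_commute_same 1 i j p q).eq f
    simp only [Module.End.mul_apply] at this
    rw [this, hW p (lt_of_le_of_lt (le_max_left _ _) h), map_zero]
  · rw [expMode_neg _ _ h, LinearMap.zero_apply, map_zero]
  · rw [hW' q (lt_of_le_of_lt (le_max_right _ _) h), map_zero]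

/-- In a normally ordered product the creation parts commute with each other, and so do the
annihilation parts; on a vector the double sum is finite and may be interchanged. -/
theorem biMode_symm (i j : Fin ν) (m k : ℤ) : biMode i j m k = biMode j i k m := by
  refine LinearMap.ext fun f => ?_
  obtain ⟨W, hW⟩ := exists_expMode_expMode_eq_zero i j f
  rw [biMode_apply', biMode_apply', finsum_swap _ (a := 0) (b := W) (c := 0) (d := W)]
  · refine finsum_congr fun p => finsum_congr fun q => ?_
    have h1 := LinearMap.congr_fun (expMode_commute_same 1 i j p q).eq f
    have h2 := fun g => LinearMap.congr_fun
      (expMode_commute_same (-1) j i (q - k) (p - m)).eq g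
    simp only [Module.End.mul_apply] at h1 h2
    rw [h1, h2]
  · intro q p h
    rw [hW p q (by tauto), map_zero, map_zero]

theorem mode_mul_mode_of_ne {i j : Fin ν} (hij : i ≠ j) (m k : ℤ) :
    mode i m * mode j k = biMode i j m k := by
  refine LinearMap.ext fun f => ?_
  rw [Module.End.mul_apply, mode_apply j, biMode_apply, map_finsum _ (mode_hasFiniteSupport j _ f)]
  refine finsum_congr fun q => ?_
  have h := LinearMap.congr_fun (commute_mode (i := i) (T := expMode (-1) j (q - k))
    (fun s l => expMode_commute_of_ne _ _ hij.symm _ _) m).eq (expMode 1 j q f)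
  exact h.symm

/-- These are the coefficients of `(1 + w/z) X(z) X(w) = (1 - w/z) :X(z) X(w):`, obtained by
applying `mode_exchange` to the creation part of `X(w)`. -/
theorem mode_mul_mode_add (i : Fin ν) (m k : ℤ) :
    mode i m * mode i k + mode i (m - 1) * mode i (k + 1) =
      biMode i i m k - biMode i i (m - 1) (k + 1) := by
  refine LinearMap.ext fun f => ?_
  rw [LinearMap.add_apply, LinearMap.sub_apply, Module.End.mul_apply, Module.End.mul_apply,
    mode_apply i k, mode_apply i (k + 1), biMode_apply, biMode_apply,
    map_finsum _ (mode_hasFiniteSupport i _ f), map_finsum _ (mode_hasFiniteSupport i _ f),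
    ← finsum_add_distrib, ← finsum_sub_distrib]
  · refine finsum_congr fun q => ?_
    have h := LinearMap.congr_fun (mode_exchange i m (q - k)) (expMode 1 i q f)
    simp only [LinearMap.add_apply, LinearMap.sub_apply, Module.End.mul_apply] at h
    rw [show q - (k + 1) = q - k - 1 by ring, h]
  · exact mode_hasFiniteSupport i (fun q => expMode (-1) i (q - k) * mode i m) f
  · exact mode_hasFiniteSupport i (fun q => expMode (-1) i (q - (k + 1)) * mode i (m - 1)) f
  · exact mode_hasFiniteSupport i (fun q => mode i m * expMode (-1) i (q - k)) f
  · exact mode_hasFiniteSupport i (fun q => mode i (m - 1) * expMode (-1) i (q - (k + 1))) f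

theorem exists_biMode_eq_zero (i j : Fin ν) (f : SymAlg ν) :
    ∃ W : ℤ, ∀ m k, (W < m ∨ W < k) → biMode i j m k f = 0 := by
  have key : ∀ i j : Fin ν, ∃ W : ℤ, ∀ m k, W < k → biMode i j m k f = 0 := fun i j => by
    obtain ⟨W, hW⟩ := exists_expMode_eq_zero j f
    refine ⟨W, fun m k hk => ?_⟩
    rw [biMode_apply, ← finsum_zero (α := ℤ)]
    refine finsum_congr fun q => ?_
    rcases lt_or_ge W q with hq | hq
    · rw [hW q hq, map_zero, map_zero]
    · rw [expMode_neg _ _ (by omega), LinearMap.zero_apply]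
  obtain ⟨W, hW⟩ := key i j
  obtain ⟨W', hW'⟩ := key j i
  refine ⟨max W W', fun m k h => ?_⟩
  rcases h with h | h
  · rw [biMode_symm, hW' _ _ (lt_of_le_of_lt (le_max_right _ _) h)]
  · rw [hW _ _ (lt_of_le_of_lt (le_max_left _ _) h)]

theorem biMode_hasFiniteSupport (i j : Fin ν) (n : ℤ) (f : SymAlg ν) :
    Function.HasFiniteSupport fun k => biMode i j (n - k) k f := by
  obtain ⟨W, hW⟩ := exists_biMode_eq_zero i j f
  exact hasFiniteSupport_of_bounds (n - W) W fun k hk => hW _ _ (by omega)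

end Modes

/-! ### Specialization of normally ordered products at `w = -az`, and the anticommutation relations.
-/

section Laurent

variable {ν : ℕ}

theorem finsum_conv_expMode (s : ℤˣ) (i j : Fin ν) (c : ℤ → ℂ)
    (P : PowerSeries (Module.End ℂ (SymAlg ν)))
    (hP : ∀ k, PowerSeries.coeff k P = ∑ x ∈ Finset.HasAntidiagonal.antidiagonal k,
      c x.2 • (PowerSeries.coeff x.1 (expE s (basisVec i) 1) *
        PowerSeries.coeff x.2 (expE s (basisVec j) 1))) (k : ℤ) (g : SymAlg ν) :
    ∑ᶠ q, c q • expMode s i (k - q) (expMode s j q g) =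
      (if 0 ≤ k then PowerSeries.coeff k.toNat P else 0) g := by
  split_ifs with hk
  · obtain ⟨k, rfl⟩ := Int.eq_ofNat_of_zero_le hk
    rw [finsum_eq_sum_range _ k, Int.toNat_natCast, hP, ← Finset.Nat.sum_antidiagonal_swap,
      Finset.Nat.sum_antidiagonal_eq_sum_range_succ_mk, LinearMap.sum_apply]
    · refine Finset.sum_congr rfl fun q hq => ?_
      have : (k : ℤ) - q = ((k - q : ℕ) : ℤ) := by
        have := Finset.mem_range.1 hq; omega
      rw [this, expMode_natCast, expMode_natCast]
      rfl
    · intro q hq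
      rcases hq with hq | hq
      · rw [expMode_neg s j hq, LinearMap.zero_apply, map_zero, smul_zero]
      · rw [expMode_neg s i (by omega), LinearMap.zero_apply, smul_zero]
  · rw [LinearMap.zero_apply, ← finsum_zero (α := ℤ)]
    refine finsum_congr fun q => ?_
    rcases lt_or_ge q 0 with hq | hq
    · rw [expMode_neg s j hq, LinearMap.zero_apply, map_zero, smul_zero]
    · rw [expMode_neg s i (by omega), LinearMap.zero_apply, smul_zero]

/-- A term of the normally ordered product `E_-(ε_i, z) E_-(ε_j, w) E_+(ε_i, z) E_+(ε_j, w)`. -/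
def modeTerm (i j : Fin ν) (n : ℤ) (t : ℤ × ℤ × ℤ) : Module.End ℂ (SymAlg ν) :=
  (expMode (-1) i (t.1 - n - t.2.2) * expMode (-1) j t.2.2) *
    (expMode 1 i (t.1 - t.2.1) * expMode 1 j t.2.1)

theorem modeTerm_hasFiniteSupport (i j : Fin ν) (n : ℤ) (c : ℤ × ℤ × ℤ → ℂ) (f : SymAlg ν) :
    Function.HasFiniteSupport fun t => c t • modeTerm i j n t f := by
  obtain ⟨W, hW⟩ := exists_expMode_expMode_eq_zero i j f
  refine ((Set.finite_Icc 0 (W + W)).prod ((Set.finite_Icc 0 W).prod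
    (Set.finite_Icc 0 (W + W - n)))).subset fun t ht => ?_
  by_contra h'
  refine ht ?_
  dsimp only
  rw [modeTerm, Module.End.mul_apply, Module.End.mul_apply, Module.End.mul_apply]
  simp only [Set.mem_prod, Set.mem_Icc, not_and_or, not_le] at h'
  by_cases h1 : t.1 - t.2.1 < 0 ∨ W < t.1 - t.2.1 ∨ t.2.1 < 0 ∨ W < t.2.1
  · rw [hW _ _ h1, map_zero, map_zero, smul_zero]
  · by_cases h2 : t.2.2 < 0
    · rw [expMode_neg (-1) j h2, LinearMap.zero_apply, map_zero, smul_zero]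
    · rw [expMode_neg (-1) i (by omega), LinearMap.zero_apply, smul_zero]

/-- The change of variables between the two parametrizations of a normally ordered product. -/
def termEquiv : ℤ × ℤ × ℤ ≃ ℤ × ℤ × ℤ where
  toFun t := (t.2.2 + t.2.1, t.2.1, t.2.1 - t.1)
  invFun t := (t.2.1 - t.2.2, t.2.1, t.1 - t.2.1)
  left_inv t := by ext <;> simp
  right_inv t := by ext <;> simp

/-- The new parameters are the total degree of annihilation, the share of `ε_j` in it, and the share
of `ε_j` in the creation part. The exponent of `w^(-1)` is the difference of the two shares, so a
multiplicative weight splits into a creation and an annihilation factor, as needed in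
`finsum_smul_modeTerm`. -/
theorem finsum_smul_biMode (i j : Fin ν) (n : ℤ) (c : ℤ → ℂ) (f : SymAlg ν) :
    ∑ᶠ k, c k • biMode i j (n - k) k f =
      ∑ᶠ t : ℤ × ℤ × ℤ, c (t.2.1 - t.2.2) • modeTerm i j n t f := by
  have e : ∀ t : ℤ × ℤ × ℤ, c ((termEquiv t).2.1 - (termEquiv t).2.2) •
      modeTerm i j n (termEquiv t) f = c t.1 • expMode (-1) j (t.2.1 - t.1)
        (expMode (-1) i (t.2.2 - (n - t.1)) (expMode 1 i t.2.2 (expMode 1 j t.2.1 f))) := by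
    intro t
    have h := fun g => LinearMap.congr_fun (expMode_commute_same (-1) i j
      (t.2.2 - (n - t.1)) (t.2.1 - t.1)).eq g
    simp only [Module.End.mul_apply] at h
    simp only [termEquiv, Equiv.coe_fn_mk, modeTerm, Module.End.mul_apply, ← h]
    rw [show t.2.1 - (t.2.1 - t.1) = t.1 by ring, show t.2.2 + t.2.1 - n - (t.2.1 - t.1) =
      t.2.2 - (n - t.1) by ring, add_sub_cancel_right]
  rw [← finsum_comp_equiv termEquiv, finsum_congr e, finsum_curry₃]
  · refine finsum_congr fun k => ?_
    rw [biMode_apply', smul_finsum]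
    refine finsum_congr fun q => ?_
    rw [smul_finsum]
  · have := (modeTerm_hasFiniteSupport i j n (fun t => c (t.2.1 - t.2.2)) f).preimage
      termEquiv.injective.injOn
    refine this.subset fun t ht => ?_
    rw [Function.mem_support, ← e] at ht
    exact ht

theorem finsum_smul_modeTerm (i j : Fin ν) (n : ℤ) (c₁ c₂ : ℤ → ℂ)
    {N P : PowerSeries (Module.End ℂ (SymAlg ν))}
    (hN : ∀ k, PowerSeries.coeff k N = ∑ x ∈ Finset.HasAntidiagonal.antidiagonal k,
      c₂ x.2 • (PowerSeries.coeff x.1 (expE (-1) (basisVec i) 1) *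
        PowerSeries.coeff x.2 (expE (-1) (basisVec j) 1)))
    (hP : ∀ k, PowerSeries.coeff k P = ∑ x ∈ Finset.HasAntidiagonal.antidiagonal k,
      c₁ x.2 • (PowerSeries.coeff x.1 (expE 1 (basisVec i) 1) *
        PowerSeries.coeff x.2 (expE 1 (basisVec j) 1))) (f : SymAlg ν) :
    ∑ᶠ t : ℤ × ℤ × ℤ, (c₁ t.2.1 * c₂ t.2.2) • modeTerm i j n t f =
      ∑ᶠ l : ℕ, (if n ≤ l then PowerSeries.coeff (l - n).toNat N else 0)
        (PowerSeries.coeff l P f) := by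
  have e : ∀ l : ℤ, ∑ᶠ (q : ℤ) (q' : ℤ), (c₁ q * c₂ q') • modeTerm i j n (l, q, q') f =
      (if 0 ≤ l - n then PowerSeries.coeff (l - n).toNat N else 0)
        ((if 0 ≤ l then PowerSeries.coeff l.toNat P else 0) f) := by
    intro l
    obtain ⟨W, hW⟩ := exists_expMode_expMode_eq_zero i j f
    rw [← finsum_conv_expMode 1 i j c₁ P hP, map_finsum]
    · refine finsum_congr fun q => ?_
      rw [← finsum_conv_expMode (-1) i j c₂ N hN]
      refine finsum_congr fun q' => ?_
      simp only [modeTerm, Module.End.mul_apply, map_smul, smul_smul, mul_comm (c₁ q)]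
    · refine hasFiniteSupport_of_bounds 0 W fun q hq => ?_
      rw [hW _ _ (by tauto), smul_zero]
  rw [finsum_curry₃ _ (modeTerm_hasFiniteSupport i j n (fun t => c₁ t.2.1 * c₂ t.2.2) f),
    finsum_congr e, finsum_int_eq_nat]
  · refine finsum_congr fun l => ?_
    rw [if_pos (Int.natCast_nonneg l), Int.toNat_natCast]
    simp only [sub_nonneg]
  · intro k hk
    rw [if_neg (not_le.2 hk), LinearMap.zero_apply, map_zero]

/-- Setting `w = -az` in the normally ordered product of two fields turns `E_±(ε_j, w)` into
`E_±(-ε_j, az)`, by `coeff_expE_neg`. -/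
theorem finsum_biMode (i j : Fin ν) {a : ℂ} (ha : a ≠ 0) (n : ℤ) (f : SymAlg ν) :
    ∑ᶠ k, (-a) ^ (-k) • biMode i j (n - k) k f = expCoeff i j a n f := by
  have hna : -a ≠ 0 := neg_ne_zero.2 ha
  have e : ∀ t : ℤ × ℤ × ℤ, (-a) ^ (-(t.2.1 - t.2.2)) • modeTerm i j n t f =
      ((-a) ^ (-t.2.1) * (-a) ^ t.2.2) • modeTerm i j n t f := fun t => by
    rw [← zpow_add₀ hna]; congr 2; ring
  rw [finsum_smul_biMode i j n (fun k => (-a) ^ (-k)), finsum_congr e]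
  refine finsum_smul_modeTerm i j n (fun k => (-a) ^ (-k)) (fun k => (-a) ^ k) ?_ ?_ f
  · intro k
    rw [PowerSeries.coeff_mul]
    refine Finset.sum_congr rfl fun x _ => ?_
    rw [coeff_expE_neg _ _ _ ha, mul_smul_comm]
    simp
  · intro k
    rw [PowerSeries.coeff_mul]
    refine Finset.sum_congr rfl fun x _ => ?_
    rw [coeff_expE_neg _ _ _ ha, mul_smul_comm]
    simp

theorem expCoeff_diag_one (i : Fin ν) (n : ℤ) (f : SymAlg ν) :
    expCoeff i i 1 n f = if n = 0 then f else 0 := by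
  change (∑ᶠ l : ℕ, (if n ≤ l then PowerSeries.coeff (l - n).toNat
    (expE (-1) (basisVec i) 1 * expE (-1) (-basisVec i) 1) else 0)
      (PowerSeries.coeff l (expE 1 (basisVec i) 1 * expE 1 (-basisVec i) 1) f)) = _
  rw [expE_mul_expE_neg, expE_mul_expE_neg, finsum_eq_single _ 0]
  · rw [PowerSeries.coeff_one 0, if_pos rfl, Module.End.one_apply, PowerSeries.coeff_one]
    split_ifs <;> first | rfl | omega
  · intro l hl
    rw [PowerSeries.coeff_one l, if_neg hl, LinearMap.zero_apply, map_zero]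

/-- The weight `k` amounts to applying `-w d/dw` before setting `w = -z`. At that point the
exponentials cancel and only the logarithmic derivative survives, its `E_+` part giving positive and
its `E_-` part negative oscillators. This supplies the case `a = 1` on the diagonal. -/
theorem finsum_derivative_biMode (i : Fin ν) (n : ℤ) (f : SymAlg ν) :
    ∑ᶠ k : ℤ, ((k : ℂ) * (-1) ^ k) • biMode i i (n - k) k f = (2 : ℂ) • osc i n f := by
  have e : ∀ t : ℤ × ℤ × ℤ, (((t.2.1 - t.2.2 : ℤ) : ℂ) * (-1) ^ (t.2.1 - t.2.2)) •
      modeTerm i i n t f =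
      (((t.2.1 : ℂ) * (-1) ^ (-t.2.1)) * (-1) ^ t.2.2) • modeTerm i i n t f -
      ((-1) ^ (-t.2.1) * ((t.2.2 : ℂ) * (-1) ^ (t.2.2))) • modeTerm i i n t f := fun t => by
    have h1 : (-1 : ℂ) ^ (t.2.1 - t.2.2) = (-1) ^ (-t.2.1) * (-1) ^ t.2.2 := by
      rw [sub_eq_add_neg, zpow_add₀ (by norm_num), zpow_neg, zpow_neg, ← inv_zpow, ← inv_zpow]
      norm_num
    rw [← sub_smul, h1]
    congr 1
    push_cast
    ring
  have hc : ∀ (s : ℤˣ) (k : ℕ), PowerSeries.coeff k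
      (expE s (basisVec i) 1 * expE s (-basisVec i) 1) =
      ∑ x ∈ Finset.HasAntidiagonal.antidiagonal k, (-1 : ℂ) ^ (-(s * x.2 : ℤ)) •
        (PowerSeries.coeff x.1 (expE s (basisVec i) 1) *
          PowerSeries.coeff x.2 (expE s (basisVec i) 1)) := fun s k => by
    rw [PowerSeries.coeff_mul]
    refine Finset.sum_congr rfl fun x _ => ?_
    rw [coeff_expE_neg _ _ _ one_ne_zero, mul_smul_comm]
  have hd : ∀ (s : ℤˣ) (k : ℕ), PowerSeries.coeff k
      (expE s (basisVec i) 1 * euler (expE s (-basisVec i) 1)) =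
      ∑ x ∈ Finset.HasAntidiagonal.antidiagonal k, ((x.2 : ℂ) * (-1 : ℂ) ^ (-(s * x.2 : ℤ))) •
        (PowerSeries.coeff x.1 (expE s (basisVec i) 1) *
          PowerSeries.coeff x.2 (expE s (basisVec i) 1)) := fun s k => by
    rw [PowerSeries.coeff_mul]
    refine Finset.sum_congr rfl fun x _ => ?_
    rw [coeff_euler, coeff_expE_neg _ _ _ one_ne_zero, smul_smul, mul_smul_comm]
  rw [finsum_smul_biMode i i n (fun k => (k : ℂ) * (-1) ^ k), finsum_congr e, finsum_sub_distrib
    (modeTerm_hasFiniteSupport i i n _ f) (modeTerm_hasFiniteSupport i i n _ f),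
    finsum_smul_modeTerm i i n (fun k => (k : ℂ) * (-1) ^ (-k)) (fun k => (-1) ^ k)
      (N := expE (-1) (basisVec i) 1 * expE (-1) (-basisVec i) 1)
      (P := expE 1 (basisVec i) 1 * euler (expE 1 (-basisVec i) 1)),
    finsum_smul_modeTerm i i n (fun k => (-1) ^ (-k)) (fun k => (k : ℂ) * (-1) ^ k)
      (N := expE (-1) (basisVec i) 1 * euler (expE (-1) (-basisVec i) 1))
      (P := expE 1 (basisVec i) 1 * expE 1 (-basisVec i) 1)]
  · rw [expE_mul_expE_neg, expE_mul_expE_neg, expE_mul_euler_expE_neg, expE_mul_euler_expE_neg]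
    have h2 : (∑ᶠ l : ℕ, (if n ≤ l then PowerSeries.coeff (l - n).toNat
        (-expD (-1) (basisVec i) 1) else 0) (PowerSeries.coeff l
          (1 : PowerSeries (Module.End ℂ (SymAlg ν))) f)) =
        if n ≤ 0 then -((2 : ℂ) • osc i n f) else 0 := by
      rw [finsum_eq_single _ 0]
      · rw [PowerSeries.coeff_one, if_pos rfl, Module.End.one_apply, Nat.cast_zero, zero_sub]
        split_ifs with h
        · rw [map_neg, expD, PowerSeries.coeff_mk, heis_basisVec, LinearMap.neg_apply,
            Int.toNat_of_nonneg (by omega)]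
          simp
        · rfl
      · intro l hl
        rw [PowerSeries.coeff_one, if_neg hl, LinearMap.zero_apply, map_zero]
    have h1 : (∑ᶠ l : ℕ, (if n ≤ l then PowerSeries.coeff (l - n).toNat
        (1 : PowerSeries (Module.End ℂ (SymAlg ν))) else 0) (PowerSeries.coeff l
          (-expD 1 (basisVec i) 1) f)) =
        if 0 ≤ n then (2 : ℂ) • osc i n f else 0 := by
      split_ifs with h
      · obtain ⟨m, rfl⟩ := Int.eq_ofNat_of_zero_le h
        rw [finsum_eq_single _ m]
        · rw [if_pos le_rfl, sub_self, Int.toNat_zero, PowerSeries.coeff_one, if_pos rfl,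
            Module.End.one_apply, map_neg, expD, PowerSeries.coeff_mk, heis_basisVec,
            LinearMap.neg_apply]
          simp
        · intro l hl
          split_ifs with h'
          · rw [PowerSeries.coeff_one, if_neg (by omega), LinearMap.zero_apply]
          · rfl
      · refine (finsum_congr fun l => ?_).trans (finsum_zero (α := ℕ))
        rw [if_pos (by omega), PowerSeries.coeff_one, if_neg (by omega), LinearMap.zero_apply]
    rw [h1, h2]
    rcases lt_trichotomy n 0 with h | h | h
    · rw [if_neg (by omega), if_pos (by omega)]; simp
    · rw [h, osc_even _ (by simp)]; simp
    · rw [if_pos (by omega), if_neg (by omega)]; simp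
  · intro k; rw [hd]; simp
  · intro k; rw [hc]; simp
  · intro k; rw [hc]; simp
  · intro k; rw [hd]; simp

/-- The anticommutation relations between the modes of the same index. -/
theorem mode_anticomm (i : Fin ν) (m k : ℤ) :
    mode i m * mode i k + mode i k * mode i m =
      if m + k = 0 then (2 * (-1 : ℂ) ^ m) • 1 else 0 := by
  refine LinearMap.ext fun f => ?_
  obtain ⟨n, rfl⟩ : ∃ n, m = n - k := ⟨m + k, by ring⟩
  -- With the total degree `n` fixed, `G` records the products and `F` the normally ordered
  -- products.
  let G : ℤ → SymAlg ν := fun k => mode i (n - k) (mode i k f)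
  let F : ℤ → SymAlg ν := fun k => biMode i i (n - k) k f
  have hneg : ∀ k : ℤ, (-1 : ℂ) ^ (k + 1) = -(-1) ^ k := fun k => by
    rw [zpow_add_one₀ (by norm_num)]; ring
  have hGF : ∀ k, G k + G (k + 1) = F k - F (k + 1) := fun k => by
    have h := LinearMap.congr_fun (mode_mul_mode_add i (n - k) k) f
    simp only [LinearMap.add_apply, LinearMap.sub_apply, Module.End.mul_apply, sub_sub] at h
    exact h
  have hFs : ∀ k, F (n - k) = F k := fun k => by
    change biMode i i (n - (n - k)) (n - k) f = biMode i i (n - k) k f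
    rw [sub_sub_cancel, biMode_symm]
  -- By the symmetry of `F` the recursions at `k` and `n - (k + 1)` have opposite right-hand sides.
  -- So the anticommutator only changes sign when `k` increases by one, and a single vector `h`
  -- remains to be found.
  have hH : ∀ k, G (k + 1) + G (n - (k + 1)) = -(G k + G (n - k)) := fun k => by
    have h1 := hGF k
    have h2 := hGF (n - (k + 1))
    rw [show n - (k + 1) + 1 = n - k by ring, hFs, hFs] at h2
    rw [← sub_eq_zero]
    calc _ = (G k + G (k + 1)) + (G (n - (k + 1)) + G (n - k)) := by abel
      _ = 0 := by rw [h1, h2]; abel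
  set h := G 0 + G (n - 0) with hh
  have hconst : ∀ k : ℤ, (-1 : ℂ) ^ k • (G k + G (n - k)) = h := by
    intro k
    induction k using Int.induction_on with
    | zero => rw [zpow_zero, one_smul]
    | succ k ih => rw [hneg, hH, neg_smul_neg, ih]
    | pred k ih =>
      rw [← ih, ← sub_add_cancel (-(k : ℤ)) 1, hneg, hH, neg_smul_neg, add_sub_cancel_right]
  obtain ⟨W, hW⟩ := exists_mode_eq_zero i f
  have hGW : ∀ k, W < k → G k = 0 := fun k hk => by
    change mode i (n - k) (mode i k f) = 0
    rw [hW k hk, map_zero]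
  -- For large `k` the product `G k` vanishes; for very negative `k` its mirror image does, so that
  -- `(-1)^k G k` equals `h`. Removing a step function leaves a family of finite support, for which
  -- telescoping is legitimate.
  let u : ℤ → SymAlg ν := fun k => (-1 : ℂ) ^ k • G k - if k ≤ 0 then h else 0
  have hu : Function.HasFiniteSupport u := by
    refine hasFiniteSupport_of_bounds (min 0 (n - W)) (max 0 W) fun k hk => ?_
    rcases hk with hk | hk
    · change (-1 : ℂ) ^ k • G k - (if k ≤ 0 then h else 0) = 0
      rw [if_pos (by omega), ← hconst k, hGW (n - k) (by omega), add_zero, sub_self]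
    · change (-1 : ℂ) ^ k • G k - (if k ≤ 0 then h else 0) = 0
      rw [if_neg (by omega), hGW k (by omega), smul_zero, sub_zero]
  have hF : Function.HasFiniteSupport F := biMode_hasFiniteSupport i i n f
  have hF' : Function.HasFiniteSupport fun k => (-1 : ℂ) ^ k • F k := hF.subset fun k hk h' =>
    hk (by dsimp only; rw [h', smul_zero])
  have hF1 : Function.HasFiniteSupport fun k => (-1 : ℂ) ^ (k + 1) • F (k + 1) :=
    hF'.preimage (add_left_injective 1).injOn
  have hu1 : Function.HasFiniteSupport fun k => u (k + 1) :=
    hu.preimage (add_left_injective 1).injOn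
  have hd : Function.HasFiniteSupport fun k : ℤ => if k = 0 then h else 0 :=
    hasFiniteSupport_of_bounds 0 0 fun k hk => if_neg (by omega)
  have hsum : ∀ k, u k - u (k + 1) + (if k = 0 then h else 0) =
      (-1 : ℂ) ^ k • F k + (-1 : ℂ) ^ (k + 1) • F (k + 1) := by
    intro k
    have h1 : (if k ≤ 0 then h else 0) = (if k + 1 ≤ 0 then h else 0) +
        if k = 0 then h else 0 := by
      split_ifs <;> first | omega | simp
    change ((-1 : ℂ) ^ k • G k - (if k ≤ 0 then h else 0)) -
      ((-1 : ℂ) ^ (k + 1) • G (k + 1) - (if k + 1 ≤ 0 then h else 0)) + _ = _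
    rw [h1, hneg, neg_smul, neg_smul]
    have h2 := congrArg (((-1 : ℂ) ^ k) • ·) (hGF k)
    simp only [smul_add, smul_sub] at h2
    rw [sub_eq_add_neg _ (_ • F (k + 1))] at h2
    rw [← h2]
    abel
  -- The jump of the step function contributes `h`; the normally ordered terms contribute twice the
  -- value at `w = -z`.
  have htot : h = (2 : ℂ) • expCoeff i i 1 n f := by
    have h1 := finsum_congr hsum
    rw [finsum_add_distrib (hu.fun_sub hu1) hd, finsum_sub_distrib hu hu1, finsum_shift,
      sub_self, zero_add, finsum_add_distrib hF' hF1, finsum_shift (fun k => (-1 : ℂ) ^ k • F k),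
      ← two_smul ℂ, finsum_eq_single _ 0 (fun k hk => if_neg hk), if_pos rfl] at h1
    rw [h1, ← finsum_biMode i i one_ne_zero]
    congr 1
    refine finsum_congr fun k => ?_
    rw [zpow_neg, ← inv_zpow]
    norm_num
    rfl
  have hk : G k + G (n - k) = (-1 : ℂ) ^ k • h := by
    rw [← hconst k, smul_smul, ← mul_zpow]
    norm_num
  rw [LinearMap.add_apply, Module.End.mul_apply, Module.End.mul_apply]
  have hk' : G (n - k) = mode i k (mode i (n - k) f) := by
    change mode i (n - (n - k)) _ = _
    rw [sub_sub_cancel]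
  rw [← hk']
  refine hk.trans ?_
  rw [htot, expCoeff_diag_one, sub_add_cancel]
  split_ifs with h0
  · rw [h0, zero_sub, zpow_neg, ← inv_zpow, smul_smul, LinearMap.smul_apply, Module.End.one_apply]
    norm_num [mul_comm]
  · simp

end Laurent

/-! ## Quadratic expressions in twisted fermions -/

section Fermions

/-- Twisted fermions: fields `ψ_i(z) = ∑ ψ_i(n) z^(-n)` with `{ψ_i(m), ψ_j(n)} = 2 (-1)^m` if `i = j`
and `m + n = 0`, and `0` otherwise, where each vector is killed by almost all `ψ_i(n)`, `n > 0`. -/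
structure Fermions (ι V : Type*) [DecidableEq ι] [AddCommGroup V] [Module ℂ V] where
  ψ : ι → ℤ → Module.End ℂ V
  anticomm : ∀ i j m n, ψ i m * ψ j n + ψ j n * ψ i m =
    if i = j ∧ m + n = 0 then (2 * (-1 : ℂ) ^ m) • 1 else 0
  smooth : ∀ i v, ∃ W : ℤ, ∀ m, W < m → ψ i m v = 0

theorem neg_one_zpow_neg (n : ℤ) : (-1 : ℂ) ^ (-n) = (-1) ^ n := by
  rw [zpow_neg, ← inv_zpow]; norm_num

theorem neg_zpow_eq (a : ℂ) (n : ℤ) : (-a) ^ n = (-1) ^ n * a ^ n := by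
  rw [← neg_one_mul, mul_zpow]

theorem neg_one_zpow_mul_self (n : ℤ) : (-1 : ℂ) ^ n * (-1) ^ n = 1 := by
  rw [← mul_zpow]; norm_num

/-- The sum `∑_r x^(-r) (sgn(r + m) - sgn(r))`. -/
def signSum (x : ℂ) (m : ℤ) : ℂ :=
  ∑ᶠ r : ℤ, x ^ (-r) * (((r + m).sign : ℂ) - (r.sign : ℂ))

theorem signSum_hasFiniteSupport (c : ℤ → ℂ) (m k : ℤ) : Function.HasFiniteSupport
    fun r : ℤ => c r * (((r + m).sign : ℂ) - ((r + k).sign : ℂ)) := by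
  refine hasFiniteSupport_of_bounds (-max |m| |k|) (max |m| |k|) fun r hr => ?_
  have h1 := le_max_left |m| |k|
  have h2 := le_max_right |m| |k|
  have h3 := neg_abs_le m
  have h4 := neg_abs_le k
  have h5 := le_abs_self m
  have h6 := le_abs_self k
  rcases hr with hr | hr
  · rw [Int.sign_eq_neg_one_of_neg (show r + m < 0 by omega),
      Int.sign_eq_neg_one_of_neg (show r + k < 0 by omega), sub_self, mul_zero]
  · rw [Int.sign_eq_one_of_pos (show 0 < r + m by omega),
      Int.sign_eq_one_of_pos (show 0 < r + k by omega), sub_self, mul_zero]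

/-- Raising `m` by one changes `sgn(r + m)` only at `r = -m - 1` and `r = -m`, by 1 each time
because the sign of zero is zero. -/
theorem signSum_add_one {x : ℂ} (m : ℤ) :
    signSum x (m + 1) = signSum x m + (x ^ (m + 1) + x ^ m) := by
  have h0 : ∀ m, Function.HasFiniteSupport
      fun r : ℤ => x ^ (-r) * (((r + m).sign : ℂ) - (r.sign : ℂ)) := fun m => by
    simpa only [add_zero] using signSum_hasFiniteSupport (fun r => x ^ (-r)) m 0
  rw [← sub_eq_iff_eq_add', signSum, signSum, ← finsum_sub_distrib (h0 _) (h0 _)]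
  have e : ∀ r : ℤ, x ^ (-r) * (((r + (m + 1)).sign : ℂ) - (r.sign : ℂ)) -
      x ^ (-r) * (((r + m).sign : ℂ) - (r.sign : ℂ)) =
      (if r = -(m + 1) then x ^ (m + 1) else 0) + (if r = -m then x ^ m else 0) := by
    intro r
    rcases lt_trichotomy (r + m) (-1) with h | h | h
    · rw [if_neg (by omega), if_neg (by omega),
        Int.sign_eq_neg_one_of_neg (show r + m < 0 by omega),
        Int.sign_eq_neg_one_of_neg (show r + (m + 1) < 0 by omega)]
      ring
    · rw [if_pos (by omega), if_neg (by omega), Int.sign_eq_neg_one_of_neg (show r + m < 0 by omega),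
        show r + (m + 1) = 0 by omega, show m + 1 = -r by omega]
      simp
      ring
    · rcases eq_or_ne (r + m) 0 with h' | h'
      · rw [if_neg (by omega), if_pos (by omega), h',
          Int.sign_eq_one_of_pos (show 0 < r + (m + 1) by omega), show m = -r by omega]
        simp
        ring
      · rw [if_neg (by omega), if_neg (by omega),
          Int.sign_eq_one_of_pos (show 0 < r + m by omega),
          Int.sign_eq_one_of_pos (show 0 < r + (m + 1) by omega)]
        ring
  rw [finsum_congr e, finsum_add_distrib (hasFiniteSupport_of_bounds (-(m + 1)) (-(m + 1))
    fun k hk => if_neg (by omega)) (hasFiniteSupport_of_bounds (-m) (-m)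
    fun k hk => if_neg (by omega)), finsum_eq_single _ (-(m + 1)) (fun k hk => if_neg hk),
    finsum_eq_single _ (-m) (fun k hk => if_neg hk), if_pos rfl, if_pos rfl]

theorem signSum_eq {x : ℂ} (f : ℤ → ℂ) (h0 : f 0 = 0)
    (hf : ∀ m, f (m + 1) = f m + (x ^ (m + 1) + x ^ m)) (m : ℤ) : signSum x m = f m := by
  induction m using Int.induction_on with
  | zero => rw [h0, signSum]; exact (finsum_congr fun r => by simp).trans finsum_zero
  | succ m ih => rw [hf, signSum_add_one, ih]
  | pred m ih =>
    have h1 := hf (-(m : ℤ) - 1)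
    have h2 := signSum_add_one (x := x) (-(m : ℤ) - 1)
    rw [sub_add_cancel] at h1 h2
    rw [h1, h2] at ih
    exact add_right_cancel ih

theorem signSum_one (m : ℤ) : signSum 1 m = 2 * m :=
  signSum_eq (fun m => 2 * (m : ℂ)) (by simp) (fun m => by
    simp only [one_zpow]; push_cast; ring) m

/-- The factor `1 - x^m` exhibits the anomaly as a coboundary; the constant in front is the
correction that enters `quad'`. -/
theorem signSum_of_ne_one {x : ℂ} (hx : x ≠ 0) (h1 : x ≠ 1) (m : ℤ) :
    signSum x m = (1 + x) / (1 - x) * (1 - x ^ m) := by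
  have h1' : 1 - x ≠ 0 := sub_ne_zero.2 h1.symm
  refine signSum_eq (fun m => (1 + x) / (1 - x) * (1 - x ^ m)) (by simp) (fun m => ?_) m
  rw [zpow_add_one₀ hx]
  field_simp
  ring

variable {ι V : Type*} [DecidableEq ι] [AddCommGroup V] [Module ℂ V] (F : Fermions ι V)

namespace Fermions

/-- The vacuum expectation value of `ψ_i(m) ψ_j(k)`. -/
def vac (i j : ι) (m k : ℤ) : ℂ :=
  if i = j ∧ m + k = 0 then (-1) ^ m * (1 + (m.sign : ℂ)) else 0

/-- The zero modes share their anticommutator equally, since `1 + sgn(0) = 1`. This choice makes the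
normal ordering exactly antisymmetric. -/
theorem vac_add_vac (i j : ι) (m k : ℤ) :
    vac i j m k + vac j i k m = if i = j ∧ m + k = 0 then 2 * (-1 : ℂ) ^ m else 0 := by
  rw [vac, vac]
  by_cases h : i = j ∧ m + k = 0
  · rw [if_pos h, if_pos ⟨h.1.symm, by omega⟩, if_pos h, show k = -m by omega, neg_one_zpow_neg,
      Int.sign_neg]
    push_cast
    ring
  · rw [if_neg h, if_neg (fun h' => h ⟨h'.1.symm, by omega⟩), if_neg h, add_zero]

/-- The normally ordered product of `ψ_i(m)` and `ψ_j(k)`. -/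
def normal (i j : ι) (m k : ℤ) : Module.End ℂ V := F.ψ i m * F.ψ j k - vac i j m k • 1

theorem normal_antisymm (i j : ι) (m k : ℤ) : F.normal i j m k = -F.normal j i k m := by
  have h := F.anticomm i j m k
  have h' := congrArg (fun c : ℂ => c • (1 : Module.End ℂ V)) (vac_add_vac i j m k)
  simp only [add_smul, ite_smul, zero_smul] at h'
  rw [← h', add_comm] at h
  rw [normal, normal, neg_sub, sub_eq_sub_iff_add_eq_add, add_comm, h, add_comm]

/-- If the right-hand mode has large index it kills `v`, and the subtracted scalar vanishes as well,
being supported on non-negative left-hand indices. Antisymmetry covers the other mode. -/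
theorem exists_normal_eq_zero (i j : ι) (v : V) :
    ∃ W : ℤ, ∀ m k, (W < m ∨ W < k) → F.normal i j m k v = 0 := by
  have key : ∀ i j : ι, ∃ W : ℤ, ∀ m k, W < k → F.normal i j m k v = 0 := fun i j => by
    obtain ⟨W, hW⟩ := F.smooth j v
    refine ⟨max W 0, fun m k hk => ?_⟩
    rw [normal, LinearMap.sub_apply, Module.End.mul_apply,
      hW k (lt_of_le_of_lt (le_max_left _ _) hk), map_zero, vac]
    split_ifs with h
    · have : m < 0 := by have := lt_of_le_of_lt (le_max_right W 0) hk; omega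
      rw [Int.sign_eq_neg_one_of_neg this]
      simp
    · simp
  obtain ⟨W, hW⟩ := key i j
  obtain ⟨W', hW'⟩ := key j i
  refine ⟨max W W', fun m k h => ?_⟩
  rcases h with h | h
  · rw [normal_antisymm, LinearMap.neg_apply, hW' _ _ (lt_of_le_of_lt (le_max_right _ _) h),
      neg_zero]
  · exact hW _ _ (lt_of_le_of_lt (le_max_left _ _) h)

theorem normal_hasFiniteSupport (i j : ι) (n : ℤ) (c : ℤ → ℂ) (v : V) :
    Function.HasFiniteSupport fun k => (c k • F.normal i j (n - k) k) v := by
  obtain ⟨W, hW⟩ := F.exists_normal_eq_zero i j v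
  refine hasFiniteSupport_of_bounds (n - W) W fun k hk => ?_
  rw [LinearMap.smul_apply, hW _ _ (by omega), smul_zero]

/-- The coefficient of `z^(-n)` in the normally ordered product of `ψ_i(z)` and `ψ_j(-az)`. -/
def quad (i j : ι) (a : ℂ) (n : ℤ) : Module.End ℂ V :=
  locSum (fun k => (-a) ^ (-k) • F.normal i j (n - k) k) (F.normal_hasFiniteSupport i j n _)

theorem quad_apply (i j : ι) (a : ℂ) (n : ℤ) (v : V) :
    F.quad i j a n v = ∑ᶠ k, ((-a) ^ (-k) • F.normal i j (n - k) k) v := rfl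

/-- The identity `[xy, z] = x{y, z} - {x, z}y` reduces each term to contractions, of which at most
those at `k = -p` and `k = n + p` are non-zero. -/
theorem quad_comm (i j l : ι) {a : ℂ} (ha : a ≠ 0) (n p : ℤ) :
    F.quad i j a n * F.ψ l p - F.ψ l p * F.quad i j a n =
      (if j = l then (2 * a ^ p) • F.ψ i (n + p) else 0) -
      (if i = l then (2 * (-1) ^ n * a ^ (-n - p)) • F.ψ j (n + p) else 0) := by
  have hna : -a ≠ 0 := neg_ne_zero.2 ha
  refine LinearMap.ext fun v => ?_
  have e : ∀ k : ℤ, ((-a) ^ (-k) • F.normal i j (n - k) k) (F.ψ l p v) -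
      F.ψ l p (((-a) ^ (-k) • F.normal i j (n - k) k) v) =
      (if j = l ∧ k = -p then (2 * a ^ p) • F.ψ i (n + p) v else 0) -
      (if i = l ∧ k = n + p then (2 * (-1) ^ n * a ^ (-n - p)) • F.ψ j (n + p) v else 0) := by
    intro k
    have h1 := LinearMap.congr_fun (F.anticomm j l k p) v
    have h2 := LinearMap.congr_fun (F.anticomm i l (n - k) p) (F.ψ j k v)
    simp only [LinearMap.add_apply, Module.End.mul_apply] at h1 h2
    rw [← eq_sub_iff_add_eq] at h1
    rw [← eq_sub_iff_add_eq'] at h2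
    simp only [LinearMap.smul_apply, normal, LinearMap.sub_apply, Module.End.mul_apply,
      Module.End.one_apply, map_smul, map_sub]
    rw [h1, h2, map_sub]
    have e1 : (-a) ^ (-k) • F.ψ i (n - k) ((if j = l ∧ k + p = 0 then
        (2 * (-1 : ℂ) ^ k) • (1 : Module.End ℂ V) else 0) v) =
        if j = l ∧ k = -p then (2 * a ^ p) • F.ψ i (n + p) v else 0 := by
      by_cases h : j = l ∧ k = -p
      · rw [if_pos ⟨h.1, by omega⟩, if_pos h, h.2, LinearMap.smul_apply, Module.End.one_apply,
          map_smul, smul_smul, sub_neg_eq_add, neg_neg, neg_one_zpow_neg, neg_zpow_eq]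
        congr 1
        rw [show (-1 : ℂ) ^ p * a ^ p * (2 * (-1) ^ p) = 2 * a ^ p * ((-1) ^ p * (-1) ^ p) by ring,
          neg_one_zpow_mul_self, mul_one]
      · rw [if_neg h, if_neg (fun h' => h ⟨h'.1, by omega⟩), LinearMap.zero_apply, map_zero,
          smul_zero]
    have e2 : (-a) ^ (-k) • ((if i = l ∧ n - k + p = 0 then
        (2 * (-1 : ℂ) ^ (n - k)) • (1 : Module.End ℂ V) else 0) (F.ψ j k v)) =
        if i = l ∧ k = n + p then (2 * (-1) ^ n * a ^ (-n - p)) • F.ψ j (n + p) v else 0 := by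
      by_cases h : i = l ∧ k = n + p
      · rw [if_pos ⟨h.1, by omega⟩, if_pos h, h.2, LinearMap.smul_apply, Module.End.one_apply,
          smul_smul, neg_zpow_eq, neg_one_zpow_neg, show n - (n + p) = -p by ring,
          neg_one_zpow_neg, zpow_add₀ (by norm_num), neg_add, ← sub_eq_add_neg (-n)]
        congr 1
        rw [show (-1 : ℂ) ^ n * (-1) ^ p * a ^ (-n - p) * (2 * (-1) ^ p) =
          2 * (-1) ^ n * a ^ (-n - p) * ((-1) ^ p * (-1) ^ p) by ring,
          neg_one_zpow_mul_self, mul_one]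
      · rw [if_neg h, if_neg (fun h' => h ⟨h'.1, by omega⟩), LinearMap.zero_apply, smul_zero]
    rw [← e1, ← e2]
    module
  have hs1 : Function.HasFiniteSupport fun k : ℤ =>
      if j = l ∧ k = -p then (2 * a ^ p) • F.ψ i (n + p) v else 0 :=
    hasFiniteSupport_of_bounds (-p) (-p) fun k hk => if_neg (by omega)
  have hs2 : Function.HasFiniteSupport fun k : ℤ =>
      if i = l ∧ k = n + p then (2 * (-1) ^ n * a ^ (-n - p)) • F.ψ j (n + p) v else 0 :=
    hasFiniteSupport_of_bounds (n + p) (n + p) fun k hk => if_neg (by omega)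
  have hs3 : Function.HasFiniteSupport fun k =>
      F.ψ l p (((-a) ^ (-k) • F.normal i j (n - k) k) v) :=
    (F.normal_hasFiniteSupport i j n (fun k => (-a) ^ (-k)) v).subset fun k hk h' => hk (by
      dsimp only at h' ⊢; rw [h', map_zero])
  rw [LinearMap.sub_apply, LinearMap.sub_apply, Module.End.mul_apply, Module.End.mul_apply,
    quad_apply, quad_apply, map_finsum _ (F.normal_hasFiniteSupport i j n _ v),
    ← finsum_sub_distrib (F.normal_hasFiniteSupport i j n _ _) hs3, finsum_congr e,
    finsum_sub_distrib hs1 hs2, finsum_eq_single _ (-p) (fun k hk => if_neg fun h => hk h.2),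
    finsum_eq_single _ (n + p) (fun k hk => if_neg fun h => hk h.2)]
  congr 1
  · by_cases h : j = l
    · rw [if_pos ⟨h, rfl⟩, if_pos h]; rfl
    · rw [if_neg (fun h' => h h'.1), if_neg h]; rfl
  · by_cases h : i = l
    · rw [if_pos ⟨h, rfl⟩, if_pos h]; rfl
    · rw [if_neg (fun h' => h h'.1), if_neg h]; rfl

/-- The terms of `[E_ij t^m e^α, ψ_k(n - r) ψ_l(r)]` which involve `E_ij` on the first factor and
the adjoint of `E_ij t^m e^α` on the second. -/
def pairTerm (i j : ι) (a : ℂ) (m : ℤ) (k l : ι) (n r : ℤ) : Module.End ℂ V :=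
  (if j = k then a ^ (n - r) • (F.ψ i (m + n - r) * F.ψ l r) else 0) -
    (if i = l then ((-1) ^ m * a ^ (-m - r)) • (F.ψ k (n - r) * F.ψ j (m + r)) else 0)

/-- The Leibniz rule gives four terms. Two of them belong to `E_ij t^m e^α`, the other two to its
image under `X ↦ -X*`, which has `i, j` interchanged, parameter `a⁻¹` and the scalar `-(-1)^m
a^(-m)`. -/
theorem half_quad_comm_mul (i j k l : ι) {a : ℂ} (ha : a ≠ 0) (m n r : ℤ) :
    ((2 : ℂ)⁻¹ • F.quad i j a m) * (F.ψ k (n - r) * F.ψ l r) -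
      (F.ψ k (n - r) * F.ψ l r) * ((2 : ℂ)⁻¹ • F.quad i j a m) =
    F.pairTerm i j a m k l n r - ((-1) ^ m * a ^ (-m)) • F.pairTerm j i a⁻¹ m k l n r := by
  have h1 := F.quad_comm i j k ha m (n - r)
  have h2 := F.quad_comm i j l ha m r
  set T := F.quad i j a m
  have e : ((2 : ℂ)⁻¹ • T) * (F.ψ k (n - r) * F.ψ l r) -
      (F.ψ k (n - r) * F.ψ l r) * ((2 : ℂ)⁻¹ • T) =
      (2 : ℂ)⁻¹ • ((T * F.ψ k (n - r) - F.ψ k (n - r) * T) * F.ψ l r +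
        F.ψ k (n - r) * (T * F.ψ l r - F.ψ l r * T)) := by
    rw [smul_mul_assoc, mul_smul_comm, ← smul_sub]
    congr 1
    noncomm_ring
  have hs : (-1 : ℂ) ^ m * a ^ (-m) * ((-1) ^ m * a⁻¹ ^ (-m - r)) = a ^ r := by
    rw [show (-1 : ℂ) ^ m * a ^ (-m) * ((-1) ^ m * a⁻¹ ^ (-m - r)) =
      ((-1) ^ m * (-1) ^ m) * (a ^ (-m) * a⁻¹ ^ (-m - r)) by ring, neg_one_zpow_mul_self, one_mul,
      inv_zpow', ← zpow_add₀ ha]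
    congr 1; ring
  have hs' : (-1 : ℂ) ^ m * a ^ (-m) * a⁻¹ ^ (n - r) = (-1) ^ m * a ^ (-m - (n - r)) := by
    rw [inv_zpow', mul_assoc, ← zpow_add₀ ha]
    congr 2
  rw [e, h1, h2, pairTerm, pairTerm, smul_sub, smul_ite, smul_ite, smul_smul, smul_smul, hs, hs',
    smul_zero, add_sub_assoc]
  have h3 : ∀ c : ℂ, (2 : ℂ)⁻¹ * (2 * c) = c := fun c => by ring
  have h4 : ∀ c d : ℂ, (2 : ℂ)⁻¹ * (2 * c * d) = c * d := fun c d => by ring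
  simp only [sub_mul, mul_sub, ite_mul, mul_ite, zero_mul, mul_zero, smul_mul_assoc, mul_smul_comm,
    smul_add, smul_sub, smul_ite, smul_zero, smul_smul, h3, h4]
  abel

/-- Products of fermions cannot be summed over `r`, but normally ordered ones can. The price is a
difference of two vacuum expectation values, which is non-zero for finitely many `r` only. -/
theorem pairTerm_eq (i j : ι) (a : ℂ) (m : ℤ) (k l : ι) (n r : ℤ) :
    F.pairTerm i j a m k l n r =
      ((if j = k then a ^ (n - r) • F.normal i l (m + n - r) r else 0) -
      (if i = l then ((-1) ^ m * a ^ (-m - r)) • F.normal k j (n - r) (m + r) else 0)) +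
      (if j = k ∧ i = l ∧ m + n = 0 then
        (a ^ (-m - r) * (-1) ^ r * (((r + m).sign : ℂ) - (r.sign : ℂ))) • 1 else 0) := by
  have hv1 : vac i l (m + n - r) r = if i = l ∧ m + n = 0 then (-1) ^ r * (1 - (r.sign : ℂ))
      else 0 := by
    rw [vac]
    by_cases h : i = l ∧ m + n = 0
    · rw [if_pos ⟨h.1, by omega⟩, if_pos h, h.2, zero_sub, neg_one_zpow_neg, Int.sign_neg]
      push_cast; ring
    · rw [if_neg h, if_neg (fun h' => h ⟨h'.1, by omega⟩)]
  have hv2 : vac k j (n - r) (m + r) = if j = k ∧ m + n = 0 then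
      (-1) ^ m * ((-1) ^ r * (1 - ((r + m).sign : ℂ))) else 0 := by
    rw [vac]
    by_cases h : j = k ∧ m + n = 0
    · rw [if_pos ⟨h.1.symm, by omega⟩, if_pos h, show n - r = -(r + m) by omega, neg_one_zpow_neg,
        Int.sign_neg, zpow_add₀ (by norm_num)]
      push_cast; ring
    · rw [if_neg h, if_neg (fun h' => h ⟨h'.1.symm, by omega⟩)]
  rw [pairTerm, normal, normal, hv1, hv2]
  by_cases h1 : j = k <;> by_cases h2 : i = l <;> by_cases h3 : m + n = 0
  · simp only [h1, h2, h3, true_and, if_pos]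
    rw [show n = -m by omega]
    have : (-1 : ℂ) ^ m * a ^ (-m - r) * ((-1) ^ m * ((-1) ^ r * (1 - ((r + m).sign : ℂ)))) =
      (-1 : ℂ) ^ m * (-1) ^ m * (a ^ (-m - r) * (-1) ^ r * (1 - ((r + m).sign : ℂ))) := by ring
    rw [smul_sub, smul_sub, smul_smul, smul_smul, this, neg_one_zpow_mul_self]
    module
  all_goals simp [h1, h2, h3]

/-- After the shift `r ↦ r + m` in the second family both weights become powers of `-ab`, so each
family sums to a quadratic expression with parameter `ab`; the vacuum terms sum to `signSum`. -/
theorem finsum_pairTerm (i j : ι) {a : ℂ} (ha : a ≠ 0) (m : ℤ) (k l : ι) {b : ℂ} (hb : b ≠ 0)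
    (n : ℤ) (v : V) :
    (Function.HasFiniteSupport fun r => ((-b) ^ (-r) • F.pairTerm i j a m k l n r) v) ∧
    ∑ᶠ r, ((-b) ^ (-r) • F.pairTerm i j a m k l n r) v =
      (if j = k then a ^ n • F.quad i l (a * b) (m + n) v else 0) -
      (if i = l then b ^ m • F.quad k j (a * b) (m + n) v else 0) +
      (if j = k ∧ i = l ∧ m + n = 0 then (a ^ (-m) * signSum (a * b) m) • v else 0) := by
  have hnb : -b ≠ 0 := neg_ne_zero.2 hb
  have h1 : (-1 : ℂ) ≠ 0 := by norm_num
  let f : ℤ → V := fun r => ((-(a * b)) ^ (-r) • F.normal i l (m + n - r) r) v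
  let g : ℤ → V := fun r => ((-(a * b)) ^ (-r) • F.normal k j (m + n - r) r) v
  let c : ℤ → ℂ := fun r => (a * b) ^ (-r) * (((r + m).sign : ℂ) - (r.sign : ℂ))
  have hf : Function.HasFiniteSupport f := F.normal_hasFiniteSupport i l (m + n) _ v
  have hg : Function.HasFiniteSupport g := F.normal_hasFiniteSupport k j (m + n) _ v
  have hg1 : Function.HasFiniteSupport fun r => g (r + m) :=
    hg.preimage (add_left_injective m).injOn
  have hc : Function.HasFiniteSupport c := by
    simpa only [add_zero] using signSum_hasFiniteSupport (fun r => (a * b) ^ (-r)) m 0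
  have e : ∀ r, ((-b) ^ (-r) • F.pairTerm i j a m k l n r) v =
      ((if j = k then a ^ n • f r else 0) - (if i = l then b ^ m • g (r + m) else 0)) +
      (if j = k ∧ i = l ∧ m + n = 0 then (a ^ (-m) * c r) • v else 0) := by
    intro r
    have e1 : (-b) ^ (-r) * a ^ (n - r) = a ^ n * (-(a * b)) ^ (-r) := by
      rw [sub_eq_add_neg, zpow_add₀ ha, ← mul_neg, mul_zpow]; ring
    have e2 : (-b) ^ (-r) * ((-1) ^ m * a ^ (-m - r)) = b ^ m * (-(a * b)) ^ (-(r + m)) := by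
      rw [neg_zpow_eq (a * b), neg_zpow_eq b, neg_add, zpow_add₀ h1, mul_zpow,
        sub_eq_add_neg, add_comm (-m), zpow_add₀ hb, neg_one_zpow_neg m,
        show b ^ m * ((-1) ^ (-r) * (-1) ^ m * (a ^ (-r + -m) * (b ^ (-r) * b ^ (-m)))) =
        (b ^ m * b ^ (-m)) * ((-1) ^ (-r) * (-1) ^ m * (a ^ (-r + -m) * b ^ (-r))) by ring,
        ← zpow_add₀ hb, add_neg_cancel, zpow_zero]
      ring
    have e3 : (-b) ^ (-r) * (a ^ (-m - r) * (-1) ^ r * (((r + m).sign : ℂ) - (r.sign : ℂ))) =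
        a ^ (-m) * c r := by
      change _ = a ^ (-m) * ((a * b) ^ (-r) * _)
      rw [neg_zpow_eq b, neg_one_zpow_neg, sub_eq_add_neg, zpow_add₀ ha, mul_zpow,
        show (-1) ^ r * b ^ (-r) * (a ^ (-m) * a ^ (-r) * (-1) ^ r *
          (((r + m).sign : ℂ) - (r.sign : ℂ))) = ((-1) ^ r * (-1) ^ r) * (b ^ (-r) *
            (a ^ (-m) * a ^ (-r)) * (((r + m).sign : ℂ) - (r.sign : ℂ))) by ring,
        neg_one_zpow_mul_self]
      ring
    rw [F.pairTerm_eq i j a, smul_add, smul_sub, smul_ite, smul_ite, smul_ite, smul_smul,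
      smul_smul, smul_smul, e1, e2, e3, smul_zero, LinearMap.add_apply, LinearMap.sub_apply]
    congr 1
    · congr 1
      · split_ifs
        · rw [LinearMap.smul_apply, mul_smul]; rfl
        · rfl
      · split_ifs
        · change _ = b ^ m • ((-(a * b)) ^ (-(r + m)) • F.normal k j (m + n - (r + m)) (r + m)) v
          rw [LinearMap.smul_apply, mul_smul, show m + n - (r + m) = n - r by ring, add_comm r m]
          rfl
        · rfl
    · split_ifs <;> rfl
  have hs1 : Function.HasFiniteSupport fun r => if j = k then a ^ n • f r else 0 :=
    hf.subset fun r hr h' => hr (by dsimp only; rw [h', smul_zero, ite_self])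
  have hs2 : Function.HasFiniteSupport fun r => if i = l then b ^ m • g (r + m) else 0 :=
    hg1.subset fun r hr h' => hr (by dsimp only at h' ⊢; rw [h', smul_zero, ite_self])
  have hs3 : Function.HasFiniteSupport fun r =>
      if j = k ∧ i = l ∧ m + n = 0 then (a ^ (-m) * c r) • v else 0 :=
    hc.subset fun r hr h' => hr (by dsimp only; rw [h', mul_zero, zero_smul, ite_self])
  refine ⟨?_, ?_⟩
  · simp only [e]
    exact (hs1.fun_sub hs2).fun_add hs3
  · rw [finsum_congr e, finsum_add_distrib (hs1.fun_sub hs2) hs3, finsum_sub_distrib hs1 hs2]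
    congr 1
    · congr 1
      · split_ifs
        · rw [quad_apply, smul_finsum]
        · exact finsum_zero
      · split_ifs
        · rw [quad_apply, smul_finsum]
          exact finsum_shift (fun r => b ^ m • g r) m
        · exact finsum_zero
    · split_ifs
      · rw [signSum, ← finsum_smul, ← mul_finsum]
      · exact finsum_zero

/-- The coefficient `quad`, corrected by the constant term of `ψ_i(z) ψ_i(-az)`. -/
def quad' (i j : ι) (a : ℂ) (n : ℤ) : Module.End ℂ V :=
  F.quad i j a n + (open Classical in
    if i = j ∧ a ≠ 1 ∧ n = 0 then (1 + a) / (1 - a) else 0 : ℂ) • 1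

open Classical in
/-- The part of the commutator of two quadratic expressions that comes from the product
`[E_ij t^m e^α, E_kl t^n e^β]` in `gl`. -/
def quadBracket (i j : ι) (a : ℂ) (m : ℤ) (k l : ι) (b : ℂ) (n : ℤ) : Module.End ℂ V :=
  (if j = k then a ^ n • F.quad' i l (a * b) (m + n) else 0) -
    (if i = l then b ^ m • F.quad' k j (a * b) (m + n) else 0) +
    (if i = l ∧ j = k ∧ m + n = 0 ∧ a * b = 1 then (2 * (m * a ^ n)) • 1 else 0)

/-- The anomaly is the central term when `ab = 1`; when `ab ≠ 1` it is the difference of the two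
constants contained in `quad'`. -/
theorem finsum_pairTerm' (i j : ι) {a : ℂ} (ha : a ≠ 0) (m : ℤ) (k l : ι) {b : ℂ} (hb : b ≠ 0)
    (n : ℤ) (v : V) : ∑ᶠ r, ((-b) ^ (-r) • F.pairTerm i j a m k l n r) v =
      F.quadBracket i j a m k l b n v := by
  rw [(F.finsum_pairTerm i j ha m k l hb n v).2, quadBracket, quad', quad']
  by_cases h1 : j = k <;> by_cases h2 : i = l <;> by_cases h3 : m + n = 0 <;>
    by_cases h4 : a * b = 1
  · simp only [h1, h2, h3, h4, true_and, if_true, ne_eq, not_true, false_and, if_false, zero_smul,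
      add_zero, LinearMap.add_apply, LinearMap.sub_apply, LinearMap.smul_apply,
      Module.End.one_apply, signSum_one, true_and]
    rw [show n = -m by omega]
    congr 2
    ring
  · simp only [h1, h2, h3, h4, if_true, ne_eq, not_false_eq_true, and_self, if_false,
      and_false, add_zero, LinearMap.add_apply, LinearMap.sub_apply, LinearMap.smul_apply,
      Module.End.one_apply, smul_add, signSum_of_ne_one (mul_ne_zero ha hb) h4]
    have e : a ^ (-m) * ((1 + a * b) / (1 - a * b) * (1 - (a * b) ^ m)) =
        a ^ n * ((1 + a * b) / (1 - a * b)) - b ^ m * ((1 + a * b) / (1 - a * b)) := by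
      rw [show n = -m by omega, mul_zpow]
      have : a ^ (-m) * a ^ m = 1 := by rw [← zpow_add₀ ha]; simp
      linear_combination (-(1 + a * b) / (1 - a * b) * b ^ m) * this
    rw [e]
    module
  all_goals simp [h1, h2, h3, h4]
  all_goals first | done | (have : ¬ (k = j) := fun h => h1 h.symm; simp [this])

/-- The commutator of two quadratic expressions in the fermions. -/
theorem quad'_comm (i j : ι) {a : ℂ} (ha : a ≠ 0) (m : ℤ) (k l : ι) {b : ℂ} (hb : b ≠ 0) (n : ℤ) :
    F.quad' i j a m * F.quad' k l b n - F.quad' k l b n * F.quad' i j a m =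
      (2 : ℂ) • (F.quadBracket i j a m k l b n -
        ((-1) ^ m * a ^ (-m)) • F.quadBracket j i a⁻¹ m k l b n) := by
  have ha' : a⁻¹ ≠ 0 := inv_ne_zero ha
  set T := (2 : ℂ)⁻¹ • F.quad i j a m with hT
  have key : T * F.quad k l b n - F.quad k l b n * T = F.quadBracket i j a m k l b n -
        ((-1) ^ m * a ^ (-m)) • F.quadBracket j i a⁻¹ m k l b n := by
    refine LinearMap.ext fun v => ?_
    -- Normal ordering subtracts scalars, which do not affect the commutator, so
    -- `half_quad_comm_mul` applies term by term.
    have e : ∀ r : ℤ, T (((-b) ^ (-r) • F.normal k l (n - r) r) v) -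
        ((-b) ^ (-r) • F.normal k l (n - r) r) (T v) =
        ((-b) ^ (-r) • F.pairTerm i j a m k l n r) v - ((-1) ^ m * a ^ (-m)) •
          ((-b) ^ (-r) • F.pairTerm j i a⁻¹ m k l n r) v := by
      intro r
      have h := LinearMap.congr_fun (F.half_quad_comm_mul i j k l ha m n r) v
      rw [← hT] at h
      simp only [LinearMap.sub_apply, Module.End.mul_apply, LinearMap.smul_apply, normal, map_smul,
        map_sub, Module.End.one_apply] at h ⊢
      rw [smul_comm _ ((-b) ^ (-r)) (F.pairTerm j i a⁻¹ m k l n r v), ← smul_sub, ← smul_sub, ← h]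
      congr 1
      abel
    have hs : Function.HasFiniteSupport fun r => T (((-b) ^ (-r) • F.normal k l (n - r) r) v) :=
      (F.normal_hasFiniteSupport k l n (fun r => (-b) ^ (-r)) v).subset fun r hr h' => hr (by
        dsimp only at h' ⊢; rw [h', map_zero])
    have hp := F.finsum_pairTerm i j ha m k l hb n v
    have hp' := F.finsum_pairTerm j i ha' m k l hb n v
    have hs' : Function.HasFiniteSupport fun r => ((-1) ^ m * a ^ (-m)) •
        ((-b) ^ (-r) • F.pairTerm j i a⁻¹ m k l n r) v :=
      hp'.1.subset fun r hr h' => hr (by dsimp only at h' ⊢; rw [h', smul_zero])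
    rw [LinearMap.sub_apply, LinearMap.sub_apply, Module.End.mul_apply, Module.End.mul_apply,
      quad_apply, quad_apply, map_finsum _ (F.normal_hasFiniteSupport k l n _ v),
      ← finsum_sub_distrib hs (F.normal_hasFiniteSupport k l n _ _), finsum_congr e,
      finsum_sub_distrib hp.1 hs', F.finsum_pairTerm' i j ha m k l hb, ← smul_finsum,
      F.finsum_pairTerm' j i ha' m k l hb]
    rfl
  rw [← key, hT, quad', quad']
  simp only [add_mul, mul_add, smul_mul_assoc, mul_smul_comm, one_mul, mul_one, smul_sub, smul_smul]
  rw [mul_inv_cancel₀ two_ne_zero, one_smul, one_smul]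
  module

/-- Antisymmetry of the normal ordering together with `k ↦ n - k` handles the quadratic part, and
`(1 + a)/(1 - a)` changes sign under `a ↦ a⁻¹`. Hence `quad'` respects the relation between `e_ij(m,
α)` and `e_ji(m, -α)`. -/
theorem quad'_symm (i j : ι) {a : ℂ} (ha : a ≠ 0) (n : ℤ) :
    (-a) ^ (-n) • F.quad' j i a⁻¹ n = -F.quad' i j a n := by
  have hna : -a ≠ 0 := neg_ne_zero.2 ha
  have e : (-a) ^ (-n) • F.quad j i a⁻¹ n = -F.quad i j a n := by
    refine LinearMap.ext fun v => ?_
    rw [LinearMap.smul_apply, LinearMap.neg_apply, quad_apply, quad_apply, smul_finsum,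
      ← finsum_neg_distrib, ← finsum_reflect _ n]
    refine finsum_congr fun k => ?_
    rw [sub_sub_cancel, F.normal_antisymm j i]
    simp only [LinearMap.smul_apply, LinearMap.neg_apply, smul_neg, smul_smul]
    congr 2
    rw [← inv_neg, inv_zpow', ← zpow_add₀ hna]
    congr 1
    ring
  rw [quad', quad', smul_add, e, neg_add, smul_smul]
  congr 1
  by_cases h : i = j ∧ a ≠ 1 ∧ n = 0
  · rw [if_pos h, if_pos ⟨h.1.symm, by simpa using h.2.1, h.2.2⟩, h.2.2, neg_zero, zpow_zero,
      one_mul, ← neg_smul]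
    congr 1
    have h1 : 1 - a ≠ 0 := sub_ne_zero.2 h.2.1.symm
    have h2 : 1 - a⁻¹ ≠ 0 := sub_ne_zero.2 (by simpa [eq_comm] using h.2.1)
    have h3 : a - 1 ≠ 0 := sub_ne_zero.2 h.2.1
    field_simp
    ring
  · rw [if_neg h, if_neg (fun h' => h ⟨h'.1.symm, by simpa using h'.2.1, h'.2.2⟩)]
    simp

end Fermions

end Fermions

/-! ## The fermions on the Fock space and the vertex operators -/

section FockFermions

variable {ν : ℕ}

theorem epsilon_basisVec (i j : Fin ν) :
    (epsilon ν).toFun (reduct (basisVec i)) (reduct (basisVec j)) = if j < i then -1 else 1 := by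
  have h : ∀ i x : Fin ν, (reduct (basisVec i) x).val = if x = i then 1 else 0 := fun i x => by
    rw [reduct, basisVec, Pi.single_apply]
    split_ifs
    · simp; rfl
    · simp
  change ∏ x, ∏ y, (if y < x then (-1 : ℂ) ^ ((reduct (basisVec i) x).val *
    (reduct (basisVec j) y).val) else 1) = _
  rw [Finset.prod_eq_single i, Finset.prod_eq_single j]
  · rw [h, h, if_pos rfl, if_pos rfl, mul_one, pow_one]
  · intro y _ hy
    rw [h j y, if_neg hy, mul_zero, pow_zero, ite_self]
  · simp
  · intro x _ hx
    refine Finset.prod_eq_one fun y _ => ?_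
    rw [h i x, if_neg hx, zero_mul, pow_zero, ite_self]
  · simp

theorem reduct_sub (α β : Fin ν → ℤ) : reduct (α - β) = reduct α + reduct β := by
  ext i
  simp [reduct, sub_eq_add_neg, ZMod.neg_eq_self_mod_two]

theorem expBar_mul_expBar (α β : Fin ν → ℤ) : expBar α * expBar β =
    (epsilon ν).toFun (reduct α) (reduct β) • expBar (α - β) := by
  rw [expBar, expBar, expBar, TwistedGroupAlgebra.exp, TwistedGroupAlgebra.exp,
    TwistedGroupAlgebra.exp, TwistedGroupAlgebra.term_mul_term, TwistedGroupAlgebra.smul_term,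
    reduct_sub, mul_one]

/-- The generator `e^(ε_i)` of the twisted group algebra. -/
def gen (i : Fin ν) : GroupAlg ν := expBar (basisVec i)

theorem gen_mul_gen (i j : Fin ν) : gen i * gen j =
    (epsilon ν).toFun (reduct (basisVec i)) (reduct (basisVec j)) •
      expBar (basisVec i - basisVec j) := expBar_mul_expBar _ _

theorem gen_mul_self (i : Fin ν) : gen i * gen i = 1 := by
  rw [gen_mul_gen, epsilon_basisVec, if_neg (lt_irrefl i), one_smul, sub_self]
  rfl

/-- The values of `ε` at the two orders of `ε_i, ε_j` differ by a sign, while `ε_i - ε_j` and `ε_j -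
ε_i` agree modulo 2. With `gen_mul_self` this is a Clifford algebra. -/
theorem gen_anticomm {i j : Fin ν} (hij : i ≠ j) : gen i * gen j = -(gen j * gen i) := by
  have h : expBar (basisVec i - basisVec j) = expBar (basisVec j - basisVec i) := by
    rw [expBar, expBar, reduct_sub, reduct_sub, add_comm]
  rw [gen_mul_gen, gen_mul_gen, h, epsilon_basisVec, epsilon_basisVec]
  rcases lt_or_gt_of_ne hij with h' | h'
  · rw [if_neg h'.asymm, if_pos h', neg_smul, neg_neg]
  · rw [if_pos h', if_neg h'.asymm, neg_smul]

theorem mulLeft_gen_mul (i j : Fin ν) : LinearMap.mulLeft ℂ (gen i) * LinearMap.mulLeft ℂ (gen j) =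
    LinearMap.mulLeft ℂ (gen i * gen j) := (LinearMap.mulLeft_mul ℂ _ (gen i) (gen j)).symm

/-- The fermions `ψ_i(z) = e^(ε_i) E_-(ε_i, z) E_+(ε_i, z)` on the Fock space. -/
def fockFermions (ν : ℕ) : Fermions (Fin ν) (Fock ν) where
  ψ i n := TensorProduct.map (LinearMap.mulLeft ℂ (gen i)) (mode i n)
  anticomm i j m n := by
    rw [← TensorProduct.map_mul, ← TensorProduct.map_mul, mulLeft_gen_mul, mulLeft_gen_mul]
    by_cases hij : i = j
    · subst hij
      rw [gen_mul_self, LinearMap.mulLeft_one, ← TensorProduct.map_add_right, mode_anticomm]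
      by_cases h : m + n = 0
      · rw [if_pos h, if_pos ⟨rfl, h⟩, TensorProduct.map_smul_right]
        congr 1
        exact TensorProduct.map_id
      · rw [if_neg h, if_neg (fun h' => h h'.2), TensorProduct.map_zero_right]
    · rw [if_neg (fun h => hij h.1), gen_anticomm hij, (mode_commute_of_ne hij m n).eq,
        ← TensorProduct.map_add_left]
      have : LinearMap.mulLeft ℂ (-(gen j * gen i)) + LinearMap.mulLeft ℂ (gen j * gen i) = 0 := by
        ext1 x
        simp [mul_assoc]
      rw [this, TensorProduct.map_zero_left]
  smooth i v := by
    induction v using TensorProduct.induction_on with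
    | zero => exact ⟨0, fun m _ => map_zero _⟩
    | tmul u f =>
      obtain ⟨W, hW⟩ := exists_mode_eq_zero i f
      exact ⟨W, fun m hm => by rw [TensorProduct.map_tmul, hW m hm, TensorProduct.tmul_zero]⟩
    | add v w hv hw =>
      obtain ⟨W, hW⟩ := hv
      obtain ⟨W', hW'⟩ := hw
      refine ⟨max W W', fun m hm => ?_⟩
      rw [map_add, hW m (lt_of_le_of_lt (le_max_left _ _) hm),
        hW' m (lt_of_le_of_lt (le_max_right _ _) hm), add_zero]

theorem fockFermions_ψ (i : Fin ν) (n : ℤ) : (fockFermions ν).ψ i n =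
    TensorProduct.map (LinearMap.mulLeft ℂ (gen i)) (mode i n) := rfl

theorem tmul_finsum (u : GroupAlg ν) {f : ℤ → SymAlg ν} (hf : Function.HasFiniteSupport f) :
    u ⊗ₜ[ℂ] (∑ᶠ k, f k) = ∑ᶠ k, u ⊗ₜ[ℂ] f k :=
  map_finsum (TensorProduct.mk ℂ (GroupAlg ν) (SymAlg ν) u) hf

theorem tmul_hasFiniteSupport (u : GroupAlg ν) {f : ℤ → SymAlg ν}
    (hf : Function.HasFiniteSupport f) : Function.HasFiniteSupport fun k => u ⊗ₜ[ℂ] f k :=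
  hf.subset fun k hk h => hk (by dsimp only; rw [h, TensorProduct.tmul_zero])

theorem smul_hasFiniteSupport {V : Type*} [AddCommGroup V] [Module ℂ V] (c : ℤ → ℂ) {f : ℤ → V}
    (hf : Function.HasFiniteSupport f) : Function.HasFiniteSupport fun k => c k • f k :=
  hf.subset fun k hk h => hk (by dsimp only; rw [h, smul_zero])

theorem vertexCoeff_eq_quad_of_ne {i j : Fin ν} (hij : i ≠ j) {a : ℂ} (ha : a ≠ 0) (n : ℤ) :
    vertexCoeff i j a n = (fockFermions ν).quad i j a n := by
  rw [vertexCoeff, if_pos hij, ← TensorProduct.map_smul_left]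
  refine TensorProduct.ext' fun u f => ?_
  have e : ∀ k, ((-a) ^ (-k) • (fockFermions ν).normal i j (n - k) k) (u ⊗ₜ f) =
      (gen i * gen j * u) ⊗ₜ[ℂ] ((-a) ^ (-k) • biMode i j (n - k) k f) := fun k => by
    rw [Fermions.normal, Fermions.vac, if_neg (fun h => hij h.1), zero_smul, sub_zero,
      fockFermions_ψ, fockFermions_ψ, ← TensorProduct.map_mul, mulLeft_gen_mul,
      mode_mul_mode_of_ne hij, LinearMap.smul_apply, TensorProduct.map_tmul,
      LinearMap.mulLeft_apply, TensorProduct.tmul_smul]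
  rw [Fermions.quad_apply, finsum_congr e, ← tmul_finsum _ (smul_hasFiniteSupport _
    (biMode_hasFiniteSupport i j n f)), finsum_biMode i j ha, TensorProduct.map_tmul, gen_mul_gen,
    LinearMap.smul_apply, LinearMap.mulLeft_apply, smul_mul_assoc]

/-- The recursion satisfied by the normally ordered products of fermions of the same index. -/
theorem normal_add_normal (i : Fin ν) (n k : ℤ) (u : GroupAlg ν) (f : SymAlg ν) :
    (fockFermions ν).normal i i (n - k) k (u ⊗ₜ f) +
      (fockFermions ν).normal i i (n - (k + 1)) (k + 1) (u ⊗ₜ f) =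
    (u ⊗ₜ[ℂ] biMode i i (n - k) k f - if n = 0 ∧ k = 0 then u ⊗ₜ[ℂ] f else 0) -
      (u ⊗ₜ[ℂ] biMode i i (n - (k + 1)) (k + 1) f -
        if n = 0 ∧ k + 1 = 0 then u ⊗ₜ[ℂ] f else 0) := by
  have h := congrArg (fun g => u ⊗ₜ[ℂ] g) (LinearMap.congr_fun (mode_mul_mode_add i (n - k) k) f)
  simp only [LinearMap.add_apply, LinearMap.sub_apply, TensorProduct.tmul_add,
    TensorProduct.tmul_sub, sub_sub] at h
  have hv : (Fermions.vac i i (n - k) k : ℂ) + Fermions.vac i i (n - (k + 1)) (k + 1) =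
      (if n = 0 ∧ k = 0 then 1 else 0) - (if n = 0 ∧ k + 1 = 0 then 1 else 0) := by
    rw [Fermions.vac, Fermions.vac, sub_add_cancel, sub_add_cancel]
    by_cases hn : n = 0
    · subst hn
      simp only [true_and, if_true, zero_sub, Int.sign_neg]
      rw [neg_one_zpow_neg, neg_one_zpow_neg, zpow_add_one₀ (by norm_num)]
      rcases lt_trichotomy k (-1) with hk | hk | hk
      · rw [if_neg (by omega), if_neg (by omega), Int.sign_eq_neg_one_of_neg (by omega),
          Int.sign_eq_neg_one_of_neg (by omega)]
        push_cast; ring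
      · subst hk; norm_num
      · rcases eq_or_ne k 0 with rfl | hk0
        · norm_num
        · rw [if_neg (by omega), if_neg (by omega), Int.sign_eq_one_of_pos (by omega),
            Int.sign_eq_one_of_pos (by omega)]
          push_cast; ring
    · simp [hn]
  have hψ : ∀ m k, (fockFermions ν).normal i i m k (u ⊗ₜ f) =
      u ⊗ₜ[ℂ] ((mode i m * mode i k) f) - Fermions.vac i i m k • u ⊗ₜ[ℂ] f := fun m k => by
    rw [Fermions.normal, fockFermions_ψ, fockFermions_ψ, ← TensorProduct.map_mul,
      mulLeft_gen_mul, gen_mul_self, LinearMap.mulLeft_one, LinearMap.sub_apply,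
      TensorProduct.map_tmul]
    rfl
  have hv' := congrArg (fun c : ℂ => c • (u ⊗ₜ[ℂ] f)) hv
  simp only [add_smul, sub_smul, ite_smul, one_smul, zero_smul] at hv'
  rw [hψ, hψ, sub_add_sub_comm, h, hv']
  abel

/-- Fermionic products `N` and bosonic ones `B` are tied by `N(k) + N(k+1) = B(k) - B(k+1)`. Summing
with weights `(-a)^(-k)` yields `(1 - a) ∑ N = (1 + a) ∑ B`, which can be divided by `1 - a` unless
`a = 1`; in that case the weight `k` recovers the lost information. -/
theorem vertexCoeff_eq_quad_diag (i : Fin ν) {a : ℂ} (ha : a ≠ 0) (n : ℤ) :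
    vertexCoeff i i a n = (fockFermions ν).quad i i a n := by
  rw [vertexCoeff, if_neg (not_not.2 rfl)]
  refine TensorProduct.ext' fun u f => ?_
  let N : ℤ → Fock ν := fun k => (fockFermions ν).normal i i (n - k) k (u ⊗ₜ f)
  let B : ℤ → Fock ν := fun k =>
    u ⊗ₜ[ℂ] biMode i i (n - k) k f - if n = 0 ∧ k = 0 then u ⊗ₜ[ℂ] f else 0
  have hN : Function.HasFiniteSupport N := by
    simpa using (fockFermions ν).normal_hasFiniteSupport i i n (fun _ => 1) (u ⊗ₜ f)
  have hd : Function.HasFiniteSupport fun k : ℤ =>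
      if n = 0 ∧ k = 0 then u ⊗ₜ[ℂ] f else 0 :=
    hasFiniteSupport_of_bounds 0 0 fun k hk => if_neg (by omega)
  have hb := tmul_hasFiniteSupport u (biMode_hasFiniteSupport i i n f)
  have hB : Function.HasFiniteSupport B := hb.fun_sub hd
  have hNB : ∀ k, N k + N (k + 1) = B k - B (k + 1) := fun k => normal_add_normal i n k u f
  have hsh : ∀ {g : ℤ → Fock ν}, Function.HasFiniteSupport g →
      Function.HasFiniteSupport fun k => g (k + 1) := fun hg =>
    hg.preimage (add_left_injective 1).injOn
  have hq : (fockFermions ν).quad i i a n (u ⊗ₜ f) = ∑ᶠ k, (-a) ^ (-k) • N k := rfl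
  by_cases h1 : a = 1
  · rw [if_pos h1, hq, h1]
    -- The factor 2 obtained here and the factor 2 of `finsum_derivative_biMode` make up the 4 in `4
    -- ε_i(z)`. The subtracted identity sits at `k = 0` and is killed by the weight `k`.
    have hs := (finsum_eq_two_smul_of_sub_shift (u := fun k => (-1 : ℂ) ^ (-k) • N k)
      (f := fun k => (-1 : ℂ) ^ (-k) • B k) (smul_hasFiniteSupport _ hN)
      (smul_hasFiniteSupport _ hB) fun k => by
        have hk : (-1 : ℂ) ^ (-(k + 1)) = -(-1) ^ (-k) := by
          rw [neg_add, zpow_add₀ (by norm_num)]; norm_num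
        have := congrArg ((-1 : ℂ) ^ (-k) • ·) (hNB k)
        simp only [smul_add, smul_sub] at this
        rw [hk, neg_smul, neg_smul, sub_neg_eq_add, this, sub_eq_add_neg]).2
    have e : ∀ k : ℤ, (k : ℂ) • (-1 : ℂ) ^ (-k) • B k =
        u ⊗ₜ[ℂ] (((k : ℂ) * (-1) ^ k) • biMode i i (n - k) k f) := fun k => by
      rw [smul_smul, neg_one_zpow_neg, smul_sub, TensorProduct.tmul_smul]
      split_ifs with h
      · rw [h.2]; simp
      · rw [smul_zero, sub_zero]
    rw [hs, finsum_congr e, ← tmul_finsum _ (smul_hasFiniteSupport _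
      (biMode_hasFiniteSupport i i n f)), finsum_derivative_biMode, LinearMap.smul_apply,
      TensorProduct.map_tmul, TensorProduct.tmul_smul, smul_smul]
    norm_num
  · have hna : -a ≠ 0 := neg_ne_zero.2 ha
    have h1' : 1 - a ≠ 0 := sub_ne_zero.2 (Ne.symm h1)
    -- The geometric weight turns a shift into multiplication by `-a`.
    have hshift : ∀ {g : ℤ → Fock ν}, ∑ᶠ k, (-a) ^ (-k) • g (k + 1) =
        (-a) • ∑ᶠ k, (-a) ^ (-k) • g k := fun {g} => by
      rw [smul_finsum, ← finsum_shift (fun k => (-a) • (-a) ^ (-k) • g k) 1]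
      refine finsum_congr fun k => ?_
      rw [smul_smul, ← zpow_one_add₀ hna]
      congr 2
      ring
    have hsum : (1 - a) • ∑ᶠ k, (-a) ^ (-k) • N k = (1 + a) • ∑ᶠ k, (-a) ^ (-k) • B k := by
      have h2 : ∑ᶠ k, ((-a) ^ (-k) • N k + (-a) ^ (-k) • N (k + 1)) =
          ∑ᶠ k, ((-a) ^ (-k) • B k - (-a) ^ (-k) • B (k + 1)) := finsum_congr fun k => by
        rw [← smul_add, hNB, smul_sub]
      rw [finsum_add_distrib (smul_hasFiniteSupport _ hN) (smul_hasFiniteSupport _ (hsh hN)),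
        finsum_sub_distrib (smul_hasFiniteSupport _ hB) (smul_hasFiniteSupport _ (hsh hB)),
        hshift, hshift] at h2
      rw [sub_smul, add_smul, one_smul, one_smul, sub_eq_add_neg, ← neg_smul, h2, neg_smul,
        sub_neg_eq_add]
    have hBsum : ∑ᶠ k, (-a) ^ (-k) • B k =
        u ⊗ₜ[ℂ] expCoeff i i a n f - if n = 0 then u ⊗ₜ[ℂ] f else 0 := by
      have e : ∀ k, (-a) ^ (-k) • B k = u ⊗ₜ[ℂ] ((-a) ^ (-k) • biMode i i (n - k) k f) -
          if n = 0 ∧ k = 0 then u ⊗ₜ[ℂ] f else 0 := fun k => by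
        rw [smul_sub, TensorProduct.tmul_smul]
        split_ifs with h
        · rw [h.2]; simp
        · rw [smul_zero]
      have hb' := tmul_hasFiniteSupport u
        (smul_hasFiniteSupport (fun k => (-a) ^ (-k)) (biMode_hasFiniteSupport i i n f))
      rw [finsum_congr e, finsum_sub_distrib hb' hd, ← tmul_finsum _ (smul_hasFiniteSupport _
        (biMode_hasFiniteSupport i i n f)), finsum_biMode i i ha,
        finsum_eq_single _ 0 (fun k hk => if_neg fun h => hk h.2)]
      simp
    rw [if_neg h1, hq]
    have := congrArg ((1 - a)⁻¹ • ·) hsum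
    simp only [smul_smul, inv_mul_cancel₀ h1', one_smul] at this
    rw [this, hBsum, LinearMap.smul_apply, LinearMap.sub_apply, TensorProduct.map_tmul,
      div_eq_inv_mul]
    split_ifs <;> rfl

theorem vertexCoeff_eq_quad (i j : Fin ν) {a : ℂ} (ha : a ≠ 0) (n : ℤ) :
    vertexCoeff i j a n = (fockFermions ν).quad i j a n := by
  by_cases h : i = j
  · subst h; exact vertexCoeff_eq_quad_diag i ha n
  · exact vertexCoeff_eq_quad_of_ne h ha n

end FockFermions

open TwistedGroupAlgebra

/-! ## The action of the unitary Lie algebra by quadratic expressions -/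

section UnitaryAction

variable {G : Type*} [AddCommGroup G] (σ : AddChar G ℂ) {ν : ℕ}

theorem matrix_monom_induction {p : Matrix (Fin ν) (Fin ν) (SkewLaurent σ) → Prop}
    (X : Matrix (Fin ν) (Fin ν) (SkewLaurent σ)) (h0 : p 0) (hadd : ∀ X Y, p X → p Y → p (X + Y))
    (hsmul : ∀ (c : ℂ) X, p X → p (c • X))
    (hsingle : ∀ i j m α, p (Matrix.single i j (monom σ m α))) : p X := by
  induction X using Matrix.induction_on' with
  | h_zero => exact h0
  | h_add X Y hX hY => exact hadd X Y hX hY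
  | h_std_basis i j x =>
    induction x using TwistedGroupAlgebra.induction with
    | h0 => rwa [Matrix.single_zero]
    | hadd f g hf hg => rw [Matrix.single_add]; exact hadd _ _ hf hg
    | hterm a x =>
      have := hsmul x _ (hsingle i j a.1 a.2)
      rwa [Matrix.smul_single, monom, TwistedGroupAlgebra.exp, smul_term, mul_one] at this

/-- The inclusion of `gl_ν(R_σ)` in its central extension. -/
def GlHat.ofMat : Matrix (Fin ν) (Fin ν) (SkewLaurent σ) →ₗ[ℂ] GlHat σ ν :=
  LinearMap.inl ℂ (Matrix (Fin ν) (Fin ν) (SkewLaurent σ)) ℂ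

/-- The map `X ↦ X - X*` from `gl_ν(R_σ)` to its central extension. -/
def GlHat.skewPart : Matrix (Fin ν) (Fin ν) (SkewLaurent σ) →ₗ[ℂ] GlHat σ ν where
  toFun X := GlHat.ofMat σ (X - X.conjTranspose)
  map_add' X Y := by
    rw [← map_add, Matrix.conjTranspose_add]
    congr 1; abel
  map_smul' c X := by
    have h : (c • X).conjTranspose = c • X.conjTranspose := by
      ext1 i j
      simp only [Matrix.conjTranspose_apply, Matrix.smul_apply, star_smul_skew]
    rw [h, ← smul_sub, map_smul, RingHom.id_apply]

theorem star_monom (m : ℤ) (α : G) :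
    star (monom σ m α) = (-σ α) ^ (-m) • monom σ m (-α) := by
  rw [star_eq_bar, monom, TwistedGroupAlgebra.exp, bar_term, monom, TwistedGroupAlgebra.exp,
    smul_term, one_mul, mul_one]

theorem GlHat.skewPart_single (i j : Fin ν) (m : ℤ) (α : G) :
    GlHat.skewPart σ (Matrix.single i j (monom σ m α)) =
      GlHat.unit σ ν i j m α - (-σ α) ^ (-m) • GlHat.unit σ ν j i m (-α) := by
  change GlHat.ofMat σ _ = GlHat.ofMat σ _ - (-σ α) ^ (-m) • GlHat.ofMat σ _
  rw [Matrix.conjTranspose_single, star_monom, map_sub, ← Matrix.smul_single, map_smul]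
  rfl

variable {V : Type*} [AddCommGroup V] [Module ℂ V] (F : Fermions (Fin ν) V)

/-- The linear map `E_ij t^m e^α ↦ (1/2) Ỹ_ij(σ(α), m)`, for the quadratic expressions `Ỹ`. -/
def matQuad : Matrix (Fin ν) (Fin ν) (SkewLaurent σ) →ₗ[ℂ] Module.End ℂ V :=
  ∑ i, ∑ j, lift (skewBichar σ) (fun p => (2 : ℂ)⁻¹ • F.quad' i j (σ p.2) p.1) ∘ₗ
    Matrix.entryLinearMap ℂ (SkewLaurent σ) i j

theorem matQuad_single (i j : Fin ν) (m : ℤ) (α : G) :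
    matQuad σ F (Matrix.single i j (monom σ m α)) = (2 : ℂ)⁻¹ • F.quad' i j (σ α) m := by
  rw [matQuad, LinearMap.sum_apply, Finset.sum_eq_single i, LinearMap.sum_apply,
    Finset.sum_eq_single j]
  · rw [LinearMap.comp_apply, Matrix.entryLinearMap_apply, Matrix.single_apply_same, monom,
      TwistedGroupAlgebra.exp, lift_term, one_smul]
  · intro k _ hk
    rw [LinearMap.comp_apply, Matrix.entryLinearMap_apply, Matrix.single_apply_of_ne _ _ _ _ _
      (fun h => hk h.2.symm), map_zero]
  · simp
  · intro k _ hk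
    rw [LinearMap.sum_apply]
    refine Finset.sum_eq_zero fun l _ => ?_
    rw [LinearMap.comp_apply, Matrix.entryLinearMap_apply, Matrix.single_apply_of_ne _ _ _ _ _
      (fun h => hk h.1.symm), map_zero]
  · simp

/-- The extension of `matQuad` to the central extension, with `c ↦ 1`. -/
def hatQuad : GlHat σ ν →ₗ[ℂ] Module.End ℂ V :=
  LinearMap.coprod (matQuad σ F) (LinearMap.toSpanSingleton ℂ (Module.End ℂ V) 1)

theorem hatQuad_ofMat (X : Matrix (Fin ν) (Fin ν) (SkewLaurent σ)) :
    hatQuad σ F (GlHat.ofMat σ X) = matQuad σ F X := by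
  refine (LinearMap.coprod_apply _ _ _).trans ?_
  change matQuad σ F X + LinearMap.toSpanSingleton ℂ (Module.End ℂ V) 1 0 = _
  rw [map_zero, add_zero]

theorem hatQuad_unit (i j : Fin ν) (m : ℤ) (α : G) :
    hatQuad σ F (GlHat.unit σ ν i j m α) = (2 : ℂ)⁻¹ • F.quad' i j (σ α) m :=
  (hatQuad_ofMat σ F _).trans (matQuad_single σ F i j m α)

theorem hatQuad_central : hatQuad σ F (GlHat.central σ ν) = 1 := by
  refine (LinearMap.coprod_apply _ _ _).trans ?_
  change matQuad σ F 0 + LinearMap.toSpanSingleton ℂ (Module.End ℂ V) 1 1 = _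
  rw [map_zero, zero_add, LinearMap.toSpanSingleton_apply, one_smul]

theorem hatQuad_apply (x : GlHat σ ν) : hatQuad σ F x = matQuad σ F x.mat + x.2 • 1 := rfl

/-- The central term of `quadBracket` is twice the cocycle, which is why `c ↦ 1` goes with the
factor `1/2` on the quadratic expressions. -/
theorem hatQuad_lie_unit (i j k l : Fin ν) (m n : ℤ) (α β : G) :
    hatQuad σ F ⁅GlHat.unit σ ν i j m α, GlHat.unit σ ν k l n β⁆ =
      (2 : ℂ)⁻¹ • F.quadBracket i j (σ α) m k l (σ β) n := by
  rw [GlHat.lie_unit, Fermions.quadBracket, map_add, map_sub, smul_add, smul_sub]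
  congr 1
  · congr 1
    · split_ifs
      · rw [map_smul, hatQuad_unit, AddChar.map_add_eq_mul, smul_comm]
      · rw [map_zero, smul_zero]
    · split_ifs
      · rw [map_smul, hatQuad_unit, AddChar.map_add_eq_mul, smul_comm]
      · rw [map_zero, smul_zero]
  · split_ifs
    · rw [map_smul, hatQuad_central, smul_smul, inv_mul_cancel_left₀ two_ne_zero]
    · rw [map_zero, smul_zero]

/-- By bilinearity this is `quad'_comm` on matrix units: its two brackets belong to `E_ij t^m e^α`
and to the negative of its adjoint. The map is thus not a representation of the full matrix algebra.
-/
theorem matQuad_comm (X Y : Matrix (Fin ν) (Fin ν) (SkewLaurent σ)) :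
    matQuad σ F X * matQuad σ F Y - matQuad σ F Y * matQuad σ F X =
      hatQuad σ F ⁅GlHat.skewPart σ X, GlHat.ofMat σ Y⁆ := by
  induction X using matrix_monom_induction with
  | h0 => simp
  | hadd X X' hX hX' =>
    rw [map_add, map_add, add_lie, map_add, ← hX, ← hX', add_mul, mul_add]
    abel
  | hsmul c X hX =>
    rw [map_smul, map_smul, smul_lie, map_smul, ← hX, smul_mul_assoc, mul_smul_comm, smul_sub]
  | hsingle i j m α =>
    induction Y using matrix_monom_induction with
    | h0 => simp
    | hadd Y Y' hY hY' =>
      rw [map_add, map_add, lie_add, map_add, ← hY, ← hY', add_mul, mul_add]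
      abel
    | hsmul c Y hY =>
      rw [map_smul, map_smul, lie_smul, map_smul, ← hY, smul_mul_assoc, mul_smul_comm, smul_sub]
    | hsingle k l n β =>
      rw [GlHat.skewPart_single, sub_lie, smul_lie, map_sub, map_smul]
      change _ = hatQuad σ F ⁅GlHat.unit σ ν i j m α, GlHat.unit σ ν k l n β⁆ - (-σ α) ^ (-m) •
        hatQuad σ F ⁅GlHat.unit σ ν j i m (-α), GlHat.unit σ ν k l n β⁆
      rw [hatQuad_lie_unit, hatQuad_lie_unit, matQuad_single, matQuad_single, smul_mul_smul_comm,
        smul_mul_smul_comm, ← smul_sub,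
        F.quad'_comm i j (char_ne_zero σ α) m k l (char_ne_zero σ β) n, char_neg,
        neg_zpow_eq (σ α), neg_one_zpow_neg, smul_comm _ (2 : ℂ)⁻¹, ← smul_sub, smul_smul,
        inv_mul_cancel_right₀ two_ne_zero]

theorem matQuad_conjTranspose_single (i j : Fin ν) (m : ℤ) (α : G) :
    matQuad σ F (Matrix.single j i (star (monom σ m α))) = -(2 : ℂ)⁻¹ • F.quad' i j (σ α) m := by
  rw [star_monom, ← Matrix.smul_single, map_smul, matQuad_single, char_neg, smul_comm,
    F.quad'_symm i j (char_ne_zero σ α), smul_neg, neg_smul]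

/-- The action of the unitary Lie algebra on a space with fermions. -/
def unitaryAction : UHat σ ν →ₗ[ℂ] Module.End ℂ V :=
  (2 : ℂ)⁻¹ • hatQuad σ F ∘ₗ (UHat σ ν).toSubmodule.subtype

theorem unitaryAction_apply (x : UHat σ ν) :
    unitaryAction σ F x = (2 : ℂ)⁻¹ • hatQuad σ F x := rfl

/-- For skew `X` the element `X - X*` of `matQuad_comm` is `2X`, and halving the map absorbs the
factor 2. -/
theorem unitaryAction_lie (x y : UHat σ ν) : unitaryAction σ F ⁅x, y⁆ =
    unitaryAction σ F x * unitaryAction σ F y - unitaryAction σ F y * unitaryAction σ F x := by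
  obtain ⟨x, hx⟩ := x
  obtain ⟨y, hy⟩ := y
  have hx' : GlHat.skewPart σ x.mat = (2 : ℂ) • GlHat.ofMat σ x.mat := by
    change GlHat.ofMat σ (x.mat - x.mat.conjTranspose) = _
    rw [show x.mat.conjTranspose = -x.mat from hx, sub_neg_eq_add, map_add, two_smul]
  have h := matQuad_comm σ F x.mat y.mat
  rw [hx', smul_lie, map_smul] at h
  change (2 : ℂ)⁻¹ • hatQuad σ F ⁅x, y⁆ = ((2 : ℂ)⁻¹ • hatQuad σ F x) *
    ((2 : ℂ)⁻¹ • hatQuad σ F y) - ((2 : ℂ)⁻¹ • hatQuad σ F y) * ((2 : ℂ)⁻¹ • hatQuad σ F x)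
  have h1 : ∀ (A B : Module.End ℂ V) (s t : ℂ),
      (A + s • 1) * (B + t • 1) - (B + t • 1) * (A + s • 1) = A * B - B * A := fun A B s t => by
    simp only [add_mul, mul_add, smul_mul_assoc, mul_smul_comm, one_mul, mul_one]
    rw [smul_add, smul_add, smul_comm s t]
    abel
  rw [smul_mul_smul_comm, smul_mul_smul_comm, ← smul_sub, hatQuad_apply σ F x,
    hatQuad_apply σ F y, h1, h, smul_smul, inv_mul_cancel_right₀ two_ne_zero]
  rfl

/-- The module structure given by the action. -/
abbrev unitaryLieRingModule : LieRingModule (UHat σ ν) V where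
  bracket x v := unitaryAction σ F x v
  add_lie x y v := by rw [map_add, LinearMap.add_apply]
  lie_add x v w := map_add _ _ _
  leibniz_lie x y v := by
    rw [unitaryAction_lie, LinearMap.sub_apply, Module.End.mul_apply, Module.End.mul_apply,
      sub_add_cancel]

theorem unitaryLieModule :
    letI := unitaryLieRingModule σ F
    LieModule ℂ (UHat σ ν) V :=
  letI := unitaryLieRingModule σ F
  { smul_lie := fun t x v => by
      change unitaryAction σ F (t • x) v = t • unitaryAction σ F x v
      rw [map_smul, LinearMap.smul_apply]
    lie_smul := fun t x v => map_smul _ _ _ }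

theorem unitaryAction_central : unitaryAction σ F (uCentral σ ν) = (2 : ℂ)⁻¹ • 1 := by
  rw [unitaryAction_apply]
  exact congrArg _ (hatQuad_central σ F)

theorem unitaryAction_two_smul_uElt (i j : Fin ν) (m : ℤ) (α : G) :
    unitaryAction σ F ((2 : ℂ) • uElt σ ν i j m α) = F.quad' i j (σ α) m := by
  rw [map_smul, unitaryAction_apply, smul_inv_smul₀ two_ne_zero]
  refine (hatQuad_ofMat σ F _).trans ?_
  refine (map_sub (matQuad σ F) _ _).trans ?_
  rw [matQuad_single, matQuad_conjTranspose_single, neg_smul, sub_neg_eq_add, ← add_smul]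
  norm_num

/-- A subspace stable under the quadratic expressions is stable under the Lie algebra. -/
theorem unitaryAction_mem {W : Submodule ℂ V}
    (hW : ∀ i j (α : G) m, ∀ v ∈ W, F.quad' i j (σ α) m v ∈ W) (x : UHat σ ν) {v : V}
    (hv : v ∈ W) : unitaryAction σ F x v ∈ W := by
  have h : ∀ X : Matrix (Fin ν) (Fin ν) (SkewLaurent σ), matQuad σ F X v ∈ W := fun X => by
    induction X using matrix_monom_induction with
    | h0 => simp
    | hadd X X' hX hX' => rw [map_add]; exact W.add_mem hX hX'
    | hsmul c X hX => rw [map_smul]; exact W.smul_mem _ hX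
    | hsingle i j m α => rw [matQuad_single]; exact W.smul_mem _ (hW i j α m v hv)
  rw [unitaryAction_apply, hatQuad_apply]
  exact W.smul_mem _ (W.add_mem (h _) (W.smul_mem _ hv))

end UnitaryAction

/-! ## The twisted group algebra and the spaces `V_ν(γ)` -/

section Components

/-- The element `x` moves to the right, altering each factor it passes, until the factor with index
`i` absorbs it. -/
theorem mul_prod_ofFn {A : Type*} [Ring A] [Algebra ℂ A] (x : A) (c : ℂ) {n : ℕ} (f g : Fin n → A)
    (i : Fin n) (hlt : ∀ j < i, x * f j = g j * x) (heq : x * f i = c • g i)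
    (hgt : ∀ j, i < j → f j = g j) : x * (List.ofFn f).prod = c • (List.ofFn g).prod := by
  induction n with
  | zero => exact i.elim0
  | succ n ih =>
    rw [List.ofFn_succ, List.ofFn_succ, List.prod_cons, List.prod_cons]
    cases i using Fin.cases with
    | zero =>
      have : (fun j : Fin n => f j.succ) = fun j => g j.succ :=
        funext fun j => hgt _ (Fin.succ_pos j)
      rw [this, ← mul_assoc, heq, smul_mul_assoc]
    | succ i =>
      rw [← mul_assoc, hlt 0 (Fin.succ_pos i), mul_assoc,
        ih (fun j => f j.succ) (fun j => g j.succ) i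
          (fun j hj => hlt _ (Fin.succ_lt_succ_iff.2 hj)) heq
          (fun j hj => hgt _ (Fin.succ_lt_succ_iff.2 hj)), mul_smul_comm]

theorem sum_prod_ofFn {A : Type*} [Ring A] {n : ℕ} (f : Fin n → ℤˣ → A)
    (hf : ∀ j, f j 1 + f j (-1) = 2) :
    ∑ ρ : Fin n → ℤˣ, (List.ofFn fun j => f j (ρ j)).prod = 2 ^ n := by
  induction n with
  | zero => simp
  | succ n ih =>
    rw [← (Fin.consEquiv fun _ : Fin (n + 1) => ℤˣ).sum_comp, Fintype.sum_prod_type]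
    have e : ∀ (s : ℤˣ) (ρ : Fin n → ℤˣ), (List.ofFn fun j =>
        f j ((Fin.consEquiv fun _ : Fin (n + 1) => ℤˣ) (s, ρ) j)).prod =
        f 0 s * (List.ofFn fun j => f j.succ (ρ j)).prod := fun s ρ => by
      rw [List.ofFn_succ, List.prod_cons]
      rfl
    simp only [e, ← Finset.mul_sum, ih (fun j => f j.succ) (fun j => hf _)]
    rw [← Finset.sum_mul, pow_succ']
    congr 1
    rw [← hf 0]
    exact Finset.sum_pair (by decide)

variable {ν : ℕ}

/-- The coefficient of `e^(ε_j)` in `w_j(ρ)`. -/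
def wCoeff (j : Fin ν) (ρ : ℤˣ) : ℂ := (if Even j.val then Complex.I else 1) * ((ρ : ℤ) : ℂ)

theorem wFactor_eq (j : Fin ν) (ρ : ℤˣ) : wFactor j ρ = 1 + wCoeff j ρ • gen j := rfl

theorem wCoeff_neg (j : Fin ν) (ρ : ℤˣ) : wCoeff j (-ρ) = -wCoeff j ρ := by
  simp [wCoeff]

theorem unit_sq (ρ : ℤˣ) : ((ρ : ℤ) : ℂ) * ((ρ : ℤ) : ℂ) = 1 := by
  rcases Int.units_eq_one_or ρ with rfl | rfl <;> simp

theorem wCoeff_mul_self (j : Fin ν) (ρ : ℤˣ) :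
    wCoeff j ρ * wCoeff j ρ = if Even j.val then -1 else 1 := by
  rw [wCoeff, mul_mul_mul_comm, unit_sq, mul_one]
  split_ifs <;> simp

theorem wCoeff_ne_zero (j : Fin ν) (ρ : ℤˣ) : wCoeff j ρ ≠ 0 := fun h => by
  have := wCoeff_mul_self j ρ
  rw [h, zero_mul] at this
  split_ifs at this <;> norm_num at this

/-- The signs obtained from `ρ` by changing the signs with index at most `2 [i / 2]`. -/
def flipTo (i : Fin ν) (ρ : Fin ν → ℤˣ) : Fin ν → ℤˣ :=
  fun j => if j.val < 2 * (i.val / 2) + 1 then -ρ j else ρ j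

theorem gen_mul_wFactor_of_ne {i j : Fin ν} (h : i ≠ j) (ρ : ℤˣ) :
    gen i * wFactor j ρ = wFactor j (-ρ) * gen i := by
  rw [wFactor_eq, wFactor_eq, mul_add, add_mul, mul_one, one_mul, mul_smul_comm, gen_anticomm h,
    wCoeff_neg, smul_neg, neg_smul, neg_mul, smul_mul_assoc]

theorem gen_mul_wFactor (i : Fin ν) (ρ : ℤˣ) :
    gen i * wFactor i ρ = wCoeff i ρ • wFactor i (if Even i.val then -ρ else ρ) := by
  rw [wFactor_eq, wFactor_eq, mul_add, mul_one, mul_smul_comm, gen_mul_self, smul_add, smul_smul,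
    add_comm]
  congr 1
  have h := wCoeff_mul_self i ρ
  split_ifs at h ⊢
  · rw [wCoeff_neg, mul_neg, h, neg_neg, one_smul]
  · rw [h, one_smul]

/-- Anticommutation flips every sign with index below `i`. The factor at `i` absorbs the generator,
and its own sign flips exactly when the square of its coefficient is `-1`, that is for even `i`. In
both cases the flipped indices run from 0 to `2 [i / 2]`. -/
theorem gen_mul_wVec (i : Fin ν) (ρ : Fin ν → ℤˣ) :
    gen i * wVec ρ = wCoeff i (ρ i) • wVec (flipTo i ρ) := by
  refine mul_prod_ofFn _ _ _ _ i (fun j hj => ?_) ?_ (fun j hj => ?_)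
  · rw [gen_mul_wFactor_of_ne hj.ne', flipTo, if_pos]
    have : j.val < i.val := hj
    omega
  · rw [gen_mul_wFactor]
    congr 2
    rw [flipTo]
    refine if_congr ?_ rfl rfl
    rw [Nat.even_iff]
    omega
  · rw [flipTo, if_neg]
    have : i.val < j.val := hj
    omega

theorem gen_mul_gen_mul_wVec (i j : Fin ν) (ρ : Fin ν → ℤˣ) : gen i * gen j * wVec ρ =
    (wCoeff j (ρ j) * wCoeff i (flipTo j ρ i)) • wVec (flipTo i (flipTo j ρ)) := by
  rw [mul_assoc, gen_mul_wVec, mul_smul_comm, gen_mul_wVec, smul_smul]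

theorem flipTo_flipTo_self {i j : Fin ν} (h : i.val / 2 = j.val / 2) (ρ : Fin ν → ℤˣ) :
    flipTo i (flipTo j ρ) = ρ := by
  ext k
  rw [flipTo, flipTo, h]
  split_ifs <;> simp

/-- The element `e^(ε_(2k)) e^(ε_(2k+1))` acts diagonally. -/
theorem gen_mul_gen_mul_wVec_self {i j : Fin ν} (hi : Even i.val) (hj : j.val = i.val + 1)
    (ρ : Fin ν → ℤˣ) :
    gen i * gen j * wVec ρ = (-Complex.I * (((ρ i * ρ j : ℤˣ) : ℤ) : ℂ)) • wVec ρ := by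
  have hi' := Nat.even_iff.1 hi
  rw [gen_mul_gen_mul_wVec, flipTo_flipTo_self (by omega)]
  congr 1
  rw [flipTo, if_pos (by omega), wCoeff_neg, wCoeff, wCoeff, if_neg (by rw [Nat.even_iff]; omega),
    if_pos hi]
  push_cast
  ring

/-! ### The basis `w(ρ)` -/

theorem bichar_ne_zero {A : Type*} [AddCommGroup A] (ε : Bichar A) (a b : A) :
    ε.toFun a b ≠ 0 := fun h => by
  have := ε.add_left a (-a) b
  rw [add_neg_cancel, ε.zero_left, h, zero_mul] at this
  exact one_ne_zero this

/-- A subspace stable under left multiplication by the generators that contains `1` is everything. -/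
theorem eq_top_of_gen_mul_mem {W : Submodule ℂ (GroupAlg ν)} (h1 : (1 : GroupAlg ν) ∈ W)
    (hW : ∀ i, ∀ x ∈ W, gen i * x ∈ W) : W = ⊤ := by
  have h : ∀ (a : Fin ν → ZMod 2) (s : Finset (Fin ν)),
      TwistedGroupAlgebra.exp (epsilon ν) (∑ i ∈ s, Pi.single i (a i)) ∈ W := fun a s => by
    induction s using Finset.induction_on with
    | empty => exact h1
    | insert i s hi ih =>
      rw [Finset.sum_insert hi]
      have ha : a i = 0 ∨ a i = 1 := by
        generalize a i = x
        revert x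
        decide
      rcases ha with h0 | h0
      · rwa [h0, Pi.single_zero, zero_add]
      · have h2 := hW i _ ih
        have h3 : reduct (basisVec i) = Pi.single i 1 := by
          ext j
          rw [reduct, basisVec, Pi.single_apply, Pi.single_apply]
          split_ifs <;> simp
        rw [gen, expBar, TwistedGroupAlgebra.exp, TwistedGroupAlgebra.exp, term_mul_term, h3,
          mul_one, mul_one] at h2
        rw [h0]
        have h4 := W.smul_mem
          ((epsilon ν).toFun (Pi.single i 1) (∑ i ∈ s, Pi.single i (a i)))⁻¹ h2
        rwa [smul_term, inv_mul_cancel₀ (bichar_ne_zero _ _ _)] at h4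
  refine eq_top_iff.2 fun f _ => ?_
  induction f using TwistedGroupAlgebra.induction with
  | h0 => exact W.zero_mem
  | hadd f g hf hg => exact W.add_mem (hf trivial) (hg trivial)
  | hterm a x =>
    have := W.smul_mem x (h a Finset.univ)
    rwa [Finset.univ_sum_single, TwistedGroupAlgebra.exp, smul_term, mul_one] at this

/-- The unit is the average of all `w(ρ)`, since the two choices in each factor add up to 2, and the
span is stable under the generators. -/
theorem span_range_wVec : Submodule.span ℂ (Set.range (wVec (ν := ν))) = ⊤ := by
  refine eq_top_of_gen_mul_mem ?_ fun i x hx => ?_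
  · have h : ∑ ρ : Fin ν → ℤˣ, wVec ρ = 2 ^ ν := sum_prod_ofFn wFactor fun j => by
      rw [wFactor_eq, wFactor_eq, wCoeff_neg, neg_smul, add_add_add_comm, add_neg_cancel, add_zero,
        one_add_one_eq_two]
    have h2 : (1 : GroupAlg ν) = ((2 : ℂ) ^ ν)⁻¹ • ∑ ρ : Fin ν → ℤˣ, wVec ρ := by
      rw [h, show (2 : GroupAlg ν) ^ ν = ((2 : ℂ) ^ ν) • 1 by
        rw [← Algebra.algebraMap_eq_smul_one, map_pow, map_ofNat],
        inv_smul_smul₀ (pow_ne_zero _ two_ne_zero)]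
    rw [h2]
    exact Submodule.smul_mem _ _
      (Submodule.sum_mem _ fun ρ _ => Submodule.subset_span (Set.mem_range_self ρ))
  · induction hx using Submodule.span_induction with
    | mem x hx =>
      obtain ⟨ρ, rfl⟩ := hx
      rw [gen_mul_wVec]
      exact Submodule.smul_mem _ _ (Submodule.subset_span (Set.mem_range_self _))
    | zero => rw [mul_zero]; exact Submodule.zero_mem _
    | add x y _ _ hx hy => rw [mul_add]; exact Submodule.add_mem _ hx hy
    | smul c x _ hx => rw [mul_smul_comm]; exact Submodule.smul_mem _ _ hx

theorem finrank_groupAlg : Module.finrank ℂ (GroupAlg ν) = 2 ^ ν := by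
  have h : Module.finrank ℂ ((Fin ν → ZMod 2) →₀ ℂ) = 2 ^ ν := by simp
  exact h

/-- The basis `w(ρ)` of the twisted group algebra. -/
def wBasis : Module.Basis (Fin ν → ℤˣ) ℂ (GroupAlg ν) :=
  basisOfTopLeSpanOfCardEqFinrank wVec span_range_wVec.ge (by
    rw [finrank_groupAlg]; simp)

theorem wBasis_apply (ρ : Fin ν → ℤˣ) : wBasis ρ = wVec ρ := by
  rw [wBasis, coe_basisOfTopLeSpanOfCardEqFinrank]

/-! ### The sign invariants -/

/-- The extension of the signs `ρ` by `1` to all indices. -/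
def extSign (ρ : Fin ν → ℤˣ) (k : ℕ) : ℤˣ := if h : k < ν then ρ ⟨k, h⟩ else 1

theorem extSign_val (ρ : Fin ν → ℤˣ) (k : Fin ν) : extSign ρ k.val = ρ k := dif_pos k.2

/-- The sign invariants `γ` of `ρ`. -/
def signInv (ρ : Fin ν → ℤˣ) (j : Fin (ν / 2 + 1)) : ℤˣ :=
  if j.val = 0 then extSign ρ 0 else extSign ρ (2 * j.val - 1) * extSign ρ (2 * j.val)

theorem signInv_zero (ρ : Fin ν → ℤˣ) : signInv ρ 0 = extSign ρ 0 := if_pos rfl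

/-- Extending `ρ` by 1 unifies the parities: for even `ν` the last pair consists of the last sign
and a sign 1 out of range, so the product condition becomes the condition on the last sign alone. -/
theorem signCond_iff (hν : 0 < ν) (γ : Fin (ν / 2 + 1) → ℤˣ) (ρ : Fin ν → ℤˣ) :
    SignCond γ ρ ↔ signInv ρ = γ := by
  constructor
  · rintro ⟨h1, h2, h3⟩
    ext1 j
    rw [signInv]
    split_ifs with hj
    · rw [extSign, dif_pos hν, h1 _ rfl]
      congr 1
      exact Fin.ext hj.symm
    · have hj2 := j.2
      rcases lt_or_ge (2 * j.val) ν with h | h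
      · rw [extSign, dif_pos (by omega), extSign, dif_pos h]
        exact h2 _ _ j (by omega) (by dsimp only; omega) rfl
      · have hev : ν = 2 * j.val := by omega
        rw [extSign, dif_pos (by omega), extSign, dif_neg (by omega), mul_one,
          h3 ⟨j.val, by omega⟩ _ (by dsimp only; omega)]
        congr 1
        refine Fin.ext ?_
        rw [Fin.val_last]
        omega
  · rintro rfl
    refine ⟨fun i hi => ?_, fun i k j hj hi hk => ?_, fun hev i hi => ?_⟩
    · rw [signInv_zero, ← hi, extSign_val]
    · rw [signInv, if_neg (by omega), ← hk, extSign_val, hk, show 2 * j.val - 1 = i.val by omega,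
        extSign_val]
    · have := Nat.even_iff.1 hev
      rw [signInv, Fin.val_last, if_neg (by omega), show 2 * (ν / 2) - 1 = i.val by omega,
        extSign_val, extSign, dif_neg (by omega), mul_one]

theorem compV_eq (hν : 0 < ν) (γ : Fin (ν / 2 + 1) → ℤˣ) :
    compV γ = Submodule.span ℂ (wVec '' {ρ | signInv ρ = γ}) := by
  rw [compV]
  congr 1
  ext x
  constructor
  · rintro ⟨ρ, h, rfl⟩
    exact ⟨ρ, (signCond_iff hν γ ρ).1 h, rfl⟩
  · rintro ⟨ρ, h, rfl⟩
    exact ⟨ρ, (signCond_iff hν γ ρ).2 h, rfl⟩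

theorem extSign_flipTo (i : Fin ν) (ρ : Fin ν → ℤˣ) (k : ℕ) :
    extSign (flipTo i ρ) k = if k < 2 * (i.val / 2) + 1 then -extSign ρ k else extSign ρ k := by
  have hi := i.2
  rw [extSign, extSign]
  by_cases h : k < ν
  · rw [dif_pos h, dif_pos h, flipTo]
  · rw [dif_neg h, dif_neg h, if_neg (by omega)]

/-- The flipped segment ends at an even index, so it contains both or neither of `2j - 1` and `2j`;
only the invariant attached to index 0 feels it. -/
theorem signInv_flipTo (i : Fin ν) (ρ : Fin ν → ℤˣ) (j : Fin (ν / 2 + 1)) :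
    signInv (flipTo i ρ) j = if j.val = 0 then -signInv ρ j else signInv ρ j := by
  rw [signInv, signInv, extSign_flipTo, extSign_flipTo, extSign_flipTo]
  split_ifs <;> first | rfl | omega | simp

theorem signInv_flipTo_flipTo (i j : Fin ν) (ρ : Fin ν → ℤˣ) :
    signInv (flipTo i (flipTo j ρ)) = signInv ρ := by
  ext1 k
  rw [signInv_flipTo, signInv_flipTo]
  split_ifs
  · rw [neg_neg]
  · rfl

theorem signInv_surjective (hν : 0 < ν) : Function.Surjective (signInv (ν := ν)) := fun γ => by
  -- The sign at index `2j - 1` carries the `j`-th invariant, and the signs at positive even indices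
  -- are 1.
  refine ⟨fun k => if k.val = 0 then γ 0 else
    if Even k.val then 1 else γ ⟨(k.val + 1) / 2, by have := k.2; omega⟩, funext fun j => ?_⟩
  rw [signInv]
  have hj2 := j.2
  split_ifs with hj
  · rw [extSign, dif_pos hν, if_pos rfl]
    congr 1
    exact Fin.ext hj.symm
  · have h1 : 2 * j.val - 1 < ν := by omega
    have h2 : ∀ s : ℤˣ, s = 1 → γ j * s = γ j := fun s hs => by rw [hs, mul_one]
    rw [extSign, dif_pos h1]
    dsimp only
    rw [if_neg (by omega), if_neg (by rw [Nat.even_iff]; omega)]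
    have h3 : (⟨(2 * j.val - 1 + 1) / 2, by omega⟩ : Fin (ν / 2 + 1)) = j := Fin.ext (by
      dsimp only; omega)
    rw [h3]
    refine h2 _ ?_
    rw [extSign]
    split_ifs with h4 h5 h6
    · dsimp only at h5; omega
    · rfl
    · exact absurd (even_two_mul _) h6
    · rfl

theorem gen_mul_gen_mul_mem_compV (hν : 0 < ν) {γ : Fin (ν / 2 + 1) → ℤˣ} (i j : Fin ν)
    {x : GroupAlg ν} (hx : x ∈ compV γ) : gen i * gen j * x ∈ compV γ := by
  rw [compV_eq hν] at *
  induction hx using Submodule.span_induction with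
  | mem x hx =>
    obtain ⟨ρ, hρ, rfl⟩ := hx
    rw [gen_mul_gen_mul_wVec]
    exact Submodule.smul_mem _ _ (Submodule.subset_span
      ⟨_, (signInv_flipTo_flipTo i j ρ).trans hρ, rfl⟩)
  | zero => rw [mul_zero]; exact Submodule.zero_mem _
  | add x y _ _ hx hy => rw [mul_add]; exact Submodule.add_mem _ hx hy
  | smul c x _ hx => rw [mul_smul_comm]; exact Submodule.smul_mem _ _ hx

/-! ### Irreducibility -/

/-- In a subspace stable under diagonal operators, the components of a vector for distinct systems
of eigenvalues belong to the subspace. -/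
theorem eigen_component_mem {ι κ V : Type*} [AddCommGroup V] [Module ℂ V] {N : Submodule ℂ V}
    (T : κ → Module.End ℂ V) (hT : ∀ k, ∀ x ∈ N, T k x ∈ N) (b : ι → V) (l : κ → ι → ℂ)
    (hb : ∀ k a, T k (b a) = l k a • b a) (s : Finset ι) (c : ι → ℂ)
    (hs : ∀ a ∈ s, ∀ a' ∈ s, (∀ k, l k a = l k a') → a = a')
    (h : ∑ a ∈ s, c a • b a ∈ N) : ∀ a ∈ s, c a • b a ∈ N := by
  classical
  induction s using Finset.induction_on generalizing c with
  | empty => simp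
  | insert a s ha ih =>
    have h1 : ∀ a' ∈ s, c a' • b a' ∈ N := fun a' ha' => by
      have hne : ¬ ∀ k, l k a' = l k a := fun h' => by
        have := hs a' (Finset.mem_insert_of_mem ha') a (Finset.mem_insert_self a s) h'
        exact ha (this ▸ ha')
      push Not at hne
      obtain ⟨k, hk⟩ := hne
      -- Subtracting the eigenvalue at `a` from an operator that distinguishes `a'` from `a` kills
      -- the component at `a` and keeps the one at `a'`.
      have h2 : ∑ a' ∈ s, ((l k a' - l k a) * c a') • b a' ∈ N := by
        have h3 := N.sub_mem (hT k _ h) (N.smul_mem (l k a) h)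
        rw [map_sum, Finset.smul_sum, ← Finset.sum_sub_distrib, Finset.sum_insert ha] at h3
        convert h3 using 1
        rw [map_smul, hb, smul_comm, sub_self, zero_add]
        refine Finset.sum_congr rfl fun x _ => ?_
        rw [map_smul, hb, smul_smul, smul_smul, ← sub_smul]
        congr 1; ring
      have h4 := ih (fun a' => (l k a' - l k a) * c a') (fun x hx y hy =>
        hs x (Finset.mem_insert_of_mem hx) y (Finset.mem_insert_of_mem hy)) h2 a' ha'
      have h5 := N.smul_mem (l k a' - l k a)⁻¹ h4
      rwa [smul_smul, inv_mul_cancel_left₀ (sub_ne_zero.2 hk)] at h5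
    intro x hx
    rcases Finset.mem_insert.1 hx with rfl | hx
    · rw [Finset.sum_insert ha] at h
      have := N.sub_mem h (N.sum_mem h1)
      rwa [add_sub_cancel_right] at this
    · exact h1 x hx

/-- The signs with given invariants are separated by the products `ρ_(2k) ρ_(2k+1)`. -/
theorem eq_of_signInv_eq {ρ ρ' : Fin ν → ℤˣ} (h : signInv ρ = signInv ρ')
    (hp : ∀ i j : Fin ν, Even i.val → j.val = i.val + 1 → ρ i * ρ j = ρ' i * ρ' j) : ρ = ρ' := by
  -- Each sign is determined by its predecessor: the step from an even index uses the given
  -- products, the step from an odd index uses the invariants.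
  have key : ∀ (n : ℕ) (k : Fin ν), k.val ≤ n → ρ k = ρ' k := fun n => by
    induction n with
    | zero =>
      intro k hk
      have := congrFun h 0
      rw [signInv_zero, signInv_zero] at this
      rw [← extSign_val ρ, ← extSign_val ρ', show k.val = 0 by omega, this]
    | succ n ih =>
      intro k hk
      rcases Nat.lt_or_ge k.val (n + 1) with h' | h'
      · exact ih k (by omega)
      have hk2 := k.2
      have hn := ih ⟨n, by omega⟩ le_rfl
      rcases Nat.even_or_odd n with he | ho
      · have := hp ⟨n, by omega⟩ k he (by dsimp only; omega)
        rw [hn] at this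
        exact mul_left_cancel this
      · obtain ⟨t, ht⟩ := ho
        have := congrFun h ⟨t + 1, by omega⟩
        rw [signInv, signInv, if_neg (by simp), if_neg (by simp)] at this
        dsimp only at this
        rw [show 2 * (t + 1) - 1 = (⟨n, by omega⟩ : Fin ν).val by dsimp only; omega,
          show 2 * (t + 1) = k.val by omega, extSign_val, extSign_val, extSign_val, extSign_val,
          hn] at this
        exact mul_left_cancel this
  exact funext fun k => key k.val k le_rfl

/-- The signs with given invariants are connected by changes of signs. -/
theorem exists_agree_of_flip_mem {S : Set (Fin ν → ℤˣ)}
    (hS : ∀ ρ ∈ S, ∀ i j, flipTo i (flipTo j ρ) ∈ S) {ρ ρ' : Fin ν → ℤˣ} (hρ : ρ ∈ S)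
    (h : signInv ρ = signInv ρ') (n : ℕ) :
    ∃ τ ∈ S, signInv τ = signInv ρ' ∧ ∀ k < 2 * n + 1, extSign τ k = extSign ρ' k := by
  induction n with
  | zero =>
    refine ⟨ρ, hρ, h, fun k hk => ?_⟩
    have := congrFun h 0
    rw [signInv_zero, signInv_zero] at this
    rw [show k = 0 by omega, this]
  | succ n ih =>
    obtain ⟨τ, hτ, hi, ha⟩ := ih
    have hstep : ∀ τ : Fin ν → ℤˣ, signInv τ = signInv ρ' →
        (∀ k < 2 * n + 1, extSign τ k = extSign ρ' k) →
        extSign τ (2 * n + 1) = extSign ρ' (2 * n + 1) →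
        ∀ k < 2 * (n + 1) + 1, extSign τ k = extSign ρ' k := fun τ hi ha h1 k hk => by
      rcases Nat.lt_or_ge k (2 * n + 1) with hk1 | hk1
      · exact ha k hk1
      rcases eq_or_ne k (2 * n + 1) with rfl | hk2
      · exact h1
      obtain rfl : k = 2 * (n + 1) := by omega
      by_cases hlt : 2 * (n + 1) < ν
      · have := congrFun hi ⟨n + 1, by omega⟩
        rw [signInv, signInv, if_neg (by simp), if_neg (by simp)] at this
        dsimp only at this
        rw [show 2 * (n + 1) - 1 = 2 * n + 1 by omega, h1] at this
        exact mul_left_cancel this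
      · rw [extSign, extSign, dif_neg hlt, dif_neg hlt]
    by_cases h1 : extSign τ (2 * n + 1) = extSign ρ' (2 * n + 1)
    · exact ⟨τ, hτ, hi, hstep τ hi ha h1⟩
    -- Otherwise the sign at `2n + 1` is out of range or is itself the last invariant, so it agrees
    -- already.
    · have hlt : 2 * n + 2 < ν := by
        by_contra hlt
        refine h1 ?_
        rcases Nat.lt_or_ge (2 * n + 1) ν with h2 | h2
        · have := congrFun hi ⟨n + 1, by omega⟩
          rw [signInv, signInv, if_neg (by simp), if_neg (by simp)] at this
          dsimp only at this
          have e : ∀ ρ : Fin ν → ℤˣ, extSign ρ (2 * (n + 1)) = 1 := fun ρ => dif_neg (by omega)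
          rwa [e, e, mul_one, mul_one, show 2 * (n + 1) - 1 = 2 * n + 1 by omega] at this
        · rw [extSign, extSign, dif_neg (by omega), dif_neg (by omega)]
      -- The composition flips precisely the indices `2n + 1` and `2n + 2`.
      refine ⟨flipTo ⟨2 * n, by omega⟩ (flipTo ⟨2 * n + 2, hlt⟩ τ), hS _ hτ _ _,
        (signInv_flipTo_flipTo _ _ _).trans hi, hstep _ ((signInv_flipTo_flipTo _ _ _).trans hi)
          (fun k hk => ?_) ?_⟩
      · rw [extSign_flipTo, extSign_flipTo]
        dsimp only
        rw [if_pos (by omega), if_pos (by omega), neg_neg, ha k hk]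
      · rw [extSign_flipTo, extSign_flipTo]
        dsimp only
        rw [if_neg (by omega), if_pos (by omega)]
        rcases Int.units_eq_one_or (extSign τ (2 * n + 1)) with h2 | h2 <;>
          rcases Int.units_eq_one_or (extSign ρ' (2 * n + 1)) with h3 | h3 <;>
          simp_all

/-- The space `V_ν(γ)` is irreducible under the products `e^(ε_i) e^(ε_j)`. -/
theorem compV_le_of_gen_mul_gen_mul_mem (hν : 0 < ν) {γ : Fin (ν / 2 + 1) → ℤˣ}
    {W : Submodule ℂ (GroupAlg ν)} (hγ : W ≤ compV γ) (h0 : W ≠ ⊥)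
    (hW : ∀ i j, ∀ x ∈ W, gen i * gen j * x ∈ W) : compV γ ≤ W := by
  obtain ⟨ρ, hργ, hρ⟩ : ∃ ρ, signInv ρ = γ ∧ wVec ρ ∈ W := by
    obtain ⟨x, hx, hx0⟩ := Submodule.exists_mem_ne_zero_of_ne_bot h0
    have hxγ := hγ hx
    rw [compV_eq hν, Finsupp.mem_span_image_iff_linearCombination] at hxγ
    obtain ⟨c, hc, rfl⟩ := hxγ
    have hc0 : c ≠ 0 := fun h => hx0 (by rw [h, map_zero])
    obtain ⟨ρ, hρ⟩ := Finsupp.support_nonempty_iff.2 hc0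
    refine ⟨ρ, hc hρ, ?_⟩
    -- These pairs give the diagonal products; their joint eigenvalues separate the basis vectors
    -- with equal invariants, so every `w(ρ)` occurring in `x` lies in `W`.
    let κ := {p : Fin ν × Fin ν // Even p.1.val ∧ p.2.val = p.1.val + 1}
    have h1 := eigen_component_mem (κ := κ) (N := W)
      (fun p => LinearMap.mulLeft ℂ (gen p.1.1 * gen p.1.2)) (fun p x hx => hW _ _ x hx) wVec
      (fun p ρ => -Complex.I * (((ρ p.1.1 * ρ p.1.2 : ℤˣ) : ℤ) : ℂ))
      (fun p ρ => gen_mul_gen_mul_wVec_self p.2.1 p.2.2 ρ) c.support c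
      (fun ρ hρ ρ' hρ' h => eq_of_signInv_eq ((hc hρ).trans (hc hρ').symm) fun i j hi hj => by
        have h2 := h ⟨(i, j), hi, hj⟩
        have h3 := mul_left_cancel₀ (neg_ne_zero.2 Complex.I_ne_zero) h2
        exact Units.ext (by exact_mod_cast h3)) hx ρ hρ
    have h2 := W.smul_mem (c ρ)⁻¹ h1
    rwa [inv_smul_smul₀ (Finsupp.mem_support_iff.1 hρ)] at h2
  rw [compV_eq hν, Submodule.span_le]
  rintro _ ⟨ρ', hρ', rfl⟩
  obtain ⟨τ, hτ, -, ha⟩ := exists_agree_of_flip_mem (S := {ρ | wVec ρ ∈ W}) (fun ρ hρ i j => by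
    have h1 := hW i j _ hρ
    rw [gen_mul_gen_mul_wVec] at h1
    have h2 := W.smul_mem (wCoeff j (ρ j) * wCoeff i (flipTo j ρ i))⁻¹ h1
    rwa [inv_smul_smul₀ (mul_ne_zero (wCoeff_ne_zero _ _) (wCoeff_ne_zero _ _))] at h2)
    hρ (hργ.trans (Eq.symm hρ')) ν
  have : τ = ρ' := funext fun k => by
    rw [← extSign_val τ, ← extSign_val ρ', ha k.val (by have := k.2; omega)]
  exact this ▸ hτ

end Components

/-! ## Complete reducibility of the Fock space -/

section FockDecomposition

variable {ν : ℕ}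

/-- The coefficient of `w(ρ)` of an element of the Fock space. -/
def fockCoord (ρ : Fin ν → ℤˣ) : Fock ν →ₗ[ℂ] SymAlg ν :=
  (TensorProduct.lid ℂ (SymAlg ν)).toLinearMap ∘ₗ (wBasis.coord ρ).rTensor (SymAlg ν)

theorem fockCoord_tmul (ρ : Fin ν → ℤˣ) (u : GroupAlg ν) (f : SymAlg ν) :
    fockCoord ρ (u ⊗ₜ f) = wBasis.repr u ρ • f := rfl

theorem sum_tmul_fockCoord (v : Fock ν) : ∑ ρ, wVec ρ ⊗ₜ[ℂ] fockCoord ρ v = v := by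
  induction v using TensorProduct.induction_on with
  | zero => simp
  | tmul u f =>
    simp only [fockCoord_tmul, ← TensorProduct.smul_tmul]
    rw [← TensorProduct.sum_tmul]
    simp only [← wBasis_apply, Module.Basis.sum_repr]
  | add v w hv hw =>
    simp only [map_add, TensorProduct.tmul_add, Finset.sum_add_distrib, hv, hw]

theorem eq_zero_of_fockCoord_eq_zero {v : Fock ν} (h : ∀ ρ, fockCoord ρ v = 0) : v = 0 := by
  rw [← sum_tmul_fockCoord v]
  simp [h]

theorem fockCoord_map_id (ρ : Fin ν → ℤˣ) (T : Module.End ℂ (SymAlg ν)) (v : Fock ν) :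
    fockCoord ρ (TensorProduct.map LinearMap.id T v) = T (fockCoord ρ v) := by
  induction v using TensorProduct.induction_on with
  | zero => simp
  | tmul u f => rw [TensorProduct.map_tmul, fockCoord_tmul, fockCoord_tmul, map_smul]; rfl
  | add v w hv hw => simp only [map_add, hv, hw]

theorem tmul_mem_compFock {γ : Fin (ν / 2 + 1) → ℤˣ} {u : GroupAlg ν} (hu : u ∈ compV γ)
    (f : SymAlg ν) : u ⊗ₜ[ℂ] f ∈ compFock γ := ⟨⟨u, hu⟩ ⊗ₜ f, rfl⟩

theorem compFock_le {γ : Fin (ν / 2 + 1) → ℤˣ} {N : Submodule ℂ (Fock ν)}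
    (h : ∀ u ∈ compV γ, ∀ f, u ⊗ₜ[ℂ] f ∈ N) : compFock γ ≤ N := by
  rintro _ ⟨v, rfl⟩
  induction v using TensorProduct.induction_on with
  | zero => rw [map_zero]; exact N.zero_mem
  | tmul u f => exact h u.1 u.2 f
  | add v w hv hw => rw [map_add]; exact N.add_mem hv hw

theorem fockCoord_eq_zero_of_mem_compFock (hν : 0 < ν) {ρ : Fin ν → ℤˣ}
    {γ : Fin (ν / 2 + 1) → ℤˣ} (h : signInv ρ ≠ γ) : compFock γ ≤ LinearMap.ker (fockCoord ρ) := by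
  refine compFock_le fun u hu f => ?_
  rw [LinearMap.mem_ker, fockCoord_tmul]
  suffices wBasis.repr u ρ = 0 by rw [this, zero_smul]
  rw [compV_eq hν] at hu
  have : Submodule.span ℂ (wVec '' {ρ | signInv ρ = γ}) ≤ LinearMap.ker (wBasis.coord ρ) := by
    rw [Submodule.span_le]
    rintro _ ⟨ρ', hρ', rfl⟩
    have hne : ρ' ≠ ρ := fun h' => h (h' ▸ hρ')
    rw [SetLike.mem_coe, LinearMap.mem_ker, Module.Basis.coord_apply, ← wBasis_apply,
      Module.Basis.repr_self, Finsupp.single_eq_of_ne' hne]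
  exact this hu

theorem iSupIndep_compFock (hν : 0 < ν) :
    iSupIndep fun γ : Fin (ν / 2 + 1) → ℤˣ => (compFock γ : Submodule ℂ (Fock ν)) := by
  rw [iSupIndep_def]
  intro γ
  rw [Submodule.disjoint_def]
  intro v hv hv'
  refine eq_zero_of_fockCoord_eq_zero fun ρ => ?_
  by_cases h : signInv ρ = γ
  · have : (⨆ (γ') (_ : γ' ≠ γ), compFock γ') ≤ LinearMap.ker (fockCoord ρ) :=
      iSup₂_le fun γ' hγ' => fockCoord_eq_zero_of_mem_compFock hν fun h' => hγ' (h' ▸ h)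
    exact this hv'
  · exact fockCoord_eq_zero_of_mem_compFock hν h hv

theorem iSup_compFock (hν : 0 < ν) :
    ⨆ γ : Fin (ν / 2 + 1) → ℤˣ, (compFock γ : Submodule ℂ (Fock ν)) = ⊤ := by
  refine eq_top_iff.2 fun v _ => ?_
  rw [← sum_tmul_fockCoord v]
  refine Submodule.sum_mem _ fun ρ _ => ?_
  refine le_iSup (fun γ : Fin (ν / 2 + 1) → ℤˣ => (compFock γ : Submodule ℂ (Fock ν)))
    (signInv ρ) (tmul_mem_compFock ?_ _)
  rw [compV_eq hν]
  exact Submodule.subset_span ⟨ρ, rfl, rfl⟩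

theorem compFock_ne_bot (hν : 0 < ν) (γ : Fin (ν / 2 + 1) → ℤˣ) : compFock γ ≠ ⊥ := by
  obtain ⟨ρ, rfl⟩ := signInv_surjective hν γ
  intro h
  have h1 : wVec ρ ⊗ₜ[ℂ] (1 : SymAlg ν) ∈ compFock (signInv ρ) := tmul_mem_compFock (by
    rw [compV_eq hν]
    exact Submodule.subset_span ⟨ρ, rfl, rfl⟩) 1
  rw [h, Submodule.mem_bot] at h1
  have h2 := congrArg (fockCoord ρ) h1
  rw [map_zero, fockCoord_tmul, ← wBasis_apply, Module.Basis.repr_self, Finsupp.single_eq_same,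
    one_smul] at h2
  exact one_ne_zero h2

/-! ### Stability under the vertex operators -/

/-- On the group algebra a vertex operator acts by a product of two generators or by the identity,
and both preserve the sign invariants. -/
theorem vertexCoeff_mem_compFock (hν : 0 < ν) {γ : Fin (ν / 2 + 1) → ℤˣ} (i j : Fin ν) (a : ℂ)
    (n : ℤ) {v : Fock ν} (hv : v ∈ compFock γ) : vertexCoeff i j a n v ∈ compFock γ := by
  have hid : ∀ T : Module.End ℂ (SymAlg ν), ∀ w ∈ compFock γ,
      TensorProduct.map LinearMap.id T w ∈ compFock γ := fun T w hw => by
    have : compFock γ ≤ (compFock γ).comap (TensorProduct.map LinearMap.id T) :=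
      compFock_le fun u hu f => tmul_mem_compFock hu (T f)
    exact this hw
  rw [vertexCoeff]
  split_ifs with h1 h2 h3
  · have : compFock γ ≤ (compFock γ).comap (TensorProduct.map
        (LinearMap.mulLeft ℂ (gen i * gen j)) (expCoeff i j a n)) :=
      compFock_le fun u hu f =>
        tmul_mem_compFock (gen_mul_gen_mul_mem_compV hν i j hu) (expCoeff i j a n f)
    have h := this hv
    have e : LinearMap.mulLeft ℂ (gen i * gen j) =
        (epsilon ν).toFun (reduct (basisVec i)) (reduct (basisVec j)) •
          LinearMap.mulLeft ℂ (expBar (basisVec i - basisVec j)) := by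
      refine LinearMap.ext fun x => ?_
      rw [gen_mul_gen, LinearMap.mulLeft_apply, smul_mul_assoc]
      rfl
    rwa [Submodule.mem_comap, e, TensorProduct.map_smul_left] at h
  · exact Submodule.smul_mem _ _ (hid _ v hv)
  · exact Submodule.smul_mem _ _ (Submodule.sub_mem _ (hid _ v hv) hv)
  · rw [sub_zero]
    exact Submodule.smul_mem _ _ (hid _ v hv)

theorem quad'_mem_compFock (hν : 0 < ν) {γ : Fin (ν / 2 + 1) → ℤˣ} (i j : Fin ν) {a : ℂ}
    (ha : a ≠ 0) (n : ℤ) {v : Fock ν} (hv : v ∈ compFock γ) :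
    (fockFermions ν).quad' i j a n v ∈ compFock γ := by
  rw [Fermions.quad', ← vertexCoeff_eq_quad i j ha]
  exact Submodule.add_mem _ (vertexCoeff_mem_compFock hν i j a n hv) (Submodule.smul_mem _ _ hv)

/-! ### Irreducibility -/

theorem osc_natCast (i : Fin ν) (k : ℕ) (f : SymAlg ν) :
    osc i (2 * k + 1) f = ((2 * k + 1 : ℂ) / 2) • MvPolynomial.pderiv (i, k) f := by
  rw [osc, if_pos ⟨k, rfl⟩, if_neg (by omega), LinearMap.smul_apply,
    show (2 * (k : ℤ) + 1).natAbs / 2 = k by omega]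
  push_cast
  rfl

theorem osc_neg_natCast (i : Fin ν) (k : ℕ) (f : SymAlg ν) :
    osc i (-(2 * k + 1)) f = MvPolynomial.X (i, k) * f := by
  rw [osc, if_pos ((show Odd (2 * (k : ℤ) + 1) from ⟨k, rfl⟩).neg), if_pos (by omega),
    show (-(2 * (k : ℤ) + 1)).natAbs / 2 = k by omega]
  rfl

theorem eq_C_of_pderiv_eq_zero {ι : Type*} {f : MvPolynomial ι ℂ}
    (h : ∀ p, MvPolynomial.pderiv p f = 0) : f = MvPolynomial.C (MvPolynomial.coeff 0 f) := by
  classical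
  ext s
  rw [MvPolynomial.coeff_C]
  split_ifs with hs
  · rw [hs]
  · obtain ⟨p, hp⟩ := Finsupp.ne_iff.1 (Ne.symm hs)
    rw [Finsupp.zero_apply] at hp
    have h1 := congrArg (MvPolynomial.coeff (s - Finsupp.single p 1)) (h p)
    have hle : Finsupp.single p 1 ≤ s := by
      rw [Finsupp.single_le_iff]; omega
    rw [MvPolynomial.coeff_pderiv, tsub_add_cancel_of_le hle, MvPolynomial.coeff_zero] at h1
    exact (mul_eq_zero.1 h1).resolve_right (Nat.cast_add_one_ne_zero _)

theorem wtLE_mono {m n : ℤ} (h : m ≤ n) {f : SymAlg ν} (hf : f ∈ wtLE m) : f ∈ wtLE n := by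
  rw [wtLE, MvPolynomial.mem_restrictSupport_iff] at *
  exact hf.trans fun s hs => le_trans hs h

/-- A non-zero subspace stable under the oscillators contains a non-zero element `u ⊗ 1`. -/
theorem exists_tmul_one_mem {N : Submodule ℂ (Fock ν)}
    (hN : ∀ i n, ∀ v ∈ N, TensorProduct.map LinearMap.id (osc i n) v ∈ N) (h0 : N ≠ ⊥) :
    ∃ u : GroupAlg ν, u ≠ 0 ∧ u ⊗ₜ[ℂ] (1 : SymAlg ν) ∈ N := by
  have key : ∀ (n : ℕ) (v : Fock ν), v ∈ N → v ≠ 0 → (∀ ρ, fockCoord ρ v ∈ wtLE (n : ℤ)) →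
      ∃ u : GroupAlg ν, u ≠ 0 ∧ u ⊗ₜ[ℂ] (1 : SymAlg ν) ∈ N := fun n => by
    induction n using Nat.strong_induction_on with | _ n ih => ?_
    intro v hv hv0 hw
    -- Either all derivatives vanish, so that every coordinate of `v` is a constant, or some
    -- annihilation operator yields a non-zero vector of smaller weight in `N`.
    by_cases hd : ∀ i (k : ℕ), TensorProduct.map LinearMap.id (osc i (2 * k + 1)) v = 0
    · have hc : ∀ ρ, fockCoord ρ v = MvPolynomial.C (MvPolynomial.coeff 0 (fockCoord ρ v)) :=
        fun ρ => eq_C_of_pderiv_eq_zero fun p => by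
          have h := congrArg (fockCoord ρ) (hd p.1 p.2)
          rw [fockCoord_map_id, osc_natCast, map_zero, smul_eq_zero] at h
          refine h.resolve_left (div_ne_zero ?_ two_ne_zero)
          exact_mod_cast Nat.succ_ne_zero (2 * p.2)
      have e : v = (∑ ρ, MvPolynomial.coeff 0 (fockCoord ρ v) • wVec ρ) ⊗ₜ[ℂ] (1 : SymAlg ν) := by
        conv_lhs => rw [← sum_tmul_fockCoord v]
        rw [TensorProduct.sum_tmul]
        refine Finset.sum_congr rfl fun ρ _ => ?_
        conv_lhs => rw [hc ρ]
        rw [TensorProduct.smul_tmul, ← MvPolynomial.C_mul', mul_one]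
      refine ⟨_, fun h => hv0 ?_, e ▸ hv⟩
      rw [e, h, TensorProduct.zero_tmul]
    · push Not at hd
      obtain ⟨i, k, hik⟩ := hd
      have hw' : ∀ ρ, fockCoord ρ (TensorProduct.map LinearMap.id (osc i (2 * k + 1)) v) ∈
          wtLE ((n : ℤ) - (2 * k + 1)) := fun ρ => by
        rw [fockCoord_map_id]
        exact Lowers.osc i (by omega) _ _ (hw ρ)
      cases n with
      | zero =>
        exact absurd (eq_zero_of_fockCoord_eq_zero fun ρ => wtLE_neg (by omega) (hw' ρ)) hik
      | succ n =>
        exact ih n n.lt_succ_self _ (hN _ _ _ hv) hik fun ρ => wtLE_mono (by omega) (hw' ρ)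
  obtain ⟨v, hv, hv0⟩ := Submodule.exists_mem_ne_zero_of_ne_bot h0
  choose d hd using fun ρ => exists_mem_wtLE (fockCoord ρ v)
  exact key (∑ ρ, d ρ) v hv hv0 fun ρ => wtLE_mono (by
    exact_mod_cast Finset.single_le_sum (f := d) (fun _ _ => Nat.zero_le _) (Finset.mem_univ ρ))
    (hd ρ)

/-- Annihilation parts of positive degree kill the vacuum, and the constant terms of all
exponentials are 1. Zero modes of vertex operators therefore see only the group algebra on vectors
`u ⊗ 1`. -/
theorem expCoeff_one (i j : Fin ν) (a : ℂ) : expCoeff i j a 0 1 = 1 := by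
  have h1 : (1 : SymAlg ν) ∈ wtLE 0 := by
    rw [wtLE, MvPolynomial.mem_restrictSupport_iff]
    intro s hs
    have := Finset.mem_singleton.1
      (MvPolynomial.support_monomial_subset (s := (0 : Fin ν × ℕ →₀ ℕ)) (a := (1 : ℂ)) hs)
    rw [this]
    change wt 0 ≤ 0
    rw [wt, map_zero]
  refine (finsum_eq_single _ 0 fun l hl => ?_).trans ?_
  · have := wtLE_neg (by omega)
      ((SeriesLowers.expE (basisVec i) 1).mul (SeriesLowers.expE (-basisVec j) a) l 0 1 h1)
    rw [this, map_zero]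
  · simp [PowerSeries.coeff_mul, coeff_zero_expE]

/-- The vectors `u` with `u ⊗ 1` in `N` form a non-zero subspace of `V_ν(γ)` stable under `e^(ε_i)
e^(ε_j)`, hence all of it; creation operators then produce every `u ⊗ f`. The parameter `a = 1`
suffices. -/
theorem compFock_le_of_vertexCoeff_mem (hν : 0 < ν) {γ : Fin (ν / 2 + 1) → ℤˣ}
    {N : Submodule ℂ (Fock ν)} (hγ : N ≤ compFock γ) (h0 : N ≠ ⊥)
    (hN : ∀ i j n, ∀ v ∈ N, vertexCoeff i j 1 n v ∈ N) : compFock γ ≤ N := by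
  have hosc : ∀ i n, ∀ v ∈ N, TensorProduct.map LinearMap.id (osc i n) v ∈ N := fun i n v hv => by
    have h := N.smul_mem (4 : ℂ)⁻¹ (hN i i n v hv)
    rwa [vertexCoeff, if_neg (not_not.2 rfl), if_pos rfl, LinearMap.smul_apply,
      inv_smul_smul₀ (by norm_num)] at h
  let W : Submodule ℂ (GroupAlg ν) := N.comap ((TensorProduct.mk ℂ _ (SymAlg ν)).flip 1)
  have hmem : ∀ u : GroupAlg ν, u ∈ W ↔ u ⊗ₜ[ℂ] (1 : SymAlg ν) ∈ N := fun u => Iff.rfl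
  have hmul : ∀ u ∈ W, ∀ f : SymAlg ν, u ⊗ₜ[ℂ] f ∈ N := fun u hu f => by
    induction f using MvPolynomial.induction_on with
    | C r =>
      have h := N.smul_mem r ((hmem u).1 hu)
      rwa [← TensorProduct.tmul_smul, ← MvPolynomial.C_mul', mul_one] at h
    | add f g hf hg => rw [TensorProduct.tmul_add]; exact N.add_mem hf hg
    | mul_X f p hf =>
      have h := hosc p.1 (-(2 * p.2 + 1)) _ hf
      rwa [TensorProduct.map_tmul, osc_neg_natCast, mul_comm] at h
  have hWγ : W ≤ compV γ := fun u hu => by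
    have h := hγ ((hmem u).1 hu)
    rw [compV_eq hν, ← wBasis.sum_repr u]
    refine Submodule.sum_mem _ fun ρ _ => ?_
    by_cases hρ : signInv ρ = γ
    · rw [wBasis_apply]
      exact Submodule.smul_mem _ _ (Submodule.subset_span ⟨ρ, hρ, rfl⟩)
    · have h1 := fockCoord_eq_zero_of_mem_compFock hν hρ h
      rw [LinearMap.mem_ker, fockCoord_tmul, smul_eq_zero] at h1
      rw [h1.resolve_right one_ne_zero, zero_smul]
      exact Submodule.zero_mem _
  have hW0 : W ≠ ⊥ := by
    obtain ⟨u, hu, huN⟩ := exists_tmul_one_mem hosc h0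
    exact (Submodule.ne_bot_iff W).2 ⟨u, huN, hu⟩
  have hWg : ∀ i j, ∀ u ∈ W, gen i * gen j * u ∈ W := fun i j u hu => by
    by_cases hij : i = j
    · rwa [hij, gen_mul_self, one_mul]
    · have h := hN i j 0 _ ((hmem u).1 hu)
      rw [vertexCoeff, if_pos hij, LinearMap.smul_apply, TensorProduct.map_tmul, expCoeff_one,
        TensorProduct.smul_tmul', LinearMap.mulLeft_apply, ← smul_mul_assoc, ← gen_mul_gen] at h
      exact h
  have hle := compV_le_of_gen_mul_gen_mul_mem hν hWγ hW0 hWg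
  exact compFock_le fun u hu f => hmul u (hle hu) f

end FockDecomposition

end

end UnitaryVertex

/-! ### The main theorem. -/

open UnitaryVertex
open Classical in
theorem theorem3p5 (ν : ℕ) (hν : 2 ≤ ν) {G : Type*} [AddCommGroup G] (σ : AddChar G ℂ) :
    ∃ (_ : LieRingModule (UHat σ ν) (Fock ν)) (_ : LieModule ℂ (UHat σ ν) (Fock ν)),
      (∀ (i j : Fin ν) (m : ℤ) (α : G) (v : Fock ν),
        ⁅(2 : ℂ) • uElt σ ν i j m α, v⁆ = vertexCoeff i j (σ α) m v +
          if i = j ∧ σ α ≠ 1 ∧ m = 0 then ((1 + σ α) / (1 - σ α)) • v else 0) ∧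
      (∀ v : Fock ν, ⁅uCentral σ ν, v⁆ = (1 / 2 : ℂ) • v) ∧
      ComplementedLattice (LieSubmodule ℂ (UHat σ ν) (Fock ν)) ∧
      ∃ N : (Fin (ν / 2 + 1) → ℤˣ) → LieSubmodule ℂ (UHat σ ν) (Fock ν),
        (∀ γ, (N γ).toSubmodule = compFock γ) ∧
        DirectSum.IsInternal (fun γ => (N γ).toSubmodule) ∧
        ∀ γ, LieModule.IsIrreducible ℂ (UHat σ ν) (N γ) := by
  have hν0 : 0 < ν := by omega
  let := unitaryLieRingModule σ (fockFermions ν)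
  have := unitaryLieModule σ (fockFermions ν)
  have hbr : ∀ (x : UHat σ ν) (v : Fock ν), ⁅x, v⁆ = unitaryAction σ (fockFermions ν) x v :=
    fun _ _ => rfl
  have hgen : ∀ (i j : Fin ν) (m : ℤ) (α : G) (v : Fock ν),
      ⁅(2 : ℂ) • uElt σ ν i j m α, v⁆ = vertexCoeff i j (σ α) m v +
        if i = j ∧ σ α ≠ 1 ∧ m = 0 then ((1 + σ α) / (1 - σ α)) • v else 0 := fun i j m α v => by
    rw [hbr, unitaryAction_two_smul_uElt, Fermions.quad',
      ← vertexCoeff_eq_quad i j (char_ne_zero σ α), LinearMap.add_apply, LinearMap.smul_apply,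
      Module.End.one_apply, ite_smul, zero_smul]
  have hvert : ∀ (N : LieSubmodule ℂ (UHat σ ν) (Fock ν)) (i j : Fin ν) (n : ℤ),
      ∀ v ∈ N, vertexCoeff i j 1 n v ∈ N := fun N i j n v hv => by
    -- For `α = 0` the character value is 1, so there is no scalar correction and the vertex
    -- operator itself preserves `N`.
    have h := N.lie_mem (x := (2 : ℂ) • uElt σ ν i j n 0) hv
    rwa [hgen, AddChar.map_zero_eq_one, if_neg (fun h => h.2.1 rfl), add_zero] at h
  let N : (Fin (ν / 2 + 1) → ℤˣ) → LieSubmodule ℂ (UHat σ ν) (Fock ν) := fun γ =>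
    { compFock γ with
      lie_mem := fun {x v} hv => unitaryAction_mem σ (fockFermions ν)
        (fun i j α m v hv => quad'_mem_compFock hν0 i j (char_ne_zero σ α) m hv) x hv }
  have hN : ∀ γ, (N γ).toSubmodule = compFock γ := fun γ => rfl
  have hatom : ∀ γ (N' : LieSubmodule ℂ (UHat σ ν) (Fock ν)), N' ≤ N γ → N' ≠ ⊥ → N' = N γ :=
    fun γ N' hle h0 => le_antisymm hle
      (compFock_le_of_vertexCoeff_mem hν0 hle (fun h => h0 (by
        rwa [← LieSubmodule.toSubmodule_inj, LieSubmodule.bot_toSubmodule])) (hvert N'))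
  have hbot : ∀ γ, N γ ≠ ⊥ := fun γ h => compFock_ne_bot hν0 γ (by
    rw [← hN, h, LieSubmodule.bot_toSubmodule])
  refine ⟨inferInstance, inferInstance, hgen, fun v => ?_,
    complementedLattice_of_sSup_atoms_eq_top ?_, N, hN, ?_, fun γ => ?_⟩
  · rw [hbr, unitaryAction_central, one_div]
    rfl
  -- Each `N γ` is an atom in the lattice of submodules, and together they span the Fock space.
  · have htop : ⨆ γ, N γ = ⊤ := LieSubmodule.iSup_toSubmodule_eq_top.1 (iSup_compFock hν0)
    refine top_le_iff.1 (htop.ge.trans (iSup_le fun γ => le_sSup ⟨hbot γ, fun N' hlt => ?_⟩))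
    by_contra h0
    exact hlt.ne (hatom γ N' hlt.le h0)
  · exact (DirectSum.isInternal_submodule_iff_iSupIndep_and_iSup_eq_top _).2
      ⟨iSupIndep_compFock hν0, iSup_compFock hν0⟩
  · have : Nontrivial (N γ) := (LieSubmodule.nontrivial_iff_ne_bot ℂ (UHat σ ν) (Fock ν)).2 (hbot γ)
    refine LieModule.IsIrreducible.mk fun N' h0 => ?_
    -- A submodule of `N γ` is carried into the Fock space, where minimality of `N γ` applies.
    have h1 := hatom γ (N'.map (N γ).incl) LieSubmodule.map_incl_le (fun h => h0 ?_)
    · refine eq_top_iff.2 fun x _ => ?_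
      have hx : (x : Fock ν) ∈ N'.map (N γ).incl := h1.ge x.2
      obtain ⟨y, hy, hxy⟩ := hx
      exact (Subtype.ext hxy : y = x) ▸ hy
    · refine (LieSubmodule.eq_bot_iff N').2 fun x hx => ?_
      have hx' : (x : Fock ν) ∈ N'.map (N γ).incl := ⟨x, hx, rfl⟩
      rw [h, LieSubmodule.mem_bot] at hx'
      exact Subtype.ext hx'
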